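/- Let $\mathcal A$ be an arrangement of $N\ge 1$ distinct non-vertical real lines $\ell:\ y=a_\ell x+b_\ell$ and finitely many distinct vertical real lines $x=\xi$ in $\mathbb C^2$, with complement $M$. Let $\pi(x,y)=x$, let $S$ be the set of points lying on at least two lines, and let $B=\mathbb C\setminus\pi(S)$. For $x\in B$ let $F_x=\pi^{-1}(x)\cap M$. Let $\mathcal L$ be the rank-one complex local system on $M$ for which a small positive circle around a line acts by multiplication by a prescribed parameter in $\mathbb C^*$ of that line, and assume that the parameter of each non-vertical line is different from $1$. Put $\mathcal L_x=\mathcal L|_{F_x}$. For $x\in\mathbb R\cap B$ number the non-vertical lines $1,\dots,N$ according to increasing intersection with the real axis of $\pi^{-1}(x)$, and let $s^{(x)}_k$ be the parameter of the $k$-th line. Fix $y_0$ with $\operatorname{Im} y_0>0$, and let $\alpha^{(x)}_k$ be the loop in $F_x$ based at $(x,y_0)$ which descends along a straight segment to a point of a small circle around the intersection with the $k$-th line (the point of this circle just above that intersection), runs once counterclockwise around the circle, and returns along the segment. For $1\le i\le N-1$ let $$\alpha^{(x)}_{i,i+1}=\frac{\alpha^{(x)}_i}{1-s^{(x)}_i}-\frac{\alpha^{(x)}_{i+1}}{1-s^{(x)}_{i+1}}\in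 H_1(F_x;\mathcal L_x),$$ where the stalk of $\mathcal L$ at $(x,y_0)$ is identified with $\mathbb C$. Let $x,x'\in\mathbb R\cap B$ and let $\gamma$ be a path in $B$ from $x$ to $x'$ with $\gamma\cap\mathbb R=\{x,x'\}$ and $\operatorname{Im}(\gamma(u))\,(x-x')\ge 0$ for all $u$ (so $\gamma$ lies in the closed upper half-plane if $x>x'$ and in the closed lower half-plane if $x<x'$). Assume that $\operatorname{Im} y_0$ is so large that $\operatorname{Im}(a_\ell\gamma(u)+b_\ell)<\operatorname{Im} y_0$ for all $u$ and all non-vertical lines $\ell$, and identify the stalks of $\mathcal L$ at $(x,y_0)$ and $(x',y_0)$ by continuation along $u\mapsto(\gamma(u),y_0)$. Let $\sigma$ be the permutation such that the $i$-th line over $x$ is the $\sigma(i)$-th line over $x'$, and let $\sigma(i,i+1)=+1$ if $\sigma(i+1)>\sigma(i)$ and $-1$ otherwise. Then fibres can be transported along $\gamma$ (there is a homotopy $[0,1]\times F_x\to M$ over $(u,y)\mapsto\gamma(u)$ starting at the inclusion of $F_x$), and for every such transport the induced parallel transport $\tau(x,x'):H_1(F_x;\mathcal L_x)\to H_1(F_{x'};\mathcal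 L_{x'})$ satisfies, for all $1\le i\le N-1$, $$\tau(x,x')\bigl(\alpha^{(x)}_{i,i+1}\bigr)=\sigma(i,i+1)\sum_{j=\min(\sigma(i),\sigma(i+1))}^{\max(\sigma(i),\sigma(i+1))-1}\Bigl(\prod_{k>i,\ \sigma(k)\le j}s^{(x)}_k\Bigr)\,\alpha^{(x')}_{j,j+1}.$$ -/

import Mathlib

noncomputable section

/-- The quotient of a submodule `Z` by its intersection with a submodule `B`. -/
abbrev Subquotient {R M : Type*} [Ring R] [AddCommGroup M] [Module R M] (Z B : Submodule R M) :
    Type _ :=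
  Z ⧸ B.submoduleOf Z

/-! ### Rank-one local systems and homology with local coefficients -/

/-- A rank-one local system of `K`-vector spaces with stalk `K` at every point: a functor from the fundamental
groupoid to the one-object groupoid `Kˣ`. A path `p` from `a` to `b` carries the stalk at `a`
to the stalk at `b` by multiplication by a unit. -/
abbrev RankOneLocalSystem (K : Type*) [Field K] (X : Type*) [TopologicalSpace X] :=
  CategoryTheory.Functor (FundamentalGroupoid X) (CategoryTheory.SingleObj Kˣ)

namespace RankOneLocalSystem

open CategoryTheory

variable {K : Type*} [Field K] {X Y : Type*} [TopologicalSpace X] [TopologicalSpace Y]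

/-- The unit by which the path `p` carries the stalk at its source to the stalk at its target. -/
def along (L : RankOneLocalSystem K X) {a b : X} (p : Path a b) : Kˣ :=
  L.map (FundamentalGroupoid.fromPath (Path.Homotopic.Quotient.mk p))

theorem along_trans (L : RankOneLocalSystem K X) {a b c : X} (p : Path a b) (q : Path b c) :
    L.along (p.trans q) = L.along p * L.along q := by
  have h := L.map_comp (FundamentalGroupoid.fromPath (Path.Homotopic.Quotient.mk p))
    (FundamentalGroupoid.fromPath (Path.Homotopic.Quotient.mk q))
  rw [SingleObj.comp_as_mul, FundamentalGroupoid.comp_eq] at h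
  rw [mul_comm]
  exact h

theorem along_congr (L : RankOneLocalSystem K X) {a b : X} {p q : Path a b} (h : p.Homotopic q) :
    L.along p = L.along q := by
  unfold along
  rw [Path.Homotopic.Quotient.eq.2 h]

theorem along_eq_of_forall (L : RankOneLocalSystem K X) {a b a' b' : X} (p : Path a b)
    (q : Path a' b') (h : ∀ t, p t = q t) : L.along p = L.along q := by
  obtain rfl : a = a' := by simpa using h 0
  obtain rfl : b = b' := by simpa using h 1
  congr 1
  ext t
  exact h t

theorem along_refl (L : RankOneLocalSystem K X) (a : X) : L.along (Path.refl a) = 1 :=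
  L.map_id (FundamentalGroupoid.mk a)

theorem along_mul_along_symm (L : RankOneLocalSystem K X) {a b : X} (p : Path a b) :
    L.along p * L.along p.symm = 1 := by
  rw [← along_trans, ← L.along_refl a]
  exact (L.along_congr ⟨Path.Homotopy.reflTransSymm p⟩).symm

/-- The pull-back (for an inclusion: the restriction) of a local system. -/
def pullback (L : RankOneLocalSystem K Y) (f : C(X, Y)) : RankOneLocalSystem K X :=
  FundamentalGroupoid.map f ⋙ L

theorem along_pullback (L : RankOneLocalSystem K Y) (f : C(X, Y)) {a b : X} (p : Path a b) :
    (L.pullback f).along p = L.along (p.map f.continuous) := rfl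

/-- Singular `k`-simplices of `X`. -/
abbrev Simplex (X : Type*) [TopologicalSpace X] (k : ℕ) := C(stdSimplex ℝ (Fin (k + 1)), X)

/-- The leading vertex of a singular simplex. -/
def lead {k : ℕ} (σ : Simplex X k) : X := σ (stdSimplex.vertex 0)

/-- The `j`-th face of a singular simplex, opposite to the `j`-th vertex. -/
def face {k : ℕ} (j : Fin (k + 2)) (σ : Simplex X (k + 1)) : Simplex X k :=
  σ.comp ⟨stdSimplex.map j.succAbove, stdSimplex.continuous_map _⟩

/-- The leading edge of a singular simplex, running from vertex `0` to vertex `1`. -/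
def leadEdge {k : ℕ} (σ : Simplex X (k + 1)) :
    Path (σ (stdSimplex.vertex 0)) (σ (stdSimplex.vertex 1)) where
  toFun t := σ (stdSimplex.map ![0, 1] (stdSimplexHomeomorphUnitInterval.symm t))
  continuous_toFun := σ.continuous.comp ((stdSimplex.continuous_map _).comp
    stdSimplexHomeomorphUnitInterval.symm.continuous)
  source' := by
    have h : stdSimplexHomeomorphUnitInterval.symm 0 = stdSimplex.vertex 0 := by
      rw [Homeomorph.symm_apply_eq]; exact stdSimplexHomeomorphUnitInterval_zero.symm
    rw [h, stdSimplex.map_vertex]; rfl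
  target' := by
    have h : stdSimplexHomeomorphUnitInterval.symm 1 = stdSimplex.vertex 1 := by
      rw [Homeomorph.symm_apply_eq]; exact stdSimplexHomeomorphUnitInterval_one.symm
    rw [h, stdSimplex.map_vertex]; rfl

/-- Singular `k`-chains with coefficients in a rank-one local system: the coefficient of a simplex
is an element of the stalk `K` at its leading vertex. -/
abbrev Chain (K : Type*) [Field K] (X : Type*) [TopologicalSpace X] (k : ℕ) := Simplex X k →₀ K

/-- The coefficient factor of the `j`-th face: on the face opposite to the leading vertex the
coefficient is transported along the leading edge to the new leading vertex. -/
def faceFactor (L : RankOneLocalSystem K X) {k : ℕ} (j : Fin (k + 2)) (σ : Simplex X (k + 1)) : K :=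
  if j = 0 then (L.along (leadEdge σ) : K) else 1

/-- The boundary operator on singular chains with coefficients in `L`. -/
def boundary (L : RankOneLocalSystem K X) (k : ℕ) : Chain K X (k + 1) →ₗ[K] Chain K X k :=
  Finsupp.linearCombination K fun σ =>
    ∑ j : Fin (k + 2), Finsupp.single (face j σ) ((-1 : K) ^ (j : ℕ) * L.faceFactor j σ)

/-- The `1`-cycles with coefficients in `L`. -/
def cycles (L : RankOneLocalSystem K X) : Submodule K (Chain K X 1) := LinearMap.ker (L.boundary 0)

/-- The `1`-boundaries with coefficients in `L`. -/
def boundaries (L : RankOneLocalSystem K X) : Submodule K (Chain K X 1) :=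
  LinearMap.range (L.boundary 1)

/-- The first singular homology group of `X` with coefficients in `L`: cycles modulo
boundaries. -/
def H1 (L : RankOneLocalSystem K X) : Type _ := Subquotient L.cycles L.boundaries

instance (L : RankOneLocalSystem K X) : AddCommGroup L.H1 :=
  inferInstanceAs (AddCommGroup (Subquotient L.cycles L.boundaries))

instance (L : RankOneLocalSystem K X) : Module K L.H1 :=
  inferInstanceAs (Module K (Subquotient L.cycles L.boundaries))

/-- The homology class of a cycle. -/
def homologyClass (L : RankOneLocalSystem K X) : L.cycles →ₗ[K] L.H1 :=
  Submodule.mkQ _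
theorem mem_cycles (L : RankOneLocalSystem K X) (c : Chain K X 1) :
    c ∈ L.cycles ↔ L.boundary 0 c = 0 := LinearMap.mem_ker

/-- The singular `1`-simplex of a path. -/
def pathSimplex {a b : X} (p : Path a b) : Simplex X 1 :=
  (p : C(unitInterval, X)).comp stdSimplexHomeomorphUnitInterval

/-- The singular `0`-simplex of a point. -/
def pointSimplex (a : X) : Simplex X 0 := ContinuousMap.const _ a

theorem boundary_single (L : RankOneLocalSystem K X) {k : ℕ} (σ : Simplex X (k + 1)) (c : K) :
    L.boundary k (Finsupp.single σ c) =
      ∑ j : Fin (k + 2),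
        Finsupp.single (face j σ) (c * ((-1 : K) ^ (j : ℕ) * L.faceFactor j σ)) := by
  simp only [boundary, Finsupp.linearCombination_single, Finset.smul_sum, Finsupp.smul_single,
    smul_eq_mul]

theorem boundary_pathSimplex (L : RankOneLocalSystem K X) {a b : X} (p : Path a b) (c : K) :
    L.boundary 0 (Finsupp.single (pathSimplex p) c) =
      Finsupp.single (pointSimplex b) (c * (L.along p : K)) - Finsupp.single (pointSimplex a) c := by
  have h0 : face 0 (pathSimplex p) = pointSimplex b := by
    ext z
    obtain rfl : z = stdSimplex.vertex 0 := Subsingleton.elim _ _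
    simp only [face, pathSimplex, pointSimplex, ContinuousMap.comp_apply, ContinuousMap.coe_mk,
      stdSimplex.map_vertex, ContinuousMap.const_apply]
    exact p.target
  have h1 : face 1 (pathSimplex p) = pointSimplex a := by
    ext z
    obtain rfl : z = stdSimplex.vertex 0 := Subsingleton.elim _ _
    simp only [face, pathSimplex, pointSimplex, ContinuousMap.comp_apply, ContinuousMap.coe_mk,
      stdSimplex.map_vertex, ContinuousMap.const_apply]
    exact p.source
  have h2 : L.along (leadEdge (pathSimplex p)) = L.along p := by
    apply along_eq_of_forall
    intro t
    change p (stdSimplexHomeomorphUnitInterval (stdSimplex.map ![0, 1]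
      (stdSimplexHomeomorphUnitInterval.symm t))) = p t
    have : (![0, 1] : Fin 2 → Fin 2) = id := by ext i; fin_cases i <;> rfl
    rw [this, stdSimplex.map_id_apply, Homeomorph.apply_symm_apply]
  rw [boundary_single, Fin.sum_univ_two, h0, h1]
  simp [faceFactor, h2, sub_eq_add_neg]

/-! ### Functoriality -/

/-- Suppose that `f : X → Y` is continuous and that `u x` identifies the stalk of `L` at `x` with
the stalk of `L'` at `f x`. The induced map sends a simplex `σ` with coefficient `c` to the simplex
`f ∘ σ` with coefficient `u (lead σ) * c`. -/
def chainMap (f : C(X, Y)) (u : X → Kˣ) (k : ℕ) : Chain K X k →ₗ[K] Chain K Y k :=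
  Finsupp.linearCombination K fun σ => Finsupp.single (f.comp σ) (u (lead σ) : K)

theorem chainMap_single (f : C(X, Y)) (u : X → Kˣ) {k : ℕ} (σ : Simplex X k) (c : K) :
    chainMap f u k (Finsupp.single σ c) = Finsupp.single (f.comp σ) (c * (u (lead σ) : K)) := by
  simp [chainMap, Finsupp.linearCombination_single]

theorem lead_face_zero {k : ℕ} (σ : Simplex X (k + 1)) :
    lead (face 0 σ) = σ (stdSimplex.vertex 1) := by
  simp [lead, face]

theorem lead_face_succ {k : ℕ} (σ : Simplex X (k + 1)) (j : Fin (k + 1)) :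
    lead (face j.succ σ) = lead σ := by
  simp [lead, face]

theorem boundary_chainMap (L : RankOneLocalSystem K X) (L' : RankOneLocalSystem K Y) (f : C(X, Y))
    (u : X → Kˣ)
    (hu : ∀ {a b : X} (p : Path a b), L.along p * u b = u a * L'.along (p.map f.continuous))
    (k : ℕ) (c : Chain K X (k + 1)) :
    L'.boundary k (chainMap f u (k + 1) c) = chainMap f u k (L.boundary k c) := by
  induction c using Finsupp.induction_linear with
  | zero => simp
  | add c d hc hd => simp only [map_add, hc, hd]
  | single σ c =>
    rw [chainMap_single, boundary_single, boundary_single, map_sum]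
    refine Finset.sum_congr rfl fun j _ => ?_
    rw [chainMap_single]
    have hf : face j (f.comp σ) = f.comp (face j σ) := rfl
    rw [hf]
    congr 1
    refine Fin.cases ?_ (fun j => ?_) j
    · have h := hu (leadEdge σ)
      have h' : L'.along (leadEdge (f.comp σ)) = L'.along ((leadEdge σ).map f.continuous) := rfl
      have h'' : (L.along (leadEdge σ) : K) * u (σ (stdSimplex.vertex 1)) =
          u (lead σ) * L'.along (leadEdge (f.comp σ)) := by
        rw [h']; exact_mod_cast h
      rw [lead_face_zero]
      simp only [faceFactor, if_true, Fin.val_zero, pow_zero, one_mul]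
      rw [mul_assoc, mul_assoc, h'']
    · rw [lead_face_succ]
      simp only [faceFactor, Fin.succ_ne_zero, if_false]
      ring

/-- The map induced on first homology by a continuous map `f` together with compatible
identifications `u` of the stalks. -/
def mapH1 (L : RankOneLocalSystem K X) (L' : RankOneLocalSystem K Y) (f : C(X, Y)) (u : X → Kˣ)
    (hu : ∀ {a b : X} (p : Path a b), L.along p * u b = u a * L'.along (p.map f.continuous)) :
    L.H1 →ₗ[K] L'.H1 :=
  Submodule.mapQ _ _
    ((chainMap f u 1).restrict fun c hc => by
      rw [mem_cycles] at hc ⊢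
      rw [boundary_chainMap L L' f u hu, hc, map_zero])
    (by
      rintro ⟨c, hc⟩ ⟨d, hd⟩
      refine ⟨chainMap f u 2 d, ?_⟩
      rw [boundary_chainMap L L' f u hu, hd]
      rfl)

end RankOneLocalSystem

/-! ### Continuous variation of the logarithm along a path of nonzero complex numbers -/

/-- The total variation of a continuous logarithm along a path in `ℂ ∖ {0}`. -/
def logIncrement {a b : {z : ℂ // z ≠ 0}} (p : Path a b) : ℂ :=
  Complex.isCoveringMap_exp.liftPath p (Complex.log a)
    (Subtype.ext (by simp [Complex.exp_log a.2])) 1 - Complex.log a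

theorem logIncrement_eq {a b : {z : ℂ // z ≠ 0}} (p : Path a b) (g : C(unitInterval, ℂ))
    (hg : ∀ t, Complex.exp (g t) = p t) : logIncrement p = g 1 - g 0 := by
  have key : (g + ContinuousMap.const _ (Complex.log a - g 0)) =
      Complex.isCoveringMap_exp.liftPath p (Complex.log a)
        (Subtype.ext (by simp [Complex.exp_log a.2])) := by
    rw [Complex.isCoveringMap_exp.eq_liftPath_iff']
    refine ⟨?_, by simp⟩
    funext t
    apply Subtype.ext
    have h0 : Complex.exp (g 0) = a := by rw [hg]; simp
    simp only [Function.comp_apply, ContinuousMap.add_apply, ContinuousMap.const_apply]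
    rw [Complex.exp_add, Complex.exp_sub, Complex.exp_log a.2, h0, div_self a.2, mul_one, hg]
    rfl
  unfold logIncrement
  rw [← key]
  simp only [ContinuousMap.add_apply, ContinuousMap.const_apply]
  ring

theorem exists_log_lift {a b : {z : ℂ // z ≠ 0}} (p : Path a b) :
    ∃ g : C(unitInterval, ℂ), ∀ t, Complex.exp (g t) = p t := by
  refine ⟨Complex.isCoveringMap_exp.liftPath p (Complex.log a)
    (Subtype.ext (by simp [Complex.exp_log a.2])), fun t => ?_⟩
  exact congrArg Subtype.val (congrFun (Complex.isCoveringMap_exp.liftPath_lifts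
    (p : C(unitInterval, {z : ℂ // z ≠ 0})) (Complex.log a)
    (Subtype.ext (by simp [Complex.exp_log a.2]))) t)

theorem logIncrement_refl (a : {z : ℂ // z ≠ 0}) : logIncrement (Path.refl a) = 0 := by
  rw [logIncrement_eq (Path.refl a) (ContinuousMap.const _ (Complex.log a))
    (fun t => by simp [Complex.exp_log a.2])]
  simp

theorem logIncrement_trans {a b c : {z : ℂ // z ≠ 0}} (p : Path a b) (q : Path b c) :
    logIncrement (p.trans q) = logIncrement p + logIncrement q := by
  obtain ⟨g, hg⟩ := exists_log_lift p
  obtain ⟨h, hh⟩ := exists_log_lift q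
  let P : Path (g 0) (g 1) := ⟨g, rfl, rfl⟩
  let Q : Path (g 1) (h 1 - h 0 + g 1) := ⟨h + ContinuousMap.const _ (g 1 - h 0), by simp,
    by simp; ring⟩
  have e : Complex.exp (g 1 - h 0) = 1 := by
    rw [Complex.exp_sub, hg, hh]; simp [div_self b.2]
  rw [logIncrement_eq (p.trans q) (P.trans Q : C(unitInterval, ℂ)) ?_, logIncrement_eq p g hg,
    logIncrement_eq q h hh]
  · simp only [ContinuousMap.coe_coe, Path.source, Path.target]
    ring
  · intro t
    simp only [ContinuousMap.coe_coe, Path.trans_apply]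
    split_ifs
    · exact hg _
    · change Complex.exp (h _ + (g 1 - h 0)) = _
      rw [Complex.exp_add, e, mul_one, hh]

theorem logIncrement_congr {a b : {z : ℂ // z ≠ 0}} {p q : Path a b} (h : p.Homotopic q) :
    logIncrement p = logIncrement q := by
  unfold logIncrement
  congr 1
  exact Complex.isCoveringMap_exp.liftPath_apply_one_eq_of_homotopicRel h _ _ _

/-! ### Real line arrangements -/

/-- An arrangement of `n` distinct non-vertical real lines `y = aᵢ x + bᵢ` and of `m` distinct
vertical real lines `x = ξⱼ` in `ℂ²`. -/
structure LineArrangement (n m : ℕ) where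
  /-- the slopes `aᵢ` -/
  slope : Fin n → ℝ
  /-- the intercepts `bᵢ` -/
  intercept : Fin n → ℝ
  /-- the abscissae `ξⱼ` of the vertical lines -/
  vert : Fin m → ℝ
  lines_injective : Function.Injective fun i => (slope i, intercept i)
  vert_injective : Function.Injective vert

namespace LineArrangement

variable {n m : ℕ} (A : LineArrangement n m)

/-- The ordinate over `x` of the `i`-th non-vertical line. -/
def height (i : Fin n) (x : ℂ) : ℂ := A.slope i * x + A.intercept i

/-- The affine form defining a line of the arrangement. -/
def form : Fin n ⊕ Fin m → ℂ × ℂ → ℂ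
  | Sum.inl i, p => p.2 - A.height i p.1
  | Sum.inr j, p => p.1 - A.vert j

/-- The complement of the arrangement in `ℂ²`. -/
def compl : Set (ℂ × ℂ) := {p | ∀ l, A.form l p ≠ 0}

/-- The singular points of the arrangement: the points lying on at least two lines. -/
def sing : Set (ℂ × ℂ) := {p | ∃ l l', l ≠ l' ∧ A.form l p = 0 ∧ A.form l' p = 0}

/-- The base of the fibration: the complement in `ℂ` of the projection of the singular points. -/
def base : Set ℂ := (Prod.fst '' A.sing)ᶜ

/-- The fibre over `x`: the line `{x} × ℂ` minus the arrangement. -/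
abbrev fibre (x : ℂ) : Type := {y : ℂ // (x, y) ∈ A.compl}

/-- The inclusion of a fibre into the complement of the arrangement. -/
def incl (x : ℂ) : C(A.fibre x, A.compl) where
  toFun y := ⟨(x, y.1), y.2⟩

theorem continuous_form (l : Fin n ⊕ Fin m) : Continuous (A.form l) := by
  rcases l with i | j
  · change Continuous fun p : ℂ × ℂ => p.2 - (A.slope i * p.1 + A.intercept i)
    fun_prop
  · change Continuous fun p : ℂ × ℂ => p.1 - A.vert j
    fun_prop

/-- The affine form of a line, as a nowhere vanishing function on the complement. -/
def unitForm (l : Fin n ⊕ Fin m) : C(A.compl, {z : ℂ // z ≠ 0}) where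
  toFun p := ⟨A.form l p.1, p.2 l⟩
  continuous_toFun := ((A.continuous_form l).comp continuous_subtype_val).subtype_mk _

/-! ### The local system with given parameters -/

/-- The factor by which a path acts on the stalk `ℂ`: the product over all lines `l` of
`exp (log (ρ l) * Δ_l / (2πi))`, where `Δ_l` is the total variation along the path of a continuous
logarithm of the affine form of `l`. On a closed path the factor of `l` is `ρ l ^ w`, where `w` is
the winding number around `l`; the choice of `log (ρ l)` only changes the local system by an
isomorphism. -/
def pathFactor (ρ : Fin n ⊕ Fin m → ℂˣ) {a b : A.compl} (p : Path a b) : ℂˣ :=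
  Units.mk0 (∏ l, Complex.exp (Complex.log (ρ l : ℂ) *
      (logIncrement (p.map (A.unitForm l).continuous) / (2 * Real.pi * Complex.I))))
    (Finset.prod_ne_zero_iff.2 fun _ _ => Complex.exp_ne_zero _)

theorem coe_pathFactor (ρ : Fin n ⊕ Fin m → ℂˣ) {a b : A.compl} (p : Path a b) :
    (A.pathFactor ρ p : ℂ) = ∏ l, Complex.exp (Complex.log (ρ l : ℂ) *
      (logIncrement (p.map (A.unitForm l).continuous) / (2 * Real.pi * Complex.I))) := rfl

theorem pathFactor_refl (ρ : Fin n ⊕ Fin m → ℂˣ) (a : A.compl) :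
    A.pathFactor ρ (Path.refl a) = 1 := by
  apply Units.ext
  simp only [pathFactor, Units.val_mk0, Units.val_one]
  refine Finset.prod_eq_one fun l _ => ?_
  have : (Path.refl a).map (A.unitForm l).continuous = Path.refl (A.unitForm l a) := rfl
  rw [this, logIncrement_refl]
  simp

theorem pathFactor_trans (ρ : Fin n ⊕ Fin m → ℂˣ) {a b c : A.compl} (p : Path a b)
    (q : Path b c) : A.pathFactor ρ (p.trans q) = A.pathFactor ρ p * A.pathFactor ρ q := by
  apply Units.ext
  simp only [pathFactor, Units.val_mk0, Units.val_mul]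
  rw [← Finset.prod_mul_distrib]
  refine Finset.prod_congr rfl fun l _ => ?_
  rw [Path.map_trans, logIncrement_trans, ← Complex.exp_add]
  congr 1
  ring

theorem pathFactor_congr (ρ : Fin n ⊕ Fin m → ℂˣ) {a b : A.compl} {p q : Path a b}
    (h : p.Homotopic q) : A.pathFactor ρ p = A.pathFactor ρ q := by
  apply Units.ext
  simp only [pathFactor, Units.val_mk0]
  refine Finset.prod_congr rfl fun l _ => ?_
  rw [logIncrement_congr (h.map (A.unitForm l))]

/-- The abelian local system on the complement of the arrangement for which a positive small
circle around the `i`-th non-vertical line acts as multiplication by `s i`, and one around the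
`j`-th vertical line as multiplication by `t j`. -/
def localSystem (s : Fin n → ℂˣ) (t : Fin m → ℂˣ) : RankOneLocalSystem ℂ A.compl where
  obj _ := CategoryTheory.SingleObj.star _
  map {_ _} := Quotient.lift (A.pathFactor (Sum.elim s t)) fun _ _ h => A.pathFactor_congr _ h
  map_id a := A.pathFactor_refl _ a.as
  map_comp := by
    rintro _ _ _ ⟨p⟩ ⟨q⟩
    exact (A.pathFactor_trans _ p q).trans (mul_comm _ _)

theorem along_localSystem (s : Fin n → ℂˣ) (t : Fin m → ℂˣ) {a b : A.compl} (p : Path a b) :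
    (A.localSystem s t).along p = A.pathFactor (Sum.elim s t) p := rfl

/-- The restriction of the local system to a fibre. -/
def fibreSystem (s : Fin n → ℂˣ) (t : Fin m → ℂˣ) (x : ℂ) : RankOneLocalSystem ℂ (A.fibre x) :=
  (A.localSystem s t).pullback (A.incl x)

theorem along_fibreSystem (s : Fin n → ℂˣ) (t : Fin m → ℂˣ) (x : ℂ) {a b : A.fibre x}
    (p : Path a b) : (A.fibreSystem s t x).along p =
      A.pathFactor (Sum.elim s t) (p.map (A.incl x).continuous) := by
  rw [fibreSystem, RankOneLocalSystem.along_pullback, along_localSystem]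

/-! ### Parallel transport -/

/-- A transport of fibres along a path `γ` from `x` to `x'`: a lift of the homotopy
`(t, y) ↦ γ t` on `[0, 1] × F_x` to the complement of the arrangement, starting at the inclusion
of `F_x`. At time `1` it defines a map from `F_x` to `F_{x'}`. -/
structure FibreTransport {x x' : ℂ} (γ : Path x x') where
  /-- the resulting map between the fibres -/
  endMap : C(A.fibre x, A.fibre x')
  /-- the lifted homotopy -/
  lift : (A.incl x).Homotopy ((A.incl x').comp endMap)
  fst_lift : ∀ t y, (lift (t, y)).1.1 = γ t

/-- The parallel transport `H₁(F_x; L_x) → H₁(F_{x'}; L_{x'})` defined by a transport of fibres.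
A simplex is moved by the lifted homotopy, and its coefficient is continued along the track of its
leading vertex. -/
def FibreTransport.onH1 {A : LineArrangement n m} {x x' : ℂ} {γ : Path x x'}
    (T : A.FibreTransport γ) (s : Fin n → ℂˣ) (t : Fin m → ℂˣ) :
    (A.fibreSystem s t x).H1 →ₗ[ℂ] (A.fibreSystem s t x').H1 :=
  RankOneLocalSystem.mapH1 _ _ T.endMap (fun y => (A.localSystem s t).along (T.lift.evalAt y))
    (by
      intro a b p
      have h := (A.localSystem s t).along_congr (Path.Homotopic.map_trans_evalAt T.lift p)
      rw [RankOneLocalSystem.along_trans, RankOneLocalSystem.along_trans] at h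
      exact h)

/-! ### The generators -/

/-- `A.lineAt x k` is the `k`-th line over the real point `x`, in the order of increasing
ordinates. -/
def lineAt (x : ℝ) : Equiv.Perm (Fin n) :=
  Tuple.sort fun i => A.slope i * x + A.intercept i

/-- The permutation of positions between two real fibres: the `i`-th line over `x` is the
`perm x x' i`-th line over `x'`. -/
def perm (x x' : ℝ) : Equiv.Perm (Fin n) := (A.lineAt x).trans (A.lineAt x').symm

/-- `r` is smaller than all the distances between the ordinates of the lines over `x`. -/
def IsSmallRadius (x r : ℝ) : Prop :=
  0 < r ∧ ∀ i j : Fin n, i ≠ j →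
    r < |(A.slope i * x + A.intercept i) - (A.slope j * x + A.intercept j)|

theorem vert_ne_of_mem_base [NeZero n] {x : ℂ} (hx : x ∈ A.base) (j : Fin m) : x ≠ A.vert j := by
  rintro rfl
  apply hx
  exact ⟨(A.vert j, A.height 0 (A.vert j)), ⟨Sum.inl 0, Sum.inr j, by simp, by simp [form],
    by simp [form]⟩, rfl⟩

theorem mem_compl_of_mem_base [NeZero n] {x : ℂ} (hx : x ∈ A.base) {y : ℂ}
    (hy : ∀ i, y ≠ A.height i x) : (x, y) ∈ A.compl := by
  rintro (i | j)
  · exact sub_ne_zero.2 (hy i)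
  · exact sub_ne_zero.2 (A.vert_ne_of_mem_base hx j)

theorem height_ofReal (i : Fin n) (x : ℝ) :
    A.height i x = ((A.slope i * x + A.intercept i : ℝ) : ℂ) := by
  simp [height]

theorem ne_height_of_im_pos (x : ℝ) {y : ℂ} (hy : 0 < y.im) (i : Fin n) : y ≠ A.height i x := by
  rintro rfl
  rw [height_ofReal] at hy
  simp at hy

theorem circle_ne_height {x r : ℝ} {z : ℂ} (hz : ‖z‖ = 1) (k i : Fin n) (hr : A.IsSmallRadius x r) :
    A.height k x + r * z ≠ A.height i x := by
  intro h
  have h1 : (r : ℂ) * z = A.height i x - A.height k x := by rw [← h]; ring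
  rcases eq_or_ne i k with rfl | hik
  · rw [sub_self, mul_eq_zero] at h1
    rcases h1 with h1 | h1
    · exact hr.1.ne' (by exact_mod_cast h1)
    · simp [h1] at hz
  · have h2 := congrArg norm h1
    rw [norm_mul, hz, mul_one, height_ofReal, height_ofReal, ← Complex.ofReal_sub,
      Complex.norm_real, Complex.norm_real, Real.norm_eq_abs, Real.norm_eq_abs,
      abs_of_pos hr.1] at h2
    exact (hr.2 i k hik).ne h2

section Generators

variable [NeZero n] {x : ℝ} (hx : (x : ℂ) ∈ A.base) {y₀ : ℂ} (hy₀ : 0 < y₀.im)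

/-- The base point of a real fibre, of ordinate `y₀` in the upper half-plane. -/
def basePoint : A.fibre x :=
  ⟨y₀, A.mem_compl_of_mem_base hx (A.ne_height_of_im_pos x hy₀)⟩

variable {r : ℝ} (hr : A.IsSmallRadius x r)

/-- The point at distance `r` above the intersection of the `k`-th line with the fibre. -/
def topPoint (k : Fin n) : A.fibre x :=
  ⟨A.height k x + r * Complex.I, A.mem_compl_of_mem_base hx
    fun i => A.circle_ne_height Complex.norm_I k i hr⟩

/-- The straight segment in a real fibre from the base point to a point just above the `k`-th
line. -/
def descent (k : Fin n) : Path (A.basePoint hx hy₀) (A.topPoint hx hr k) where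
  toFun t := ⟨(1 - (t : ℝ)) * y₀ + (t : ℝ) * (A.height k x + r * Complex.I),
    A.mem_compl_of_mem_base hx (A.ne_height_of_im_pos x (by
      rw [height_ofReal]
      have h0 := t.2.1
      have h1 := t.2.2
      have hr0 := hr.1
      have e : ((1 - ((t : ℝ) : ℂ)) * y₀ + ((t : ℝ) : ℂ) *
          (((A.slope k * x + A.intercept k : ℝ) : ℂ) + r * Complex.I)).im =
          (1 - (t : ℝ)) * y₀.im + (t : ℝ) * r := by
        simp [-Complex.ofReal_add, -Complex.ofReal_mul]
      rw [e]
      rcases h1.lt_or_eq with h | h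
      · have := mul_pos (sub_pos.2 h) hy₀
        have := mul_nonneg h0 hr0.le
        linarith
      · rw [h]; simpa using hr0))⟩
  continuous_toFun := by fun_prop
  source' := by apply Subtype.ext; simp [basePoint]
  target' := by apply Subtype.ext; simp [topPoint]

/-- The circle of radius `r` around the `k`-th line, run once counterclockwise from its
highest point. -/
def circle (k : Fin n) : Path (A.topPoint hx hr k) (A.topPoint hx hr k) where
  toFun t := ⟨A.height k x +
      r * (Complex.I * Complex.exp ((2 * Real.pi * (t : ℝ) : ℝ) * Complex.I)),
    A.mem_compl_of_mem_base hx fun i => A.circle_ne_height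
      (by rw [norm_mul, Complex.norm_I, Complex.norm_exp_ofReal_mul_I, mul_one]) k i hr⟩
  continuous_toFun := by fun_prop
  source' := by apply Subtype.ext; simp [topPoint]
  target' := by apply Subtype.ext; simp [topPoint]

/-- The elementary loop around the `k`-th line in a real fibre. -/
def loop (k : Fin n) : Path (A.basePoint hx hy₀) (A.basePoint hx hy₀) :=
  ((A.descent hx hy₀ hr k).trans (A.circle hx hr k)).trans (A.descent hx hy₀ hr k).symm

end Generators

section Monodromy

variable [NeZero n] {x : ℝ} (hx : (x : ℂ) ∈ A.base) {y₀ : ℂ} (hy₀ : 0 < y₀.im) {r : ℝ}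
  (hr : A.IsSmallRadius x r)

theorem logIncrement_circle_self (k : Fin n) :
    logIncrement (((A.circle hx hr k).map (A.incl x).continuous).map
      (A.unitForm (Sum.inl k)).continuous) = 2 * Real.pi * Complex.I := by
  have hr0 : (r : ℂ) ≠ 0 := by exact_mod_cast hr.1.ne'
  rw [logIncrement_eq _ (⟨fun t : unitInterval => Complex.log (r * Complex.I) +
    (2 * Real.pi * (t : ℝ) : ℝ) * Complex.I, by fun_prop⟩ : C(unitInterval, ℂ))]
  · simp
  · intro t
    have h : ((((A.circle hx hr k).map (A.incl x).continuous).map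
      (A.unitForm (Sum.inl k)).continuous) t : ℂ) = (A.height k x +
      r * (Complex.I * Complex.exp ((2 * Real.pi * (t : ℝ) : ℝ) * Complex.I))) -
      A.height k x := rfl
    rw [h]
    simp only [ContinuousMap.coe_mk]
    rw [Complex.exp_add, Complex.exp_log (mul_ne_zero hr0 Complex.I_ne_zero)]
    ring

theorem logIncrement_circle_of_ne (k : Fin n) (l : Fin n ⊕ Fin m) (hl : l ≠ Sum.inl k) :
    logIncrement (((A.circle hx hr k).map (A.incl x).continuous).map
      (A.unitForm l).continuous) = 0 := by
  set p := ((A.circle hx hr k).map (A.incl x).continuous).map (A.unitForm l).continuous with hp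
  obtain ⟨w, hw0, hw⟩ : ∃ w : ℂ, w ≠ 0 ∧ ∀ t, ((p t : ℂ) / w) ∈ Complex.slitPlane := by
    rcases l with i | j
    · have hik : i ≠ k := fun h => hl (h ▸ rfl)
      have hlt := hr.2 k i hik.symm
      have hne : A.height k x - A.height i x ≠ 0 := by
        rw [height_ofReal, height_ofReal, ← Complex.ofReal_sub]
        exact_mod_cast abs_pos.1 (hr.1.trans hlt)
      refine ⟨_, hne, fun t => ?_⟩
      apply Complex.mem_slitPlane_of_norm_lt_one (z := (r * (Complex.I *
        Complex.exp ((2 * Real.pi * (t : ℝ) : ℝ) * Complex.I))) /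
          (A.height k x - A.height i x)) ?_ |> fun h => ?_
      · rw [norm_div, norm_mul, norm_mul, Complex.norm_I, Complex.norm_exp_ofReal_mul_I,
          height_ofReal, height_ofReal, ← Complex.ofReal_sub, Complex.norm_real,
          Complex.norm_real, Real.norm_eq_abs, Real.norm_eq_abs, abs_of_pos hr.1, one_mul, mul_one,
          div_lt_one (hr.1.trans hlt)]
        exact hlt
      · have e : (p t : ℂ) = (A.height k x + r * (Complex.I *
          Complex.exp ((2 * Real.pi * (t : ℝ) : ℝ) * Complex.I))) - A.height i x := rfl
        rw [e]
        convert h using 1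
        field_simp
        ring
    · refine ⟨x - A.vert j, sub_ne_zero.2 (A.vert_ne_of_mem_base hx j), fun t => ?_⟩
      have e : (p t : ℂ) = x - A.vert j := rfl
      rw [e, div_self (sub_ne_zero.2 (A.vert_ne_of_mem_base hx j))]
      exact Complex.one_mem_slitPlane
  have hc : Continuous fun t => (p t : ℂ) / w :=
    (continuous_subtype_val.comp p.continuous).div_const w
  rw [logIncrement_eq p (⟨fun t => Complex.log ((p t : ℂ) / w) + Complex.log w,
    (hc.clog hw).add continuous_const⟩ : C(unitInterval, ℂ))]
  · simp
  · intro t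
    simp only [ContinuousMap.coe_mk]
    rw [Complex.exp_add, Complex.exp_log hw0, Complex.exp_log (Complex.slitPlane_ne_zero (hw t)),
      div_mul_cancel₀ _ hw0]

/-- The elementary loop around the `k`-th line of a real fibre acts on the local system as
multiplication by the parameter of this line. -/
theorem along_loop (s : Fin n → ℂˣ) (t : Fin m → ℂˣ) (k : Fin n) :
    (A.fibreSystem s t x).along (A.loop hx hy₀ hr k) = s k := by
  have h1 : (A.fibreSystem s t x).along (A.circle hx hr k) = s k := by
    apply Units.ext
    rw [along_fibreSystem, coe_pathFactor, Finset.prod_eq_single (Sum.inl k)]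
    · rw [logIncrement_circle_self, div_self Complex.two_pi_I_ne_zero, mul_one, Sum.elim_inl,
        Complex.exp_log (s k).ne_zero]
    · intro l _ hl
      rw [logIncrement_circle_of_ne A hx hr k l hl]
      simp
    · simp
  rw [loop, RankOneLocalSystem.along_trans, RankOneLocalSystem.along_trans, h1, mul_right_comm,
    RankOneLocalSystem.along_mul_along_symm, one_mul]

end Monodromy

/-- The loop `α_k` of the real fibre over `x`: the elementary loop around the `k`-th line in the
order of the fibre. -/
def alpha [NeZero n] {x : ℝ} (hx : (x : ℂ) ∈ A.base) {y₀ : ℂ} (hy₀ : 0 < y₀.im) {r : ℝ}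
    (hr : A.IsSmallRadius x r) (k : Fin n) : Path (A.basePoint hx hy₀) (A.basePoint hx hy₀) :=
  A.loop hx hy₀ hr (A.lineAt x k)

end LineArrangement

namespace LineArrangement

variable {n m : ℕ} (A : LineArrangement (n + 1) m) (s : Fin (n + 1) → ℂˣ) (t : Fin m → ℂˣ)

/-- The parameter of the `k`-th line over the real point `x`. -/
def param (x : ℝ) (k : Fin (n + 1)) : ℂ := s (A.lineAt x k)

section Classes

variable {x : ℝ} (hx : (x : ℂ) ∈ A.base) {y₀ : ℂ} (hy₀ : 0 < y₀.im) {r : ℝ}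
  (hr : A.IsSmallRadius x r) (c : ℂ) (i : Fin n)

/-- The chain `(1 - s_{i+1}) α_i - (1 - s_i) α_{i+1}` with value `c` in the stalk at the base
point. -/
def tildeChain : RankOneLocalSystem.Chain ℂ (A.fibre x) 1 :=
  Finsupp.single (RankOneLocalSystem.pathSimplex (A.alpha hx hy₀ hr i.castSucc))
      ((1 - A.param s x i.succ) * c) -
    Finsupp.single (RankOneLocalSystem.pathSimplex (A.alpha hx hy₀ hr i.succ))
      ((1 - A.param s x i.castSucc) * c)

theorem tildeChain_mem_cycles :
    A.tildeChain s hx hy₀ hr c i ∈ (A.fibreSystem s t x).cycles := by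
  rw [RankOneLocalSystem.mem_cycles, tildeChain, map_sub,
    RankOneLocalSystem.boundary_pathSimplex, RankOneLocalSystem.boundary_pathSimplex, alpha, alpha,
    along_loop, along_loop, ← Finsupp.single_sub, ← Finsupp.single_sub, ← Finsupp.single_sub,
    Finsupp.single_eq_zero, param, param]
  ring

/-- The homology class of `(1 - s_{i+1}) α_i - (1 - s_i) α_{i+1}`. -/
def tildeClass : (A.fibreSystem s t x).H1 :=
  (A.fibreSystem s t x).homologyClass
    ⟨A.tildeChain s hx hy₀ hr c i, A.tildeChain_mem_cycles s t hx hy₀ hr c i⟩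

/-- The homology class `α_{i,i+1} = α_i / (1 - s_i) - α_{i+1} / (1 - s_{i+1})`, with value `c` in
the stalk at the base point. -/
def alphaClass : (A.fibreSystem s t x).H1 :=
  (((1 - A.param s x i.castSucc) * (1 - A.param s x i.succ))⁻¹ : ℂ) •
    A.tildeClass s t hx hy₀ hr c i

end Classes

/-- The sign `σ(i, i+1)` of the positions of two consecutive lines. -/
def consecutiveSign (σ : Equiv.Perm (Fin (n + 1))) (i : Fin n) : ℂ :=
  if σ i.castSucc < σ i.succ then 1 else -1

/-- The track of the base point: the path `t ↦ (γ t, y₀)` in the complement of the arrangement. -/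
def baseTrack {x x' : ℝ} (hx : (x : ℂ) ∈ A.base) (hx' : (x' : ℂ) ∈ A.base)
    (γ : Path (x : ℂ) (x' : ℂ)) (hγ : ∀ u, γ u ∈ A.base) {y₀ : ℂ} (hy₀ : 0 < y₀.im)
    (hy : ∀ u i, (A.height i (γ u)).im < y₀.im) :
    Path (A.incl x (A.basePoint hx hy₀)) (A.incl x' (A.basePoint hx' hy₀)) where
  toFun u := ⟨(γ u, y₀), A.mem_compl_of_mem_base (hγ u) fun i h =>
    (hy u i).ne (by rw [h])⟩
  continuous_toFun := by fun_prop
  source' := by apply Subtype.ext; simp [incl, basePoint]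
  target' := by apply Subtype.ext; simp [incl, basePoint]

end LineArrangement

end

/-! The computation takes place in the fundamental groupoid of one total space. The square `[0,1] ×
[0,1]` parametrises a deformation `transit` of `γ` (first coordinate `0`) to a horizontal segment at
height `ε (x - x')` (first coordinate `1`). All fibres over it lie over `A.base`, because real lines
meet only over real points and the side condition on `γ` keeps the deformed paths off the real axis.
Over `(0,0)` and `(0,1)` the fibres are `F_x` and `F_{x'}`. The union of the fibres retracts onto
each of them, so identities over `x'` may be tested in the union (`PointMotion.fibreMap_injective`).
There a loop and its transported image differ only by the track of the base point
(`exists_fibreMap_transport`).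

Single loops are not cycles, so classes are taken in chains modulo boundaries. On paths they form a
crossed homomorphism `[gh] = [g] + χ(g)[h]`, where `χ` is the action of the local system. A change
of base path changes `[α]` by a multiple of `1 - χ(α)`, up to the scalar by which the path acts.
After division by `1 - χ(α)` the added term is the same for all loops and cancels in `α_{i,i+1}`.
This explains why the formula holds for every transport.

A loop around a real point passes from far above to far below on the left of the point and returns
on its right (`homOf_loop`). It thus suffices to follow one vertical crossing at abscissa `g`. Let
`q` and `q'` be the ordinates over `x` and `x'`. Along the horizontal segment the points are `q_i -
u (q_i - q'_i) + I ε (q_i - q'_i)`, and the line `Re = g - u Im / ε` tilts without ever meeting them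
(`vert_eq_cross`). At the end it is `Im = ε (g - Re)`, which leaves exactly the points with `q_i >
g` above it. The crossing therefore becomes the product, by increasing `q'`, of the loops around
these points, followed by a vertical crossing to the right of everything (`exists_word`).

With `a_j = [α_j] / (1 - s_j)` over `x'`, the class of such a word telescopes
(`eq_sub_sum_of_word`). The words on the two sides of the `k`-th point differ only in the letter
belonging to `k`. Their combination, divided by `1 - s_k`, is `a_0` minus a weighted sum of the `a_j
- a_{j+1}` over `j < σ(k)` (`inv_smul_word_sub`). Subtracting the results for `i` and `i + 1` leaves
the `j` between `σ(i)` and `σ(i+1)` (`sub_eq_sign_smul_sum`). -/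

noncomputable section

/-! ### Classes of paths in chains modulo boundaries -/

namespace RankOneLocalSystem

open CategoryTheory

variable {K : Type*} [Field K] {X Y : Type*} [TopologicalSpace X] [TopologicalSpace Y]

/-- The singular `1`-simplex of a path, with coefficient `1`, modulo boundaries. -/
def pathClass (L : RankOneLocalSystem K X) {a b : X} (p : Path a b) :
    Chain K X 1 ⧸ L.boundaries :=
  L.boundaries.mkQ (Finsupp.single (pathSimplex p) 1)

/-- The affine singular `2`-simplex with given vertices, composed with a continuous map. -/
def affineTriangle {E : Type*} [AddCommGroup E] [Module ℝ E] [TopologicalSpace E]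
    [ContinuousAdd E] [ContinuousSMul ℝ E] (f : C(E, X)) (P : Fin 3 → E) : Simplex X 2 where
  toFun z := f (∑ i, z i • P i)
  continuous_toFun := by
    refine f.continuous.comp (continuous_finsetSum _ fun i _ => Continuous.smul ?_ continuous_const)
    exact (continuous_apply i).comp continuous_subtype_val

theorem pathSimplex_apply {a b : X} (p : Path a b) (z : stdSimplex ℝ (Fin 2)) :
    pathSimplex p z = p (stdSimplexHomeomorphUnitInterval z) := rfl

theorem face_affineTriangle {E : Type*} [AddCommGroup E] [Module ℝ E] [TopologicalSpace E]
    [ContinuousAdd E] [ContinuousSMul ℝ E] (f : C(E, X)) (P : Fin 3 → E) (j : Fin 3)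
    {a b : X} (p : Path a b)
    (hp : ∀ t : unitInterval, p t =
      f ((1 - (t : ℝ)) • P (j.succAbove 0) + (t : ℝ) • P (j.succAbove 1))) :
    face j (affineTriangle f P) = pathSimplex p := by
  ext z
  have hz : z 0 = 1 - z 1 := by
    have := z.2.2
    rw [Fin.sum_univ_two] at this
    exact eq_sub_of_add_eq this
  rw [pathSimplex_apply, hp]
  have h1 : ((stdSimplexHomeomorphUnitInterval z : unitInterval) : ℝ) = z 1 := rfl
  rw [h1, ← hz]
  change f _ = f _
  congr 1
  have e : ∀ i, (stdSimplex.map j.succAbove z) i = ∑ k with j.succAbove k = i, z k := fun i => by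
    rw [stdSimplex.map_coe, FunOnFinite.linearMap_apply_apply]
  simp only [ContinuousMap.coe_mk, e, Finset.sum_smul]
  rw [← Fin.sum_univ_two (fun k => z k • P (j.succAbove k)),
    ← Finset.sum_fiberwise Finset.univ j.succAbove]
  refine Finset.sum_congr rfl fun i _ => Finset.sum_congr rfl fun k hk => ?_
  rw [(Finset.mem_filter.1 hk).2]

/-- This is the boundary of a single triangle. The face opposite the leading vertex carries its
coefficient along `p`, which produces the factor. The vertices may be collinear or equal, so the
relations below all come from degenerate triangles. -/
theorem pathClass_eq_add_of_triangle (L : RankOneLocalSystem K X) {E : Type*} [AddCommGroup E]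
    [Module ℝ E] [TopologicalSpace E] [ContinuousAdd E] [ContinuousSMul ℝ E] (f : C(E, X))
    (A B C : E) {a b c : X} (p : Path a b) (q : Path b c) (r : Path a c)
    (hp : ∀ t : unitInterval, p t = f ((1 - (t : ℝ)) • A + (t : ℝ) • B))
    (hq : ∀ t : unitInterval, q t = f ((1 - (t : ℝ)) • B + (t : ℝ) • C))
    (hr : ∀ t : unitInterval, r t = f ((1 - (t : ℝ)) • A + (t : ℝ) • C)) :
    L.pathClass r = L.pathClass p + (L.along p : K) • L.pathClass q := by
  have h2 := face_affineTriangle f ![A, B, C] 2 p hp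
  have h0 := face_affineTriangle f ![A, B, C] 0 q hq
  have h1 := face_affineTriangle f ![A, B, C] 1 r hr
  have hl : L.along (leadEdge (affineTriangle f ![A, B, C])) = L.along p := by
    apply along_eq_of_forall
    intro t
    have := DFunLike.congr_fun h2 (stdSimplexHomeomorphUnitInterval.symm t)
    rw [pathSimplex_apply, Homeomorph.apply_symm_apply] at this
    rw [← this]
    change affineTriangle f ![A, B, C] _ = affineTriangle f ![A, B, C] _
    congr 2
    ext i; fin_cases i <;> rfl
  have hb : L.boundary 1 (Finsupp.single (affineTriangle f ![A, B, C]) 1) ∈ L.boundaries :=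
    ⟨_, rfl⟩
  rw [boundary_single, Fin.sum_univ_three, h0, h1, h2, ← Submodule.Quotient.mk_eq_zero] at hb
  simp only [faceFactor, if_true, hl, Fin.val_zero, pow_zero, one_mul] at hb
  simp only [Fin.isValue, Fin.val_one, Fin.val_two, one_ne_zero, if_false, pow_one, mul_one,
    even_two, Even.neg_pow, one_pow, Fin.reduceEq, Submodule.Quotient.mk_add] at hb
  have e1 : (Finsupp.single (pathSimplex q) (L.along p : K)) =
    (L.along p : K) • Finsupp.single (pathSimplex q) 1 := by simp
  have e2 : (Finsupp.single (pathSimplex r) (-1 : K)) = - Finsupp.single (pathSimplex r) 1 := by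
    simp
  rw [e1, e2, Submodule.Quotient.mk_neg, Submodule.Quotient.mk_smul] at hb
  simp only [pathClass, Submodule.mkQ_apply]
  rw [← sub_eq_zero, ← neg_eq_zero, ← hb]
  abel

theorem pathClass_refl (L : RankOneLocalSystem K X) (a : X) : L.pathClass (Path.refl a) = 0 := by
  have h := L.pathClass_eq_add_of_triangle (ContinuousMap.const ℝ a) 0 0 0 (Path.refl a)
    (Path.refl a) (Path.refl a) (fun _ => rfl) (fun _ => rfl) (fun _ => rfl)
  rw [along_refl, Units.val_one, one_smul] at h
  simpa using h

/-- The triangle with the collinear vertices `0`, `1/2`, `1` in `ℝ`, mapped by the concatenated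
path, has the three paths as its edges. -/
theorem pathClass_trans (L : RankOneLocalSystem K X) {a b c : X} (p : Path a b) (q : Path b c) :
    L.pathClass (p.trans q) = L.pathClass p + (L.along p : K) • L.pathClass q := by
  refine L.pathClass_eq_add_of_triangle ⟨_, (p.trans q).continuous_extend⟩ (0 : ℝ) (1 / 2) 1 p q
    (p.trans q) (fun t => ?_) (fun t => ?_) (fun t => ?_)
  · have h0 := t.2.1
    have h1 := t.2.2
    have : (1 - (t : ℝ)) • (0 : ℝ) + (t : ℝ) • (1 / 2 : ℝ) ∈ unitInterval := by
      simp only [smul_eq_mul]; constructor <;> linarith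
    simp only [ContinuousMap.coe_mk]
    rw [Path.extend_apply _ this, Path.trans_apply, dif_pos (by simp; linarith)]
    congr 1; ext; simp; ring
  · have h0 := t.2.1
    have h1 := t.2.2
    have : (1 - (t : ℝ)) • (1 / 2 : ℝ) + (t : ℝ) • (1 : ℝ) ∈ unitInterval := by
      simp only [smul_eq_mul]; constructor <;> linarith
    simp only [ContinuousMap.coe_mk]
    rw [Path.extend_apply _ this, Path.trans_apply]
    split_ifs with h
    · simp only [smul_eq_mul] at h
      -- At the parameter `1/2` the concatenation is computed by its first branch; both branches
      -- give the common endpoint.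
      have ht : t = 0 := le_antisymm (show (t : ℝ) ≤ 0 by linarith) h0
      subst ht
      rw [q.source]
      conv_lhs => rw [← p.target]
      congr 1; ext; simp
    · congr 1; ext; simp; ring
  · simp

/-- The square of the homotopy is cut along its diagonal. Each half has one constant edge, so `p`
and `q` both have the class of the diagonal. -/
theorem pathClass_congr (L : RankOneLocalSystem K X) {a b : X} {p q : Path a b}
    (h : p.Homotopic q) : L.pathClass p = L.pathClass q := by
  obtain ⟨H⟩ := h
  let f : C(ℝ × ℝ, X) := ⟨fun z => H (Set.projIcc 0 1 zero_le_one z.1,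
    Set.projIcc 0 1 zero_le_one z.2), by fun_prop⟩
  let d : Path a b := ⟨⟨fun t => H (t, t), by fun_prop⟩, by simp, by simp⟩
  have h1 := L.pathClass_eq_add_of_triangle f (0, 0) (0, 1) (1, 1) p (Path.refl b) d
    (fun t => by simp [f]) (fun t => by simp [f]) (fun t => by simp [f, d])
  have h2 := L.pathClass_eq_add_of_triangle f (0, 0) (1, 0) (1, 1) (Path.refl a) q d
    (fun t => by simp [f]) (fun t => by simp [f]) (fun t => by simp [f, d])
  rw [pathClass_refl, smul_zero, add_zero] at h1
  rw [pathClass_refl, along_refl, Units.val_one, one_smul, zero_add] at h2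
  rw [← h1, h2]

/-- The unit by which a morphism of the fundamental groupoid acts on the stalks. -/
def alongHom (L : RankOneLocalSystem K X) {a b : FundamentalGroupoid X} (g : a ⟶ b) : Kˣ :=
  L.map g

theorem alongHom_comp (L : RankOneLocalSystem K X) {a b c : FundamentalGroupoid X} (g : a ⟶ b)
    (h : b ⟶ c) : L.alongHom (g ≫ h) = L.alongHom g * L.alongHom h := by
  rw [mul_comm]
  exact L.map_comp g h

theorem alongHom_id (L : RankOneLocalSystem K X) (a : FundamentalGroupoid X) :
    L.alongHom (𝟙 a) = 1 := L.map_id a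

theorem alongHom_inv (L : RankOneLocalSystem K X) {a b : FundamentalGroupoid X} (g : a ⟶ b) :
    L.alongHom (inv g) = (L.alongHom g)⁻¹ := by
  rw [eq_inv_iff_mul_eq_one, ← alongHom_comp, IsIso.inv_hom_id, alongHom_id]

/-- The class of the singular `1`-simplex of a path, as a function of the homotopy class of the
path. -/
def homClass (L : RankOneLocalSystem K X) {a b : FundamentalGroupoid X} (g : a ⟶ b) :
    Chain K X 1 ⧸ L.boundaries :=
  Quotient.lift (fun p : Path a.as b.as => L.pathClass p) (fun _ _ h => L.pathClass_congr h) g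

theorem homClass_comp (L : RankOneLocalSystem K X) {a b c : FundamentalGroupoid X} (g : a ⟶ b)
    (h : b ⟶ c) : L.homClass (g ≫ h) = L.homClass g + (L.alongHom g : K) • L.homClass h := by
  induction g using Quotient.ind
  induction h using Quotient.ind
  exact L.pathClass_trans _ _

theorem homClass_id (L : RankOneLocalSystem K X) (a : FundamentalGroupoid X) :
    L.homClass (𝟙 a) = 0 := L.pathClass_refl a.as

theorem homClass_inv (L : RankOneLocalSystem K X) {a b : FundamentalGroupoid X} (g : a ⟶ b) :
    L.homClass (inv g) = -((L.alongHom g : K)⁻¹ • L.homClass g) := by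
  have h := L.homClass_comp (inv g) g
  rw [IsIso.inv_hom_id, homClass_id, alongHom_inv, Units.val_inv_eq_inv_val] at h
  exact eq_neg_of_add_eq_zero_left h.symm

/-! ### Induced maps on chains modulo boundaries -/

/-- The map induced on chains modulo boundaries by a continuous map `f` together with compatible
identifications `u` of the stalks. -/
def mapChainQuotient (L : RankOneLocalSystem K X) (L' : RankOneLocalSystem K Y) (f : C(X, Y))
    (u : X → Kˣ)
    (hu : ∀ {a b : X} (p : Path a b), L.along p * u b = u a * L'.along (p.map f.continuous)) :
    (Chain K X 1 ⧸ L.boundaries) →ₗ[K] (Chain K Y 1 ⧸ L'.boundaries) :=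
  Submodule.mapQ _ _ (chainMap f u 1) (by
    rintro _ ⟨d, rfl⟩
    exact ⟨chainMap f u 2 d, boundary_chainMap L L' f u hu 1 d⟩)

theorem mapChainQuotient_pathClass (L : RankOneLocalSystem K X) (L' : RankOneLocalSystem K Y)
    (f : C(X, Y)) (u : X → Kˣ)
    (hu : ∀ {a b : X} (p : Path a b), L.along p * u b = u a * L'.along (p.map f.continuous))
    {a b : X} (p : Path a b) :
    mapChainQuotient L L' f u hu (L.pathClass p) =
      (u a : K) • L'.pathClass (p.map f.continuous) := by
  have hl : lead (pathSimplex p) = a := by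
    exact p.source
  have hs : pathSimplex (p.map f.continuous) = f.comp (pathSimplex p) := rfl
  rw [mapChainQuotient, pathClass, Submodule.mkQ_apply, Submodule.mapQ_apply, chainMap_single, hl,
    pathClass, hs, Submodule.mkQ_apply, ← Submodule.Quotient.mk_smul]
  simp

/-- The inclusion of the first homology into the chains modulo boundaries. -/
def toChainQuotient (L : RankOneLocalSystem K X) : L.H1 →ₗ[K] Chain K X 1 ⧸ L.boundaries :=
  Submodule.mapQ _ _ L.cycles.subtype le_rfl

theorem toChainQuotient_homologyClass (L : RankOneLocalSystem K X) (c : L.cycles) :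
    L.toChainQuotient (L.homologyClass c) = L.boundaries.mkQ c := rfl

/-- A cycle that vanishes modulo boundaries is a boundary. Identities in homology may therefore be
checked where the single loops have classes, although they are not cycles. -/
theorem toChainQuotient_injective (L : RankOneLocalSystem K X) :
    Function.Injective L.toChainQuotient := by
  rw [← LinearMap.ker_eq_bot, LinearMap.ker_eq_bot']
  rintro ⟨c⟩ hc
  have h : L.boundaries.mkQ c = 0 := hc
  rw [Submodule.mkQ_apply, Submodule.Quotient.mk_eq_zero] at h
  exact (Submodule.Quotient.mk_eq_zero _).2 h

theorem toChainQuotient_mapH1 (L : RankOneLocalSystem K X) (L' : RankOneLocalSystem K Y)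
    (f : C(X, Y)) (u : X → Kˣ)
    (hu : ∀ {a b : X} (p : Path a b), L.along p * u b = u a * L'.along (p.map f.continuous))
    (z : L.H1) : L'.toChainQuotient (mapH1 L L' f u hu z) =
      mapChainQuotient L L' f u hu (L.toChainQuotient z) := by
  obtain ⟨c⟩ := z
  rfl

/-- A homotopy between `f` and `g` identifies the pull-back under `f` with that under `g`. -/
theorem along_mul_evalAt (L : RankOneLocalSystem K Y) {f g : C(X, Y)} (H : f.Homotopy g) {a b : X}
    (p : Path a b) : L.along (p.map f.continuous) * L.along (H.evalAt b) =
      L.along (H.evalAt a) * L.along (p.map g.continuous) := by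
  rw [← along_trans, ← along_trans]
  exact L.along_congr (Path.Homotopic.map_trans_evalAt H p)

end RankOneLocalSystem
end

noncomputable section

/-! ### Pushing the plane along moving points -/

section Push

variable {ι E : Type*}

/-- A bump function of radius `δ` around the point `p i d`. -/
def bump (p : ι → E → ℂ) (δ : ℝ) (i : ι) (d : E) (y : ℂ) : ℝ := max 0 (1 - ‖y - p i d‖ / δ)

theorem abs_bump_sub_bump_le (p : ι → E → ℂ) {δ : ℝ} (hδ : 0 < δ) (i : ι) (d : E) (y z : ℂ) :
    |bump p δ i d y - bump p δ i d z| ≤ ‖y - z‖ / δ := by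
  unfold bump
  refine (abs_max_sub_max_le_max _ _ _ _).trans ?_
  rw [sub_self, abs_zero, max_eq_right (abs_nonneg _)]
  have : (1 - ‖y - p i d‖ / δ) - (1 - ‖z - p i d‖ / δ) = -((‖y - p i d‖ - ‖z - p i d‖) / δ) := by
    ring
  rw [this, abs_neg, abs_div, abs_of_pos hδ]
  gcongr
  refine (abs_norm_sub_norm_le _ _).trans_eq ?_
  congr 1
  ring

variable [Fintype ι]

/-- The map of the plane that displaces a neighbourhood of `p i d` by `p i e - p i d`. -/
def pushStep (p : ι → E → ℂ) (δ : ℝ) (d e : E) (y : ℂ) : ℂ :=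
  y + ∑ i, (bump p δ i d y : ℂ) * (p i e - p i d)

theorem pushStep_apply_point (p : ι → E → ℂ) {δ : ℝ} (hδ : 0 < δ) (d e : E)
    (hsep : ∀ i j, i ≠ j → δ ≤ ‖p i d - p j d‖) (i : ι) :
    pushStep p δ d e (p i d) = p i e := by
  classical
  rw [pushStep, Finset.sum_eq_single i]
  · simp [bump]
  · intro j _ hj
    have : bump p δ j d (p i d) = 0 := by
      rw [bump, max_eq_left]
      rw [sub_nonpos, one_le_div hδ]
      exact hsep i j hj.symm
    simp [this]
  · simp

/-- The displacement is Lipschitz in `y` with constant at most `card ι * η / δ < 1`. Identity plus a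
contraction is injective, and `p i d` already goes to `p i e`. -/
theorem pushStep_ne (p : ι → E → ℂ) {δ η : ℝ} (hδ : 0 < δ) (d e : E)
    (hsep : ∀ i j, i ≠ j → δ ≤ ‖p i d - p j d‖) (hη : ∀ i, ‖p i e - p i d‖ ≤ η)
    (hηδ : Fintype.card ι * η < δ) {y : ℂ} {i : ι} (hy : y ≠ p i d) :
    pushStep p δ d e y ≠ p i e := by
  intro h
  rw [← pushStep_apply_point p hδ d e hsep i, pushStep, pushStep] at h
  have h1 : p i d - y = ∑ j, ((bump p δ j d y - bump p δ j d (p i d) : ℝ) : ℂ) *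
      (p j e - p j d) := by
    simp only [Complex.ofReal_sub, sub_mul, Finset.sum_sub_distrib]
    linear_combination -h
  have hpos : 0 < ‖y - p i d‖ := norm_pos_iff.2 (sub_ne_zero.2 hy)
  have h2 : ‖p i d - y‖ ≤ Fintype.card ι * (‖y - p i d‖ / δ * η) := by
    rw [h1]
    refine (norm_sum_le _ _).trans ?_
    refine (Finset.sum_le_card_nsmul _ _ (‖y - p i d‖ / δ * η) fun j _ => ?_).trans_eq
      (by simp [Finset.card_univ])
    rw [norm_mul, Complex.norm_real, Real.norm_eq_abs]
    gcongr
    · exact abs_bump_sub_bump_le p hδ j d _ _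
    · exact hη j
  rw [norm_sub_rev] at h2
  have h3 : (Fintype.card ι : ℝ) * (‖y - p i d‖ / δ * η) =
      (Fintype.card ι * η) * (‖y - p i d‖ / δ) := by ring
  have h4 : (Fintype.card ι * η) * (‖y - p i d‖ / δ) < δ * (‖y - p i d‖ / δ) := by gcongr
  rw [mul_div_cancel₀ _ hδ.ne'] at h4
  linarith

variable [NormedAddCommGroup E] [NormedSpace ℝ E]

/-- The composition of `k` steps of the subdivision into `N` steps of the way from `d` to `e`. -/
def push (p : ι → E → ℂ) (δ : ℝ) (N : ℕ) (d e : E) (y : ℂ) : ℕ → ℂ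
  | 0 => y
  | k + 1 => pushStep p δ (d + ((k : ℝ) / N) • (e - d)) (d + (((k + 1 : ℕ) : ℝ) / N) • (e - d))
      (push p δ N d e y k)

theorem continuous_push {p : ι → E → ℂ} (hp : ∀ i, Continuous (p i)) (δ : ℝ) (N k : ℕ) :
    Continuous fun z : E × E × ℂ => push p δ N z.1 z.2.1 z.2.2 k := by
  induction k with
  | zero => exact continuous_snd.snd
  | succ k ih =>
    simp only [push, pushStep, bump]
    fun_prop

theorem push_self (p : ι → E → ℂ) (δ : ℝ) (N : ℕ) (d : E) (y : ℂ) (k : ℕ) :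
    push p δ N d d y k = y := by
  induction k with
  | zero => rfl
  | succ k ih => simp [push, pushStep, ih]

/-- Points moving without collisions over a compact convex set of parameters can be pushed along
simultaneously, with a continuous dependence on the parameters. -/
theorem exists_push {p : ι → E → ℂ} (hp : ∀ i, Continuous (p i)) {D : Set E} (hD : IsCompact D)
    (hDc : Convex ℝ D) (hinj : ∀ d ∈ D, ∀ i j, i ≠ j → p i d ≠ p j d) :
    ∃ Ψ : E × E × ℂ → ℂ, Continuous Ψ ∧ (∀ d y, Ψ (d, d, y) = y) ∧
      ∀ d ∈ D, ∀ e ∈ D, ∀ y, (∀ i, y ≠ p i d) → ∀ i, Ψ (d, e, y) ≠ p i e := by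
  obtain ⟨δ, hδ, hsep⟩ : ∃ δ > 0, ∀ i j, i ≠ j → ∀ d ∈ D, δ ≤ ‖p i d - p j d‖ := by
    have : ∀ᶠ δ in nhdsWithin (0 : ℝ) (Set.Ioi 0), ∀ i j, i ≠ j → ∀ d ∈ D,
        δ ≤ ‖p i d - p j d‖ := by
      rw [Filter.eventually_all]
      intro i
      rw [Filter.eventually_all]
      intro j
      rcases eq_or_ne i j with rfl | hij
      · simp
      obtain ⟨a, ha, h⟩ := hD.exists_forall_le' (f := fun d => ‖p i d - p j d‖)
        (((hp i).sub (hp j)).norm.continuousOn) (a := 0)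
        fun d hd => norm_pos_iff.2 (sub_ne_zero.2 (hinj d hd i j hij))
      filter_upwards [Ioo_mem_nhdsGT ha] with b hb _ d hd
      exact hb.2.le.trans (h d hd)
    obtain ⟨δ, h, hδ⟩ := (this.and self_mem_nhdsWithin).exists
    exact ⟨δ, hδ, h⟩
  -- The `+ 1` makes `card ι * η < δ` strict and avoids division by zero when there are no points.
  set η : ℝ := δ / (Fintype.card ι + 1) with hη_def
  have hη : 0 < η := by positivity
  have hηδ : Fintype.card ι * η < δ := by
    rw [hη_def, mul_div_assoc', div_lt_iff₀ (by positivity)]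
    linarith
  obtain ⟨ρ, hρ, hclose⟩ : ∃ ρ > 0, ∀ i, ∀ d ∈ D, ∀ e ∈ D, dist d e < ρ → dist (p i d) (p i e) < η := by
    have : ∀ᶠ ρ in nhdsWithin (0 : ℝ) (Set.Ioi 0), ∀ i, ∀ d ∈ D, ∀ e ∈ D, dist d e < ρ →
        dist (p i d) (p i e) < η := by
      rw [Filter.eventually_all]
      intro i
      obtain ⟨ρ, hρ, h⟩ := Metric.uniformContinuousOn_iff.1
        (hD.uniformContinuousOn_of_continuous (hp i).continuousOn) η hη
      filter_upwards [Ioo_mem_nhdsGT hρ] with b hb d hd e he hde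
      exact h d hd e he (hde.trans hb.2)
    obtain ⟨ρ, h, hρ⟩ := (this.and self_mem_nhdsWithin).exists
    exact ⟨ρ, hρ, h⟩
  obtain ⟨C, hC⟩ := Metric.isBounded_iff.1 hD.isBounded
  -- `C` bounds the distances in `D`, so each of the `N` steps is shorter than `ρ` and moves every
  -- point by less than `η`. The maximum with `0` ensures `N > 0`.
  obtain ⟨N, hN⟩ := exists_nat_gt (max 0 (C / ρ))
  have hN0 : (0 : ℝ) < N := (le_max_left _ _).trans_lt hN
  refine ⟨fun z => push p δ N z.1 z.2.1 z.2.2 N, continuous_push hp δ N N,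
    fun d y => push_self p δ N d y N, fun d hd e he y hy => ?_⟩
  have hw : ∀ k : ℕ, k ≤ N → d + ((k : ℝ) / N) • (e - d) ∈ D := fun k hk =>
    hDc.add_smul_sub_mem hd he ⟨by positivity, (div_le_one hN0).2 (by exact_mod_cast hk)⟩
  have key : ∀ k : ℕ, k ≤ N → ∀ i, push p δ N d e y k ≠ p i (d + ((k : ℝ) / N) • (e - d)) := by
    intro k
    induction k with
    | zero => intro _ i; simpa [push] using hy i
    | succ k ih =>
      intro hk i
      refine pushStep_ne p hδ _ _ (fun i j hij => hsep i j hij _ (hw k (by omega)))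
        (fun i => ?_) hηδ (ih (by omega) i)
      rw [← dist_eq_norm]
      refine (hclose i _ (hw _ hk) _ (hw k (by omega)) ?_).le
      rw [dist_add_left, dist_eq_norm, ← sub_smul, norm_smul]
      have e1 : ((k + 1 : ℕ) : ℝ) / N - k / N = 1 / N := by push_cast; ring
      rw [e1, Real.norm_of_nonneg (by positivity), ← dist_eq_norm]
      calc 1 / N * dist e d ≤ 1 / N * C := by gcongr; exact hC he hd
        _ < ρ := by
          have := (le_max_right _ _).trans_lt hN
          rw [div_lt_iff₀ hρ] at this
          rw [one_div, inv_mul_lt_iff₀ hN0]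
          exact this
  intro i
  simpa [div_self hN0.ne'] using key N le_rfl i

end Push
end

noncomputable section

/-! ### Segments in the fundamental groupoid of a subset of a vector space -/

section Segments

open CategoryTheory

variable {W : Type*} [AddCommGroup W] [Module ℝ W] [TopologicalSpace W] [IsTopologicalAddGroup W]
  [ContinuousSMul ℝ W] {Ω : Set W}

/-- The homotopy class of a path, as a morphism of the fundamental groupoid. -/
def homOf {X : Type*} [TopologicalSpace X] {a b : X} (p : Path a b) :
    FundamentalGroupoid.mk a ⟶ FundamentalGroupoid.mk b :=
  FundamentalGroupoid.fromPath (Path.Homotopic.Quotient.mk p)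

theorem homOf_eq {X : Type*} [TopologicalSpace X] {a b : X} {p q : Path a b} (h : p.Homotopic q) :
    homOf p = homOf q := Quotient.sound h

theorem homOf_trans {X : Type*} [TopologicalSpace X] {a b c : X} (p : Path a b) (q : Path b c) :
    homOf (p.trans q) = homOf p ≫ homOf q := rfl

theorem homOf_symm {X : Type*} [TopologicalSpace X] {a b : X} (p : Path a b) :
    homOf p.symm = inv (homOf p) := by
  rw [← Groupoid.inv_eq_inv]
  rfl

/-- The segment between two points, as a path in a set containing it. -/
def segPath {a b : W} (h : segment ℝ a b ⊆ Ω) :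
    Path (⟨a, h (left_mem_segment ℝ a b)⟩ : Ω) ⟨b, h (right_mem_segment ℝ a b)⟩ where
  toFun t := ⟨(1 - (t : ℝ)) • a + (t : ℝ) • b,
    h ⟨1 - t, t, sub_nonneg.2 t.2.2, t.2.1, by ring, rfl⟩⟩
  continuous_toFun := by fun_prop
  source' := by ext; simp
  target' := by ext; simp

/-- The homotopy class of a segment. -/
def seg {a b : W} (h : segment ℝ a b ⊆ Ω) :
    FundamentalGroupoid.mk (⟨a, h (left_mem_segment ℝ a b)⟩ : Ω) ⟶
      FundamentalGroupoid.mk ⟨b, h (right_mem_segment ℝ a b)⟩ := homOf (segPath h)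

/-- A nonempty convex set is contractible, hence simply connected. All identities between segments
below come from convex regions free of the removed points. -/
theorem homotopic_of_convex {S : Set W} (hS : Convex ℝ S) (hSΩ : S ⊆ Ω) {a b : Ω} {p q : Path a b}
    (hp : ∀ t, (p t : W) ∈ S) (hq : ∀ t, (q t : W) ∈ S) : p.Homotopic q := by
  have : ContractibleSpace S := hS.contractibleSpace ⟨_, hp 0⟩
  have ha : (a : W) ∈ S := by simpa using hp 0
  have hb : (b : W) ∈ S := by simpa using hp 1
  let P : Path (⟨a, ha⟩ : S) ⟨b, hb⟩ :=
    ⟨⟨fun t => ⟨p t, hp t⟩, by fun_prop⟩, by simp, by simp⟩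
  let Q : Path (⟨a, ha⟩ : S) ⟨b, hb⟩ :=
    ⟨⟨fun t => ⟨q t, hq t⟩, by fun_prop⟩, by simp, by simp⟩
  exact (SimplyConnectedSpace.paths_homotopic P Q).map ⟨Set.inclusion hSΩ, by fun_prop⟩

theorem segPath_mem {S : Set W} (hS : Convex ℝ S) {a b : W} (ha : a ∈ S) (hb : b ∈ S)
    (h : segment ℝ a b ⊆ Ω) (t : unitInterval) : (segPath h t : W) ∈ S :=
  hS ha hb (sub_nonneg.2 t.2.2) t.2.1 (by ring)

theorem homOf_eq_seg {S : Set W} (hS : Convex ℝ S) (hSΩ : S ⊆ Ω) {a b : W}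
    (h : segment ℝ a b ⊆ Ω) (p : Path (⟨a, h (left_mem_segment ℝ a b)⟩ : Ω)
      ⟨b, h (right_mem_segment ℝ a b)⟩) (hp : ∀ t, (p t : W) ∈ S) : homOf p = seg h :=
  homOf_eq (homotopic_of_convex hS hSΩ hp
    (segPath_mem hS (by simpa using hp 0) (by simpa using hp 1) h))

theorem seg_comp {S : Set W} (hS : Convex ℝ S) (hSΩ : S ⊆ Ω) {a b c : W} (ha : a ∈ S) (hb : b ∈ S)
    (hc : c ∈ S) (hab : segment ℝ a b ⊆ Ω) (hbc : segment ℝ b c ⊆ Ω) (hac : segment ℝ a c ⊆ Ω) :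
    seg hab ≫ seg hbc = seg hac := by
  refine homOf_eq_seg hS hSΩ hac ((segPath hab).trans (segPath hbc)) fun t => ?_
  rw [Path.trans_apply]
  split_ifs
  · exact segPath_mem hS ha hb hab _
  · exact segPath_mem hS hb hc hbc _

theorem seg_self {a : W} (h : segment ℝ a a ⊆ Ω) : seg h = 𝟙 _ := by
  have : segPath h = Path.refl _ := by
    ext t
    simp [segPath, ← add_smul]
  unfold seg
  rw [this]
  rfl

theorem inv_seg {a b : W} (h : segment ℝ a b ⊆ Ω) (h' : segment ℝ b a ⊆ Ω) :
    inv (seg h) = seg h' := by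
  have e : seg h ≫ seg h' = 𝟙 _ := by
    rw [seg_comp (convex_segment a b) h (left_mem_segment ℝ a b) (right_mem_segment ℝ a b)
      (left_mem_segment ℝ a b) h h' (by rw [segment_same]; simpa using h (left_mem_segment ℝ a b)),
      seg_self]
  rw [← cancel_epi (seg h), e, IsIso.hom_inv_id]

theorem Path.trans_apply_congr {X Y : Type*} [TopologicalSpace X] [TopologicalSpace Y] {a b c : X}
    {a' b' c' : Y} {p : Path a b} {q : Path b c} {p' : Path a' b'} {q' : Path b' c'} (f : X → Y)
    (hp : ∀ t, f (p t) = p' t) (hq : ∀ t, f (q t) = q' t) (t : unitInterval) :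
    f (p.trans q t) = p'.trans q' t := by
  rw [Path.trans_apply, Path.trans_apply]
  split_ifs
  · exact hp _
  · exact hq _

/-- If the bilinear square with corners `a`, `b`, `b'`, `a'` lies in `Ω`, then its two boundary
paths from `a` to `b'` are homotopic. -/
theorem seg_square {a b a' b' : W} (hab : segment ℝ a b ⊆ Ω) (hbb' : segment ℝ b b' ⊆ Ω)
    (haa' : segment ℝ a a' ⊆ Ω) (hab' : segment ℝ a' b' ⊆ Ω)
    (h : ∀ u ∈ Set.Icc (0 : ℝ) 1, ∀ t ∈ Set.Icc (0 : ℝ) 1,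
      (1 - t) • ((1 - u) • a + u • a') + t • ((1 - u) • b + u • b') ∈ Ω) :
    seg hab ≫ seg hbb' = seg haa' ≫ seg hab' := by
  -- Clamping the coordinates extends the bilinear square to the whole plane, whose simple
  -- connectedness gives the homotopy.
  let pr : ℝ → unitInterval := Set.projIcc 0 1 zero_le_one
  let f : C(ℝ × ℝ, Ω) := ⟨fun z => ⟨_, h (pr z.1) (pr z.1).2 (pr z.2) (pr z.2).2⟩, by fun_prop⟩
  have key : (((Path.segment ((0 : ℝ), (0 : ℝ)) (0, 1)).trans (Path.segment (0, 1) (1, 1))).map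
      f.continuous).Homotopic (((Path.segment (0, 0) (1, 0)).trans
        (Path.segment (1, 0) (1, 1))).map f.continuous) :=
    (SimplyConnectedSpace.paths_homotopic _ _).map f
  have e0 : f (0, 0) = ⟨a, hab (left_mem_segment ℝ a b)⟩ := by ext; simp [f, pr]
  have e1 : f (1, 1) = ⟨b', hbb' (right_mem_segment ℝ b b')⟩ := by ext; simp [f, pr]
  have h1 : ((segPath hab).trans (segPath hbb')) = ((((Path.segment ((0 : ℝ), (0 : ℝ)) (0, 1)).trans
      (Path.segment (0, 1) (1, 1))).map f.continuous).cast e0.symm e1.symm) := by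
    ext1
    funext t
    symm
    refine Path.trans_apply_congr f (fun t => ?_) (fun t => ?_) t
    · ext; simp [f, pr, segPath, AffineMap.lineMap_apply]
    · ext; simp [f, pr, segPath, AffineMap.lineMap_apply]
  have h2 : ((segPath haa').trans (segPath hab')) = ((((Path.segment ((0 : ℝ), (0 : ℝ)) (1, 0)).trans
      (Path.segment (1, 0) (1, 1))).map f.continuous).cast e0.symm e1.symm) := by
    ext1
    funext t
    symm
    refine Path.trans_apply_congr f (fun t => ?_) (fun t => ?_) t
    · ext; simp [f, pr, segPath, AffineMap.lineMap_apply]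
    · ext; simp [f, pr, segPath, AffineMap.lineMap_apply]
  refine homOf_eq (p := (segPath hab).trans (segPath hbb')) (q := (segPath haa').trans (segPath hab')) ?_
  rw [h1, h2]
  exact key.pathCast _ _

end Segments
end

noncomputable section

/-! ### The complement of moving points in the plane -/

open CategoryTheory

/-- Points of the plane moving over a convex set of parameters and staying between two horizontal
lines, together with a base point above and one below. -/
structure PointMotion (ι E : Type*) [AddCommGroup E] [Module ℝ E] where
  /-- the moving points -/
  pt : ι → E → ℂ
  /-- the set of parameters -/
  dom : Set E
  convex_dom : Convex ℝ dom
  /-- a height above all points -/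
  top : ℝ
  /-- a height exceeding `top` and the depth of all points -/
  height : ℝ
  top_le : top ≤ height
  lt_top : ∀ d ∈ dom, ∀ i, (pt i d).im < top
  neg_height_lt : ∀ d ∈ dom, ∀ i, -height < (pt i d).im
  /-- the base point above -/
  base : E × ℂ
  base_mem : base ∈ dom ×ˢ {y : ℂ | top ≤ y.im}
  /-- the base point below -/
  nadir : E × ℂ
  nadir_mem : nadir ∈ dom ×ˢ {y : ℂ | y.im ≤ -height}

namespace PointMotion

variable {ι E : Type*} [AddCommGroup E] [Module ℝ E] (P : PointMotion ι E)

/-- The complement of the moving points. -/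
def space : Set (E × ℂ) := {w | w.1 ∈ P.dom ∧ ∀ i, w.2 ≠ P.pt i w.1}

/-- The region above all points. -/
def topSet : Set (E × ℂ) := P.dom ×ˢ {y : ℂ | P.top ≤ y.im}

/-- The region below all points. -/
def botSet : Set (E × ℂ) := P.dom ×ˢ {y : ℂ | y.im ≤ -P.height}

theorem convex_topSet : Convex ℝ P.topSet := P.convex_dom.prod (convex_halfSpace_im_ge _)

theorem convex_botSet : Convex ℝ P.botSet := P.convex_dom.prod (convex_halfSpace_im_le _)

theorem topSet_subset : P.topSet ⊆ P.space := fun w hw => ⟨hw.1, fun i h => by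
  have h1 := P.lt_top w.1 hw.1 i
  rw [← h] at h1
  exact h1.not_ge hw.2⟩

theorem botSet_subset : P.botSet ⊆ P.space := fun w hw => ⟨hw.1, fun i h => by
  have h1 := P.neg_height_lt w.1 hw.1 i
  rw [← h] at h1
  exact h1.not_ge hw.2⟩

theorem segment_subset {S : Set (E × ℂ)} (hS : Convex ℝ S) (hSP : S ⊆ P.space) {a b : E × ℂ}
    (ha : a ∈ S) (hb : b ∈ S) : segment ℝ a b ⊆ P.space :=
  (hS.segment_subset ha hb).trans hSP

theorem top_segment {a b : E × ℂ} (ha : a ∈ P.topSet) (hb : b ∈ P.topSet) :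
    segment ℝ a b ⊆ P.space := P.segment_subset P.convex_topSet P.topSet_subset ha hb

theorem bot_segment {a b : E × ℂ} (ha : a ∈ P.botSet) (hb : b ∈ P.botSet) :
    segment ℝ a b ⊆ P.space := P.segment_subset P.convex_botSet P.botSet_subset ha hb

theorem mk_mem_topSet {d : E} (hd : d ∈ P.dom) (c : ℝ) : (d, (⟨c, P.height⟩ : ℂ)) ∈ P.topSet :=
  ⟨hd, P.top_le⟩

theorem mk_mem_botSet {d : E} (hd : d ∈ P.dom) (c : ℝ) : (d, (⟨c, -P.height⟩ : ℂ)) ∈ P.botSet :=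
  ⟨hd, le_rfl (a := -P.height)⟩

theorem singleton_prod_subset {d : E} (hd : d ∈ P.dom) {C : Set ℂ} (hC : ∀ i, P.pt i d ∉ C) :
    {d} ×ˢ C ⊆ P.space := by
  rintro ⟨e, y⟩ ⟨rfl : e = d, hy⟩
  exact ⟨hd, fun i h => hC i (h ▸ hy)⟩

theorem fibre_segment {d : E} (hd : d ∈ P.dom) {C : Set ℂ} (hC : Convex ℝ C)
    (hCP : ∀ i, P.pt i d ∉ C) {a b : ℂ} (ha : a ∈ C) (hb : b ∈ C) :
    segment ℝ (d, a) (d, b) ⊆ P.space :=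
  P.segment_subset ((convex_singleton d).prod hC) (P.singleton_prod_subset hd hCP)
    ⟨Set.mem_singleton d, ha⟩ ⟨Set.mem_singleton d, hb⟩

theorem convex_re_eq (c : ℝ) : Convex ℝ {y : ℂ | y.re = c} :=
  convex_hyperplane (f := Complex.re) ⟨Complex.add_re, fun r z => by simp⟩ c

/-- A segment between two points of the same fibre of the same real part. -/
theorem vert_segment {d : E} (hd : d ∈ P.dom) {c : ℝ} (hc : ∀ i, (P.pt i d).re ≠ c) (h h' : ℝ) :
    segment ℝ (d, (⟨c, h⟩ : ℂ)) (d, ⟨c, h'⟩) ⊆ P.space :=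
  P.fibre_segment hd (convex_re_eq c) hc rfl rfl

variable [TopologicalSpace E] [IsTopologicalAddGroup E] [ContinuousSMul ℝ E]

theorem top_comp {a b c : E × ℂ} (ha : a ∈ P.topSet) (hb : b ∈ P.topSet) (hc : c ∈ P.topSet) :
    seg (P.top_segment ha hb) ≫ seg (P.top_segment hb hc) = seg (P.top_segment ha hc) :=
  seg_comp P.convex_topSet P.topSet_subset ha hb hc _ _ _

theorem bot_comp {a b c : E × ℂ} (ha : a ∈ P.botSet) (hb : b ∈ P.botSet) (hc : c ∈ P.botSet) :
    seg (P.bot_segment ha hb) ≫ seg (P.bot_segment hb hc) = seg (P.bot_segment ha hc) :=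
  seg_comp P.convex_botSet P.botSet_subset ha hb hc _ _ _

/-- The base point above, as an object of the fundamental groupoid. -/
abbrev baseObj : FundamentalGroupoid P.space := ⟨⟨P.base, P.topSet_subset P.base_mem⟩⟩

/-- The base point below, as an object of the fundamental groupoid. -/
abbrev nadirObj : FundamentalGroupoid P.space := ⟨⟨P.nadir, P.botSet_subset P.nadir_mem⟩⟩

/-- The way from the base point to a point of the top region. -/
def fromBase {a : E × ℂ} (ha : a ∈ P.topSet) :
    P.baseObj ⟶ ⟨⟨a, P.topSet_subset ha⟩⟩ := seg (P.top_segment P.base_mem ha)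

/-- The way from a point of the bottom region to the base point below. -/
def toNadir {b : E × ℂ} (hb : b ∈ P.botSet) :
    (⟨⟨b, P.botSet_subset hb⟩⟩ : FundamentalGroupoid P.space) ⟶ P.nadirObj :=
  seg (P.bot_segment hb P.nadir_mem)

/-- The passage from the base point above to the one below along a segment from the top region to
the bottom region. -/
def cross {a b : E × ℂ} (h : segment ℝ a b ⊆ P.space) (ha : a ∈ P.topSet) (hb : b ∈ P.botSet) :
    P.baseObj ⟶ P.nadirObj := P.fromBase ha ≫ seg h ≫ P.toNadir hb

/-- The square moves one segment into the other. The tracks of its endpoints stay in the convex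
regions at the top and at the bottom, where they are absorbed into the ways to the base points. -/
theorem cross_eq_of_square {a b a' b' : E × ℂ} (h : segment ℝ a b ⊆ P.space) (ha : a ∈ P.topSet)
    (hb : b ∈ P.botSet) (h' : segment ℝ a' b' ⊆ P.space) (ha' : a' ∈ P.topSet)
    (hb' : b' ∈ P.botSet)
    (H : ∀ u ∈ Set.Icc (0 : ℝ) 1, ∀ t ∈ Set.Icc (0 : ℝ) 1,
      (1 - t) • ((1 - u) • a + u • a') + t • ((1 - u) • b + u • b') ∈ P.space) :
    P.cross h ha hb = P.cross h' ha' hb' := by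
  have h1 := seg_square h (P.bot_segment hb hb') (P.top_segment ha ha') h' H
  rw [cross, cross, fromBase, fromBase, toNadir, toNadir, ← P.top_comp P.base_mem ha ha',
    ← P.bot_comp hb hb' P.nadir_mem, Category.assoc, reassoc_of% h1]

theorem fibre_comp {d : E} (hd : d ∈ P.dom) {C : Set ℂ} (hC : Convex ℝ C)
    (hCP : ∀ i, P.pt i d ∉ C) {a b c : ℂ} (ha : a ∈ C) (hb : b ∈ C) (hc : c ∈ C)
    (hab : segment ℝ (d, a) (d, b) ⊆ P.space) (hbc : segment ℝ (d, b) (d, c) ⊆ P.space)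
    (hac : segment ℝ (d, a) (d, c) ⊆ P.space) : seg hab ≫ seg hbc = seg hac :=
  seg_comp ((convex_singleton d).prod hC) (P.singleton_prod_subset hd hCP)
    ⟨Set.mem_singleton d, ha⟩ ⟨Set.mem_singleton d, hb⟩ ⟨Set.mem_singleton d, hc⟩ _ _ _

/-- The passage from the base point above to the one below along a vertical line. -/
def vert {d : E} (hd : d ∈ P.dom) {c : ℝ} (hc : ∀ i, (P.pt i d).re ≠ c) :
    P.baseObj ⟶ P.nadirObj :=
  P.cross (P.vert_segment hd hc _ _) (P.mk_mem_topSet hd c) (P.mk_mem_botSet hd c)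

/-- The square swept by the vertical segment has constant abscissa `c`, which no point takes along
the way. -/
theorem vert_eq_vert {d d' : E} (hd : d ∈ P.dom) (hd' : d' ∈ P.dom) {c : ℝ}
    (hc : ∀ e ∈ segment ℝ d d', ∀ i, (P.pt i e).re ≠ c) :
    P.vert hd (hc d (left_mem_segment ℝ d d')) = P.vert hd' (hc d' (right_mem_segment ℝ d d')) := by
  refine P.cross_eq_of_square _ _ _ _ _ _ fun u hu t ht => ?_
  have he : (1 - u) • d + u • d' ∈ segment ℝ d d' :=
    ⟨1 - u, u, sub_nonneg.2 hu.2, hu.1, by ring, rfl⟩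
  have e1 : (1 - t) • ((1 - u) • (d, (⟨c, P.height⟩ : ℂ)) + u • (d', (⟨c, P.height⟩ : ℂ))) +
      t • ((1 - u) • (d, (⟨c, -P.height⟩ : ℂ)) + u • (d', (⟨c, -P.height⟩ : ℂ))) =
      ((1 - u) • d + u • d', (⟨c, (1 - t) * P.height - t * P.height⟩ : ℂ)) := by
    refine Prod.ext ?_ (Complex.ext ?_ ?_)
    · simp only [Prod.fst_add, Prod.smul_fst]
      module
    · simp; ring
    · simp; ring
  rw [e1]
  refine ⟨P.convex_dom.segment_subset hd hd' he, fun i h => hc _ he i ?_⟩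
  rw [← h]

/-! ### Loops around a point of a real configuration -/

/-- An open half-plane stays convex when one boundary point is added. If the points of a fibre are
real, this region avoids them all and still allows a path to reach the real axis at a free abscissa.
-/
theorem convex_insert_im_pos {z : ℂ} (hz : z.im = 0) : Convex ℝ (insert z {y : ℂ | 0 < y.im}) := by
  rw [convex_iff_forall_pos]
  rintro x hx y hy a b ha hb hab
  rcases hx with rfl | hx <;> rcases hy with rfl | hy
  · left; rw [← add_smul, hab, one_smul]
  · right; simp only [Set.mem_ofPred_eq] at hy ⊢; simp [hz]; positivity
  · right; simp only [Set.mem_ofPred_eq] at hx ⊢; simp [hz]; positivity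
  · right; simp only [Set.mem_ofPred_eq] at hx hy ⊢; simp; positivity

theorem convex_insert_im_neg {z : ℂ} (hz : z.im = 0) : Convex ℝ (insert z {y : ℂ | y.im < 0}) := by
  rw [convex_iff_forall_pos]
  rintro x hx y hy a b ha hb hab
  rcases hx with rfl | hx <;> rcases hy with rfl | hy
  · left; rw [← add_smul, hab, one_smul]
  · right; simp only [Set.mem_ofPred_eq] at hy ⊢; simp [hz]; nlinarith
  · right; simp only [Set.mem_ofPred_eq] at hx ⊢; simp [hz]; nlinarith
  · right; simp only [Set.mem_ofPred_eq] at hx hy ⊢; simp; nlinarith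

end PointMotion
end

noncomputable section

open CategoryTheory

/-- All three paths are images of segments in the simply connected line. This cuts a circle into
arcs parametrised by the angle. -/
theorem homOf_arc {X : Type*} [TopologicalSpace X] (f : C(ℝ, X)) {a b c : X} {s t u : ℝ}
    (p : Path a b) (q : Path b c) (r : Path a c)
    (hp : ∀ τ : unitInterval, p τ = f ((1 - (τ : ℝ)) * s + τ * t))
    (hq : ∀ τ : unitInterval, q τ = f ((1 - (τ : ℝ)) * t + τ * u))
    (hr : ∀ τ : unitInterval, r τ = f ((1 - (τ : ℝ)) * s + τ * u)) :
    homOf r = homOf p ≫ homOf q := by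
  obtain rfl : a = f s := by simpa using hp 0
  obtain rfl : b = f t := by simpa using hp 1
  obtain rfl : c = f u := by simpa using hq 1
  have key : ((Path.segment s u).map f.continuous).Homotopic
      (((Path.segment s t).trans (Path.segment t u)).map f.continuous) :=
    (SimplyConnectedSpace.paths_homotopic _ _).map f
  have e1 : r = (Path.segment s u).map f.continuous := by
    ext τ; simp [hr, AffineMap.lineMap_apply]; congr 1; ring
  have e2 : p = (Path.segment s t).map f.continuous := by
    ext τ; simp [hp, AffineMap.lineMap_apply]; congr 1; ring
  have e3 : q = (Path.segment t u).map f.continuous := by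
    ext τ; simp [hq, AffineMap.lineMap_apply]; congr 1; ring
  rw [e1, e2, e3, homOf_eq key, Path.map_trans, homOf_trans]

namespace PointMotion

variable {ι E : Type*} [AddCommGroup E] [Module ℝ E] (P : PointMotion ι E)

section Fibre

variable {d : E} {q : ι → ℝ} (hq : ∀ i, P.pt i d = q i)
include hq

theorem pt_notMem_insert_im_pos {c : ℝ} (hc : ∀ i, q i ≠ c) (i : ι) :
    P.pt i d ∉ insert (⟨c, 0⟩ : ℂ) {y : ℂ | 0 < y.im} := by
  rw [hq]
  rintro (h | h)
  · exact hc i (congrArg Complex.re h)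
  · simp at h

theorem pt_notMem_insert_im_neg {c : ℝ} (hc : ∀ i, q i ≠ c) (i : ι) :
    P.pt i d ∉ insert (⟨c, 0⟩ : ℂ) {y : ℂ | y.im < 0} := by
  rw [hq]
  rintro (h | h)
  · exact hc i (congrArg Complex.re h)
  · simp at h

theorem re_pt_ne {c : ℝ} (hc : ∀ i, q i ≠ c) (i : ι) : (P.pt i d).re ≠ c := by
  rw [hq]; exact hc i

variable (hd : d ∈ P.dom)
include hd

theorem upper_segment {c : ℝ} (hc : ∀ i, q i ≠ c) {a b : ℂ}
    (ha : a ∈ insert (⟨c, 0⟩ : ℂ) {y : ℂ | 0 < y.im})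
    (hb : b ∈ insert (⟨c, 0⟩ : ℂ) {y : ℂ | 0 < y.im}) :
    segment ℝ (d, a) (d, b) ⊆ P.space :=
  P.fibre_segment hd (convex_insert_im_pos rfl) (P.pt_notMem_insert_im_pos hq hc) ha hb

theorem lower_segment {c : ℝ} (hc : ∀ i, q i ≠ c) {a b : ℂ}
    (ha : a ∈ insert (⟨c, 0⟩ : ℂ) {y : ℂ | y.im < 0})
    (hb : b ∈ insert (⟨c, 0⟩ : ℂ) {y : ℂ | y.im < 0}) :
    segment ℝ (d, a) (d, b) ⊆ P.space :=
  P.fibre_segment hd (convex_insert_im_neg rfl) (P.pt_notMem_insert_im_neg hq hc) ha hb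

end Fibre

variable [TopologicalSpace E] [IsTopologicalAddGroup E] [ContinuousSMul ℝ E]

section Real

variable {d : E} (hd : d ∈ P.dom) {q : ι → ℝ} (hq : ∀ i, P.pt i d = q i)
include hd hq

theorem upper_comp {c : ℝ} (hc : ∀ i, q i ≠ c) {x y z : ℂ}
    (hx : x ∈ insert (⟨c, 0⟩ : ℂ) {y : ℂ | 0 < y.im})
    (hy : y ∈ insert (⟨c, 0⟩ : ℂ) {y : ℂ | 0 < y.im})
    (hz : z ∈ insert (⟨c, 0⟩ : ℂ) {y : ℂ | 0 < y.im}) (hxy : segment ℝ (d, x) (d, y) ⊆ P.space)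
    (hyz : segment ℝ (d, y) (d, z) ⊆ P.space) (hxz : segment ℝ (d, x) (d, z) ⊆ P.space) :
    seg hxy ≫ seg hyz = seg hxz :=
  P.fibre_comp hd (convex_insert_im_pos rfl) (P.pt_notMem_insert_im_pos hq hc) hx hy hz _ _ _

theorem lower_comp {c : ℝ} (hc : ∀ i, q i ≠ c) {x y z : ℂ}
    (hx : x ∈ insert (⟨c, 0⟩ : ℂ) {y : ℂ | y.im < 0})
    (hy : y ∈ insert (⟨c, 0⟩ : ℂ) {y : ℂ | y.im < 0})
    (hz : z ∈ insert (⟨c, 0⟩ : ℂ) {y : ℂ | y.im < 0}) (hxy : segment ℝ (d, x) (d, y) ⊆ P.space)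
    (hyz : segment ℝ (d, y) (d, z) ⊆ P.space) (hxz : segment ℝ (d, x) (d, z) ⊆ P.space) :
    seg hxy ≫ seg hyz = seg hxz :=
  P.fibre_comp hd (convex_insert_im_neg rfl) (P.pt_notMem_insert_im_neg hq hc) hx hy hz _ _ _

/-- The vertical line is broken at the real axis, and the upper half is contracted inside a
half-plane to a segment from `y₀`. In this form it can be compared with a loop based at `y₀`. -/
theorem vert_eq_of_real (hK : 0 < P.height) {y₀ : ℂ} (hy₀ : 0 < y₀.im)
    (ho : (d, y₀) ∈ P.topSet) {c : ℝ} (hc : ∀ i, q i ≠ c) :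
    P.vert hd (P.re_pt_ne hq hc) = P.fromBase ho ≫
      seg (P.upper_segment hq hd hc (a := y₀) (b := ⟨c, 0⟩) (Or.inr hy₀) (Or.inl rfl)) ≫
      seg (P.lower_segment hq hd hc (a := ⟨c, 0⟩) (b := ⟨c, -P.height⟩) (Or.inl rfl)
        (Or.inr (neg_neg_of_pos hK))) ≫ P.toNadir (P.mk_mem_botSet hd c) := by
  have hc' := P.re_pt_ne hq hc
  have hA := P.mk_mem_topSet hd c
  have h1 : seg (P.vert_segment hd hc' P.height 0) ≫ seg (P.vert_segment hd hc' 0 (-P.height)) =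
      seg (P.vert_segment hd hc' P.height (-P.height)) :=
    P.fibre_comp hd (convex_re_eq c) hc' rfl rfl rfl _ _ _
  have h2 := P.upper_comp hd hq hc (x := y₀) (y := ⟨c, P.height⟩) (z := ⟨c, 0⟩) (Or.inr hy₀)
    (Or.inr hK) (Or.inl rfl) (P.top_segment ho hA) (P.vert_segment hd hc' _ _)
    (P.upper_segment hq hd hc (Or.inr hy₀) (Or.inl rfl))
  rw [vert, cross, ← h1, ← h2, fromBase, fromBase, ← P.top_comp P.base_mem ho hA]
  simp only [Category.assoc]

end Real

end PointMotion
end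

noncomputable section

open CategoryTheory

namespace PointMotion

variable {ι E : Type*} [AddCommGroup E] [Module ℝ E] (P : PointMotion ι E)
  [TopologicalSpace E] [IsTopologicalAddGroup E] [ContinuousSMul ℝ E]

/-- A point of the circle of radius `r` around `c`, at angle `2πu` from its highest point. -/
theorem circle_point_eq (c r u : ℝ) :
    (c : ℂ) + r * (Complex.I * Complex.exp ((2 * Real.pi * u : ℝ) * Complex.I)) =
      ⟨c - r * Real.sin (2 * Real.pi * u), r * Real.cos (2 * Real.pi * u)⟩ := by
  rw [Complex.exp_mul_I, ← Complex.ofReal_cos, ← Complex.ofReal_sin]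
  apply Complex.ext <;> simp [-Complex.ofReal_cos, -Complex.ofReal_sin]
  ring

/-- The elementary loop around a point of a real configuration crosses to the bottom on the left
of the point and comes back on the right. -/
theorem homOf_loop {d : E} (hd : d ∈ P.dom) {q : ι → ℝ} (hq : ∀ i, P.pt i d = q i) {y₀ : ℂ}
    (hy₀ : 0 < y₀.im) (ho : (d, y₀) ∈ P.topSet) {k : ι} {r : ℝ} (hr : 0 < r)
    {zT : ℂ} (hzT : zT = q k + r * Complex.I)
    (hT : (d, zT) ∈ P.space) (desc : Path (⟨(d, y₀), P.topSet_subset ho⟩ : P.space) ⟨(d, zT), hT⟩)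
    (circ : Path (⟨(d, zT), hT⟩ : P.space) ⟨(d, zT), hT⟩)
    (hdesc : ∀ t, (desc t : E × ℂ) = (d, (1 - (t : ℝ)) * y₀ + (t : ℝ) * zT))
    (hcirc : ∀ t, (circ t : E × ℂ) =
      (d, q k + r * (Complex.I * Complex.exp ((2 * Real.pi * (t : ℝ) : ℝ) * Complex.I))))
    (hl : ∀ i, (P.pt i d).re ≠ q k - r) (hr' : ∀ i, (P.pt i d).re ≠ q k + r) :
    P.fromBase ho ≫ (homOf desc ≫ homOf circ ≫ inv (homOf desc)) ≫ inv (P.fromBase ho) =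
      P.vert hd hl ≫ inv (P.vert hd hr') := by
  have hK : 0 < P.height := by
    have := P.neg_height_lt d hd k
    rw [hq, Complex.ofReal_im] at this
    linarith
  have hl' : ∀ i, q i ≠ q k - r := fun i => by simpa [hq] using hl i
  have hr'' : ∀ i, q i ≠ q k + r := fun i => by simpa [hq] using hr' i
  obtain rfl : zT = ⟨q k, r⟩ := by rw [hzT]; apply Complex.ext <;> simp
  -- the circle as a continuous function of the angle
  have hf : ∀ u : ℝ, ((d, (⟨q k - r * Real.sin (2 * Real.pi * u),
      r * Real.cos (2 * Real.pi * u)⟩ : ℂ)) : E × ℂ) ∈ P.space := by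
    intro u
    refine ⟨hd, fun i h => ?_⟩
    rw [hq] at h
    have h1 := congrArg Complex.re h
    have h2 := congrArg Complex.im h
    simp only [Complex.ofReal_re, Complex.ofReal_im] at h1 h2
    -- Since the points are real, the circle could meet one only where it crosses the real axis, at
    -- `q k - r` or `q k + r`; both are excluded.
    have hc : Real.cos (2 * Real.pi * u) = 0 := by
      rcases mul_eq_zero.1 h2 with h | h
      · exact absurd h hr.ne'
      · exact h
    have hs := Real.sin_sq_add_cos_sq (2 * Real.pi * u)
    rw [hc] at hs
    have hs' : (Real.sin (2 * Real.pi * u) - 1) * (Real.sin (2 * Real.pi * u) + 1) = 0 := by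
      linarith
    rcases mul_eq_zero.1 hs' with h | h
    · exact hl' i (by rw [← h1, sub_eq_zero.1 h]; ring)
    · exact hr'' i (by rw [← h1, eq_neg_of_add_eq_zero_left h]; ring)
  let f : C(ℝ, P.space) := ⟨fun u => ⟨_, hf u⟩, by
    have : Continuous fun u : ℝ => (⟨q k - r * Real.sin (2 * Real.pi * u),
        r * Real.cos (2 * Real.pi * u)⟩ : ℂ) := by
      simp only [← circle_point_eq]
      fun_prop
    fun_prop⟩
  have hπ := Real.pi_pos
  have c4 : Real.cos (2 * Real.pi * (1 / 4)) = 0 := by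
    rw [show 2 * Real.pi * (1 / 4) = Real.pi / 2 by ring, Real.cos_pi_div_two]
  have s4 : Real.sin (2 * Real.pi * (1 / 4)) = 1 := by
    rw [show 2 * Real.pi * (1 / 4) = Real.pi / 2 by ring, Real.sin_pi_div_two]
  have c34 : Real.cos (2 * Real.pi * (3 / 4)) = 0 := by
    rw [show 2 * Real.pi * (3 / 4) = Real.pi / 2 + Real.pi by ring, Real.cos_add_pi,
      Real.cos_pi_div_two, neg_zero]
  have s34 : Real.sin (2 * Real.pi * (3 / 4)) = -1 := by
    rw [show 2 * Real.pi * (3 / 4) = Real.pi / 2 + Real.pi by ring, Real.sin_add_pi,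
      Real.sin_pi_div_two]
  have c2 : Real.cos (2 * Real.pi * (1 / 2)) = -1 := by
    rw [show 2 * Real.pi * (1 / 2) = Real.pi by ring, Real.cos_pi]
  have s2 : Real.sin (2 * Real.pi * (1 / 2)) = 0 := by
    rw [show 2 * Real.pi * (1 / 2) = Real.pi by ring, Real.sin_pi]
  have hzl : (d, (⟨q k - r, 0⟩ : ℂ)) ∈ P.space := by
    simpa only [s4, c4, mul_one, mul_zero] using hf (1 / 4)
  have hzb : (d, (⟨q k, -r⟩ : ℂ)) ∈ P.space := by
    simpa only [s2, c2, mul_neg, mul_one, mul_zero, sub_zero] using hf (1 / 2)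
  have hzr : (d, (⟨q k + r, 0⟩ : ℂ)) ∈ P.space := by
    simpa only [s34, c34, mul_neg, mul_one, mul_zero, sub_neg_eq_add] using hf (3 / 4)
  let arc (s t : ℝ) (a b : P.space) (ha : f s = a) (hb : f t = b) : Path a b :=
    ⟨⟨fun τ => f ((1 - (τ : ℝ)) * s + τ * t), by fun_prop⟩, by simpa using ha, by simpa using hb⟩
  let zt : P.space := ⟨(d, ⟨q k, r⟩), hT⟩
  have e0 : f 0 = zt := by ext <;> simp [f, zt]
  have e1 : f 1 = zt := by ext <;> simp [f, zt]
  have el : f (1 / 4) = ⟨_, hzl⟩ := by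
    apply Subtype.ext; simp only [f, ContinuousMap.coe_mk, s4, c4, mul_one, mul_zero]
  have eb : f (1 / 2) = ⟨_, hzb⟩ := by
    apply Subtype.ext; simp only [f, ContinuousMap.coe_mk, s2, c2, mul_zero, sub_zero, mul_neg,
      mul_one]
  have er : f (3 / 4) = ⟨_, hzr⟩ := by
    apply Subtype.ext; simp only [f, ContinuousMap.coe_mk, s34, c34, mul_zero, sub_neg_eq_add,
      mul_neg, mul_one]
  -- The circle is cut at its leftmost, lowest and rightmost points. Each quarter lies in an open
  -- half-plane together with one point of the real axis, so it is homotopic to its chord.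
  have hcirc4 : homOf circ = homOf (arc 0 (1 / 4) zt _ e0 el) ≫ homOf (arc (1 / 4) (1 / 2) _ _ el eb)
      ≫ homOf (arc (1 / 2) (3 / 4) _ _ eb er) ≫ homOf (arc (3 / 4) 1 _ zt er e1) := by
    have hc : ∀ τ, circ τ = f ((1 - (τ : ℝ)) * 0 + τ * 1) := fun τ => by
      apply Subtype.ext
      rw [hcirc, circle_point_eq]
      simp [f]
    rw [homOf_arc f (arc 0 (1 / 4) zt _ e0 el) (arc (1 / 4) 1 _ zt el e1) circ (fun _ => rfl)
      (fun _ => rfl) hc, homOf_arc f (arc (1 / 4) (1 / 2) _ _ el eb) (arc (1 / 2) 1 _ zt eb e1)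
      (arc (1 / 4) 1 _ zt el e1) (fun _ => rfl) (fun _ => rfl) (fun _ => rfl),
      homOf_arc f (arc (1 / 2) (3 / 4) _ _ eb er) (arc (3 / 4) 1 _ zt er e1)
      (arc (1 / 2) 1 _ zt eb e1) (fun _ => rfl) (fun _ => rfl) (fun _ => rfl)]
  -- the four quarters of the circle
  have up : ∀ {c u : ℝ}, 0 < Real.cos (2 * Real.pi * u) →
      (f u : E × ℂ) ∈ ({d} : Set E) ×ˢ insert (⟨c, 0⟩ : ℂ) {y : ℂ | 0 < y.im} := fun h =>
    ⟨rfl, Or.inr (mul_pos hr h)⟩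
  have lo : ∀ {c u : ℝ}, Real.cos (2 * Real.pi * u) < 0 →
      (f u : E × ℂ) ∈ ({d} : Set E) ×ˢ insert (⟨c, 0⟩ : ℂ) {y : ℂ | y.im < 0} := fun h =>
    ⟨rfl, Or.inr (mul_neg_of_pos_of_neg hr h)⟩
  have a1 : homOf (arc 0 (1 / 4) zt _ e0 el) =
      seg (P.upper_segment hq hd hl' (Or.inr hr) (Or.inl rfl)) := by
    refine homOf_eq_seg (a := (d, ⟨q k, r⟩)) (b := (d, ⟨q k - r, 0⟩))
      ((convex_singleton d).prod (convex_insert_im_pos (z := ⟨q k - r, 0⟩) rfl))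
      (P.singleton_prod_subset hd (P.pt_notMem_insert_im_pos hq hl'))
      (P.upper_segment hq hd hl' (Or.inr hr) (Or.inl rfl)) (arc 0 (1 / 4) zt _ e0 el) fun τ => ?_
    change (f _ : E × ℂ) ∈ _
    have h0 := τ.2.1
    have h1 := τ.2.2
    rcases h1.eq_or_lt with h | h
    · rw [h, show (1 - (1 : ℝ)) * 0 + 1 * (1 / 4) = 1 / 4 by ring, el]
      exact ⟨rfl, Or.inl rfl⟩
    · exact up (Real.cos_pos_of_mem_Ioo ⟨by nlinarith, by nlinarith⟩)
  have a2 : homOf (arc (1 / 4) (1 / 2) _ _ el eb) =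
      seg (P.lower_segment hq hd hl' (Or.inl rfl) (Or.inr (neg_neg_of_pos hr))) := by
    refine homOf_eq_seg (a := (d, ⟨q k - r, 0⟩)) (b := (d, ⟨q k, -r⟩))
      ((convex_singleton d).prod (convex_insert_im_neg (z := ⟨q k - r, 0⟩) rfl))
      (P.singleton_prod_subset hd (P.pt_notMem_insert_im_neg hq hl'))
      (P.lower_segment hq hd hl' (Or.inl rfl) (Or.inr (neg_neg_of_pos hr))) (arc (1 / 4) (1 / 2) _ _ el eb) fun τ => ?_
    change (f _ : E × ℂ) ∈ _
    have h0 := τ.2.1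
    have h1 := τ.2.2
    rcases h0.eq_or_lt with h | h
    · rw [← h, show (1 - (0 : ℝ)) * (1 / 4) + 0 * (1 / 2) = 1 / 4 by ring, el]
      exact ⟨rfl, Or.inl rfl⟩
    · exact lo (Real.cos_neg_of_pi_div_two_lt_of_lt (by nlinarith) (by nlinarith))
  have a3 : homOf (arc (1 / 2) (3 / 4) _ _ eb er) =
      seg (P.lower_segment hq hd hr'' (Or.inr (neg_neg_of_pos hr)) (Or.inl rfl)) := by
    refine homOf_eq_seg (a := (d, ⟨q k, -r⟩)) (b := (d, ⟨q k + r, 0⟩))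
      ((convex_singleton d).prod (convex_insert_im_neg (z := ⟨q k + r, 0⟩) rfl))
      (P.singleton_prod_subset hd (P.pt_notMem_insert_im_neg hq hr''))
      (P.lower_segment hq hd hr'' (Or.inr (neg_neg_of_pos hr)) (Or.inl rfl)) (arc (1 / 2) (3 / 4) _ _ eb er) fun τ => ?_
    change (f _ : E × ℂ) ∈ _
    have h0 := τ.2.1
    have h1 := τ.2.2
    rcases h1.eq_or_lt with h | h
    · rw [h, show (1 - (1 : ℝ)) * (1 / 2) + 1 * (3 / 4) = 3 / 4 by ring, er]
      exact ⟨rfl, Or.inl rfl⟩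
    · exact lo (Real.cos_neg_of_pi_div_two_lt_of_lt (by nlinarith) (by nlinarith))
  have a4 : homOf (arc (3 / 4) 1 _ zt er e1) =
      seg (P.upper_segment hq hd hr'' (Or.inl rfl) (Or.inr hr)) := by
    refine homOf_eq_seg (a := (d, ⟨q k + r, 0⟩)) (b := (d, ⟨q k, r⟩))
      ((convex_singleton d).prod (convex_insert_im_pos (z := ⟨q k + r, 0⟩) rfl))
      (P.singleton_prod_subset hd (P.pt_notMem_insert_im_pos hq hr''))
      (P.upper_segment hq hd hr'' (Or.inl rfl) (Or.inr hr)) (arc (3 / 4) 1 _ zt er e1) fun τ => ?_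
    change (f _ : E × ℂ) ∈ _
    have h0 := τ.2.1
    have h1 := τ.2.2
    rcases h0.eq_or_lt with h | h
    · rw [← h, show (1 - (0 : ℝ)) * (3 / 4) + 0 * 1 = 3 / 4 by ring, er]
      exact ⟨rfl, Or.inl rfl⟩
    · refine up ?_
      -- The angle lies in `(3π/2, 2π]`; subtracting `2π` moves it to the interval where the cosine
      -- is known to be positive.
      rw [← Real.cos_sub_two_pi]
      exact Real.cos_pos_of_mem_Ioo ⟨by nlinarith, by nlinarith⟩
  have hoT := P.upper_segment hq hd hl' (a := y₀) (b := ⟨q k, r⟩) (Or.inr hy₀) (Or.inr hr)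
  have hTo := P.upper_segment hq hd hl' (a := ⟨q k, r⟩) (b := y₀) (Or.inr hr) (Or.inr hy₀)
  have hds : homOf desc = seg hoT := by
    have : desc = segPath hoT := by
      apply Path.ext
      funext t
      apply Subtype.ext
      rw [hdesc]
      simp only [segPath, Path.coe_mk_mk, Prod.smul_mk, Prod.mk_add_mk, ← add_smul,
        sub_add_cancel, one_smul, Complex.real_smul, Complex.ofReal_sub, Complex.ofReal_one]
    rw [this]; rfl
  have hBl := P.mk_mem_botSet hd (q k - r)
  have hBr := P.mk_mem_botSet hd (q k + r)
  have hneg : -P.height < 0 := neg_neg_of_pos hK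
  have hnr : -r < 0 := neg_neg_of_pos hr
  have hLb := P.lower_segment hq hd hl' (a := ⟨q k - r, -P.height⟩) (b := ⟨q k, -r⟩)
    (Or.inr hneg) (Or.inr hnr)
  have hbR := P.lower_segment hq hd hl' (a := ⟨q k, -r⟩) (b := ⟨q k + r, -P.height⟩)
    (Or.inr hnr) (Or.inr hneg)
  have f1 := P.upper_comp hd hq hl' (x := y₀) (y := ⟨q k, r⟩) (z := ⟨q k - r, 0⟩) (Or.inr hy₀)
    (Or.inr hr) (Or.inl rfl) hoT (P.upper_segment hq hd hl' (Or.inr hr) (Or.inl rfl))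
    (P.upper_segment hq hd hl' (Or.inr hy₀) (Or.inl rfl))
  have f2 := P.lower_comp hd hq hl' (x := ⟨q k - r, 0⟩) (y := ⟨q k - r, -P.height⟩) (z := ⟨q k, -r⟩)
    (Or.inl rfl) (Or.inr hneg) (Or.inr hnr)
    (P.lower_segment hq hd hl' (Or.inl rfl) (Or.inr hneg)) hLb
    (P.lower_segment hq hd hl' (Or.inl rfl) (Or.inr hnr))
  have f3 := P.lower_comp hd hq hr'' (x := ⟨q k, -r⟩) (y := ⟨q k + r, -P.height⟩)
    (z := ⟨q k + r, 0⟩) (Or.inr hnr) (Or.inr hneg) (Or.inl rfl) hbR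
    (P.lower_segment hq hd hr'' (Or.inr hneg) (Or.inl rfl))
    (P.lower_segment hq hd hr'' (Or.inr hnr) (Or.inl rfl))
  have f4 := P.upper_comp hd hq hr'' (x := ⟨q k + r, 0⟩) (y := ⟨q k, r⟩) (z := y₀) (Or.inl rfl)
    (Or.inr hr) (Or.inr hy₀) (P.upper_segment hq hd hr'' (Or.inl rfl) (Or.inr hr)) hTo
    (P.upper_segment hq hd hr'' (Or.inl rfl) (Or.inr hy₀))
  have f5 := P.lower_comp hd hq hl' (x := ⟨q k - r, -P.height⟩) (y := ⟨q k, -r⟩)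
    (z := ⟨q k + r, -P.height⟩) (Or.inr hneg) (Or.inr hnr) (Or.inr hneg) hLb hbR
    (P.bot_segment hBl hBr)
  have f6 := P.bot_comp hBl hBr P.nadir_mem
  -- The upper quarters contract with the descent from `y₀`. The lower quarters are rerouted through
  -- depth `-P.height`, where the connection between the two abscissae is also the way of the two
  -- crossings through the lower base point.
  rw [P.vert_eq_of_real hd hq hK hy₀ ho hl', P.vert_eq_of_real hd hq hK hy₀ ho hr'', toNadir,
    ← f6, ← f5, hds, inv_seg hoT hTo, hcirc4, a1, a2, a3, a4, ← f2, ← f3]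
  simp only [Category.assoc, reassoc_of% f1, reassoc_of% f4, IsIso.inv_comp]
  rw [inv_seg _ (P.lower_segment hq hd hr'' (a := ⟨q k + r, -P.height⟩) (b := ⟨q k + r, 0⟩)
    (Or.inr hneg) (Or.inl rfl)), inv_seg _ (P.upper_segment hq hd hr'' (a := ⟨q k + r, 0⟩) (b := y₀)
    (Or.inl rfl) (Or.inr hy₀))]
  simp [toNadir]

end PointMotion
end

noncomputable section

open CategoryTheory

theorem convex_line (ε g : ℝ) : Convex ℝ {y : ℂ | y.im = ε * (g - y.re)} := by
  intro x (hx : _ = _) y (hy : _ = _) a b _ _ hab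
  change (a • x + b • y).im = ε * (g - (a • x + b • y).re)
  obtain rfl : b = 1 - a := by linarith
  simp [hx, hy]
  ring

/-- In a strip where all points lie under the slanted line, this is a convex region free of points;
the next set plays the same role when they lie above it. -/
theorem convex_above (ε g m M : ℝ) :
    Convex ℝ {y : ℂ | m ≤ y.re ∧ y.re ≤ M ∧ ε * (g - y.re) ≤ y.im} := by
  rintro x ⟨h1, h2, h3⟩ y ⟨h1', h2', h3'⟩ a b ha hb hab
  obtain rfl : b = 1 - a := by linarith
  refine ⟨?_, ?_, ?_⟩ <;> simp <;> nlinarith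

theorem convex_below (ε g m M : ℝ) :
    Convex ℝ {y : ℂ | m ≤ y.re ∧ y.re ≤ M ∧ y.im ≤ ε * (g - y.re)} := by
  rintro x ⟨h1, h2, h3⟩ y ⟨h1', h2', h3'⟩ a b ha hb hab
  obtain rfl : b = 1 - a := by linarith
  refine ⟨?_, ?_, ?_⟩ <;> simp <;> nlinarith

namespace PointMotion

variable {ι E : Type*} [AddCommGroup E] [Module ℝ E] (P : PointMotion ι E)

theorem line_segment {d : E} (hd : d ∈ P.dom) {ε g : ℝ}
    (hline : ∀ i, (P.pt i d).im ≠ ε * (g - (P.pt i d).re)) (c c' : ℝ) :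
    segment ℝ (d, (⟨c, ε * (g - c)⟩ : ℂ)) (d, ⟨c', ε * (g - c')⟩) ⊆ P.space :=
  P.fibre_segment hd (convex_line ε g) hline rfl rfl

variable [TopologicalSpace E] [IsTopologicalAddGroup E] [ContinuousSMul ℝ E]

/-! ### A slanted line in terms of vertical lines -/

theorem vert_eq_split {d : E} (hd : d ∈ P.dom) {c : ℝ} (y : ℝ) (hc : ∀ i, (P.pt i d).re ≠ c) :
    P.vert hd hc = (P.fromBase (P.mk_mem_topSet hd c) ≫
      seg (P.vert_segment hd hc P.height y)) ≫
      seg (P.vert_segment hd hc y (-P.height)) ≫ P.toNadir (P.mk_mem_botSet hd c) := by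
  have h : seg (P.vert_segment hd hc P.height y) ≫
      seg (P.vert_segment hd hc y (-P.height)) =
      seg (P.vert_segment hd hc P.height (-P.height)) :=
    P.fibre_comp hd (convex_re_eq c) hc rfl rfl rfl _ _ _
  rw [vert, cross, ← h]
  simp only [Category.assoc]

section Slanted

variable {d : E} (hd : d ∈ P.dom) {ε g : ℝ}
  (hline : ∀ i, (P.pt i d).im ≠ ε * (g - (P.pt i d).re))

include hd hline

theorem line_comp (c c' c'' : ℝ) :
    seg (P.line_segment hd hline c c') ≫ seg (P.line_segment hd hline c' c'') =
      seg (P.line_segment hd hline c c'') :=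
  P.fibre_comp hd (convex_line ε g) hline rfl rfl rfl _ _ _

variable {a b : ℝ} (ha : (d, (⟨a, ε * (g - a)⟩ : ℂ)) ∈ P.topSet)
  (hb : (d, (⟨b, ε * (g - b)⟩ : ℂ)) ∈ P.botSet)

/-- The loop at the base point that follows the line `y = ε (g - x)` from the top region to the
abscissa `c` and returns vertically. -/
def slantLoop {c : ℝ} (hc : ∀ i, (P.pt i d).re ≠ c) : P.baseObj ⟶ P.baseObj :=
  P.fromBase ha ≫ seg (P.line_segment hd hline a c) ≫
    inv (P.fromBase (P.mk_mem_topSet hd c) ≫ seg (P.vert_segment hd hc P.height (ε * (g - c))))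

/-- Between the abscissae the part of the strip above the line is convex and free of points, so the
vertical return may slide from `c` to `c'`. -/
theorem slantLoop_eq_of_above {c c' : ℝ} (hc : ∀ i, (P.pt i d).re ≠ c)
    (hc' : ∀ i, (P.pt i d).re ≠ c') (hK : ε * (g - c) ≤ P.height) (hK' : ε * (g - c') ≤ P.height)
    (h : ∀ i, min c c' ≤ (P.pt i d).re → (P.pt i d).re ≤ max c c' →
      (P.pt i d).im < ε * (g - (P.pt i d).re)) :
    P.slantLoop hd hline ha hc' = P.slantLoop hd hline ha hc := by
  have hA := P.mk_mem_topSet hd c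
  have hA' := P.mk_mem_topSet hd c'
  have hC : ∀ i, P.pt i d ∉ {y : ℂ | min c c' ≤ y.re ∧ y.re ≤ max c c' ∧
      ε * (g - y.re) ≤ y.im} := fun i hi => (h i hi.1 hi.2.1).not_ge hi.2.2
  have hl := le_max_left c c'
  have hr := le_max_right c c'
  have hl' := min_le_left c c'
  have hr' := min_le_right c c'
  have hac' := P.fibre_segment hd (convex_above ε g _ _) hC (a := ⟨c, P.height⟩)
    (b := ⟨c', ε * (g - c')⟩) ⟨hl', hl, hK⟩ ⟨hr', hr, le_rfl⟩
  have e1 := P.fibre_comp hd (convex_above ε g _ _) hC (a := ⟨c, P.height⟩)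
    (b := ⟨c, ε * (g - c)⟩) (c := ⟨c', ε * (g - c')⟩) ⟨hl', hl, hK⟩ ⟨hl', hl, le_rfl⟩
    ⟨hr', hr, le_rfl⟩ (P.vert_segment hd hc _ _) (P.line_segment hd hline c c') hac'
  have e2 := P.fibre_comp hd (convex_above ε g _ _) hC (a := ⟨c, P.height⟩)
    (b := ⟨c', P.height⟩) (c := ⟨c', ε * (g - c')⟩) ⟨hl', hl, hK⟩ ⟨hr', hr, hK'⟩
    ⟨hr', hr, le_rfl⟩ (P.top_segment hA hA') (P.vert_segment hd hc' _ _) hac'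
  have e3 := P.top_comp P.base_mem hA hA'
  have key : P.fromBase hA' ≫ seg (P.vert_segment hd hc' P.height (ε * (g - c'))) =
      (P.fromBase hA ≫ seg (P.vert_segment hd hc P.height (ε * (g - c)))) ≫
        seg (P.line_segment hd hline c c') := by
    rw [Category.assoc, e1, fromBase, ← e3, Category.assoc, e2, fromBase]
  rw [slantLoop, slantLoop, ← P.line_comp hd hline a c c']
  simp only [key, IsIso.inv_comp, Category.assoc, IsIso.hom_inv_id_assoc]

/-- Here the free convex region is the part of the strip below the line. The downward continuations
from `c` and `c'` can be slid into each other, so the two returns differ by a full crossing at `c`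
followed by one back at `c'`. -/
theorem slantLoop_eq_of_below {c c' : ℝ} (hc : ∀ i, (P.pt i d).re ≠ c)
    (hc' : ∀ i, (P.pt i d).re ≠ c') (hK : -P.height ≤ ε * (g - c)) (hK' : -P.height ≤ ε * (g - c'))
    (h : ∀ i, min c c' ≤ (P.pt i d).re → (P.pt i d).re ≤ max c c' →
      ε * (g - (P.pt i d).re) < (P.pt i d).im) :
    P.slantLoop hd hline ha hc' =
      P.slantLoop hd hline ha hc ≫ P.vert hd hc ≫ inv (P.vert hd hc') := by
  have hB := P.mk_mem_botSet hd c
  have hB' := P.mk_mem_botSet hd c'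
  have hC : ∀ i, P.pt i d ∉ {y : ℂ | min c c' ≤ y.re ∧ y.re ≤ max c c' ∧
      y.im ≤ ε * (g - y.re)} := fun i hi => (h i hi.1 hi.2.1).not_ge hi.2.2
  have hl := le_max_left c c'
  have hr := le_max_right c c'
  have hl' := min_le_left c c'
  have hr' := min_le_right c c'
  have hcb := P.fibre_segment hd (convex_below ε g _ _) hC (a := ⟨c, ε * (g - c)⟩)
    (b := ⟨c', -P.height⟩) ⟨hl', hl, le_rfl⟩ ⟨hr', hr, hK'⟩
  have e1 := P.fibre_comp hd (convex_below ε g _ _) hC (a := ⟨c, ε * (g - c)⟩)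
    (b := ⟨c', ε * (g - c')⟩) (c := ⟨c', -P.height⟩) ⟨hl', hl, le_rfl⟩ ⟨hr', hr, le_rfl⟩
    ⟨hr', hr, hK'⟩ (P.line_segment hd hline c c') (P.vert_segment hd hc' _ _) hcb
  have e2 := P.fibre_comp hd (convex_below ε g _ _) hC (a := ⟨c, ε * (g - c)⟩)
    (b := ⟨c, -P.height⟩) (c := ⟨c', -P.height⟩) ⟨hl', hl, le_rfl⟩ ⟨hl', hl, hK⟩
    ⟨hr', hr, hK'⟩ (P.vert_segment hd hc _ _) (P.bot_segment hB hB') hcb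
  have e3 := P.bot_comp hB hB' P.nadir_mem
  have key : seg (P.vert_segment hd hc (ε * (g - c)) (-P.height)) ≫ P.toNadir hB =
      seg (P.line_segment hd hline c c') ≫
        seg (P.vert_segment hd hc' (ε * (g - c')) (-P.height)) ≫ P.toNadir hB' := by
    rw [reassoc_of% e1, toNadir, ← e3, reassoc_of% e2, toNadir]
  rw [slantLoop, slantLoop, ← P.line_comp hd hline a c c']
  simp only [P.vert_eq_split hd (ε * (g - c)) hc, P.vert_eq_split hd (ε * (g - c')) hc', key]
  simp

/-- The loop contracts in the half-plane to the left of all points and in the top region. -/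
theorem slantLoop_eq_id {c : ℝ} (hc : ∀ i, (P.pt i d).re ≠ c) (hac : a ≤ c)
    (h : ∀ i, c < (P.pt i d).re) : P.slantLoop hd hline ha hc = 𝟙 _ := by
  have hA := P.mk_mem_topSet hd c
  have hC : ∀ i, P.pt i d ∉ {y : ℂ | y.re ≤ c} := fun i hi => (h i).not_ge hi
  have e1 := P.fibre_comp hd (convex_halfSpace_re_le c) hC (a := ⟨a, ε * (g - a)⟩)
    (b := ⟨c, P.height⟩) (c := ⟨c, ε * (g - c)⟩) hac (le_refl c) (le_refl c)
    (P.top_segment ha hA) (P.vert_segment hd hc _ _) (P.line_segment hd hline a c)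
  have e2 := P.top_comp P.base_mem ha hA
  rw [slantLoop, ← e1]
  simp only [fromBase, ← e2]
  simp

/-- To the right of all points the remaining part of the slanted line can be turned into the
vertical one inside a half-plane. -/
theorem cross_line_eq {c : ℝ} (hc : ∀ i, (P.pt i d).re ≠ c) (hcb : c ≤ b)
    (h : ∀ i, (P.pt i d).re < c) : P.cross (P.line_segment hd hline a b) ha hb =
      P.slantLoop hd hline ha hc ≫ P.vert hd hc := by
  have hB := P.mk_mem_botSet hd c
  have hC : ∀ i, P.pt i d ∉ {y : ℂ | c ≤ y.re} := fun i hi => (h i).not_ge hi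
  have e1 := P.fibre_comp hd (convex_halfSpace_re_ge c) hC (a := ⟨c, ε * (g - c)⟩)
    (b := ⟨c, -P.height⟩) (c := ⟨b, ε * (g - b)⟩) (le_refl c) (le_refl c) hcb
    (P.vert_segment hd hc _ _) (P.bot_segment hB hb) (P.line_segment hd hline c b)
  have e2 := P.bot_comp hB hb P.nadir_mem
  rw [P.vert_eq_split hd (ε * (g - c)) hc, slantLoop, cross, ← P.line_comp hd hline a c b, ← e1]
  simp only [toNadir, ← e2]
  simp

end Slanted

end PointMotion
end

/-! ### Tilting a vertical line and reading off its word -/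

noncomputable section

open CategoryTheory

namespace PointMotion

theorem ne_add_of_small {ι : Type*} {q : ι → ℝ} {r : ℝ} (hr : 0 < r)
    (hq : ∀ i j, i ≠ j → r < |q i - q j|) {δ : ℝ} (hδ : |δ| = r) (i k : ι) : q i ≠ q k + δ := by
  intro h
  have h1 : |q i - q k| = r := by rw [h, add_sub_cancel_left, hδ]
  rcases eq_or_ne i k with rfl | hik
  · rw [sub_self, abs_zero] at h1
    exact hr.ne h1
  · exact (hq i k hik).ne' h1

variable {ι : Type*} (P : PointMotion ι (ℝ × ℝ))

/-- Crossing vertically between real points before the motion is crossing along a slanted line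
at the end of an upper path of parameters. -/
theorem vert_eq_cross (hdom : P.dom = Set.Icc 0 1 ×ˢ Set.Icc 0 1) {q q' : ι → ℝ} {ε : ℝ}
    (hε : 0 < ε) (hleft : ∀ s ∈ Set.Icc (0 : ℝ) 1, ∀ i, (P.pt i (s, 0)).re = q i)
    (htop : ∀ u ∈ Set.Icc (0 : ℝ) 1, ∀ i,
      P.pt i (1, u) = ⟨q i - u * (q i - q' i), ε * (q i - q' i)⟩)
    {g : ℝ} (h00 : (0, 0) ∈ P.dom) (h11 : (1, 1) ∈ P.dom)
    (hg : ∀ i, (P.pt i (0, 0)).re ≠ g)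
    (hline : ∀ i, (P.pt i (1, 1)).im ≠ ε * (g - (P.pt i (1, 1)).re))
    (ha : ((1, 1), (⟨g - P.height / ε, ε * (g - (g - P.height / ε))⟩ : ℂ)) ∈ P.topSet)
    (hb : ((1, 1), (⟨g + P.height / ε, ε * (g - (g + P.height / ε))⟩ : ℂ)) ∈ P.botSet) :
    P.vert h00 hg = P.cross (P.line_segment h11 hline _ _) ha hb := by
  have hg' : ∀ i, q i ≠ g := fun i => by
    rw [← hleft 0 ⟨le_rfl, zero_le_one⟩]; exact hg i
  have h10 : ((1 : ℝ), (0 : ℝ)) ∈ P.dom := by rw [hdom]; simp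
  -- On the left edge the points move only vertically, so the crossing is first carried from `(0,0)`
  -- to `(1,0)` unchanged.
  have hseg : ∀ e ∈ segment ℝ ((0 : ℝ), (0 : ℝ)) (1, 0), ∀ i, (P.pt i e).re ≠ g := by
    rintro _ ⟨a, b, ha, hb, hab, rfl⟩ i
    have e1 : a • ((0 : ℝ), (0 : ℝ)) + b • ((1 : ℝ), (0 : ℝ)) = (b, 0) := by simp
    rw [e1, hleft b ⟨hb, by linarith⟩]
    exact hg' i
  rw [P.vert_eq_vert h00 h10 hseg]
  refine P.cross_eq_of_square _ _ _ _ _ _ fun u hu t ht => ?_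
  -- At time `u` the bilinear square is the segment of the line `Re = g - u Im / ε` between the
  -- heights `P.height` and `-P.height`.
  have e1 : (1 - t) • ((1 - u) • (((1 : ℝ), (0 : ℝ)), (⟨g, P.height⟩ : ℂ)) +
      u • ((1, 1), ⟨g - P.height / ε, ε * (g - (g - P.height / ε))⟩)) +
      t • ((1 - u) • ((1, 0), ⟨g, -P.height⟩) +
      u • ((1, 1), ⟨g + P.height / ε, ε * (g - (g + P.height / ε))⟩)) =
      ((1, u), ⟨g - u * ((1 - 2 * t) * P.height / ε), (1 - 2 * t) * P.height⟩) := by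
    refine Prod.ext (Prod.ext ?_ ?_) (Complex.ext ?_ ?_)
    · simp
    · simp; ring
    · simp; ring
    · simp; field_simp; ring
  rw [e1]
  refine ⟨by rw [hdom]; exact ⟨⟨zero_le_one, le_rfl⟩, hu⟩, fun i h => hg' i ?_⟩
  rw [htop u hu] at h
  have h1 := congrArg Complex.re h
  have h2 := congrArg Complex.im h
  simp only at h1 h2
  -- The `i`-th point has imaginary part `ε (q i - q' i)`. On the tilted line this would give it the
  -- abscissa `g - u (q i - q' i)` and hence force `q i = g`, whatever `u` is.
  rw [h2, mul_div_cancel_left₀ _ hε.ne'] at h1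
  linarith

/-- The loop at the base point that crosses on the left of the point `q' k` and comes back on its
right. -/
def vertLoop {d : ℝ × ℝ} (hd : d ∈ P.dom) {a b : ℝ} (ha : ∀ i, (P.pt i d).re ≠ a)
    (hb : ∀ i, (P.pt i d).re ≠ b) : P.baseObj ⟶ P.baseObj :=
  P.vert hd ha ≫ inv (P.vert hd hb)

/-- At the end of the motion the slanted line runs below the points with `g < q i` and above the
others. `Z j` is the slanted loop that returns just to the right of the `j`-th point. Passing a
point below appends its loop and passing it above changes nothing. -/
theorem exists_word (hdom : P.dom = Set.Icc 0 1 ×ˢ Set.Icc 0 1) {q q' : ι → ℝ} {ε : ℝ}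
    (hε : 0 < ε) (hleft : ∀ s ∈ Set.Icc (0 : ℝ) 1, ∀ i, (P.pt i (s, 0)).re = q i)
    (htop : ∀ u ∈ Set.Icc (0 : ℝ) 1, ∀ i,
      P.pt i (1, u) = ⟨q i - u * (q i - q' i), ε * (q i - q' i)⟩)
    (hright : ∀ s ∈ Set.Icc (0 : ℝ) 1, ∀ i, (P.pt i (s, 1)).re = q' i)
    {g : ℝ} (h00 : (0, 0) ∈ P.dom) (h01 : (0, 1) ∈ P.dom)
    (hg : ∀ i, (P.pt i (0, 0)).re ≠ g)
    {r : ℝ} (hr : 0 < r) (hrq : ∀ i j, i ≠ j → r < |q' i - q' j|)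
    (hK : ∀ i, |ε * (g - (q' i - r))| ≤ P.height ∧ |ε * (g - (q' i + r))| ≤ P.height)
    (hm : ∀ k i, (P.pt i (0, 1)).re ≠ q' k - r) (hp : ∀ k i, (P.pt i (0, 1)).re ≠ q' k + r)
    {n : ℕ} (e : Fin (n + 1) ≃ ι) (he : StrictMono (q' ∘ e)) :
    ∃ Z : Fin (n + 1) → (P.baseObj ⟶ P.baseObj),
      (Z 0 = if g < q (e 0) then P.vertLoop h01 (hm (e 0)) (hp (e 0)) else 𝟙 _) ∧
      (∀ j : Fin n, Z j.succ = if g < q (e j.succ) then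
        Z j.castSucc ≫ P.vertLoop h01 (hm (e j.succ)) (hp (e j.succ)) else Z j.castSucc) ∧
      P.vert h00 hg = Z (Fin.last n) ≫ P.vert h01 (hp (e (Fin.last n))) := by
  have hg' : ∀ i, q i ≠ g := fun i => by
    rw [← hleft 0 ⟨le_rfl, zero_le_one⟩]; exact hg i
  have h11 : ((1 : ℝ), (1 : ℝ)) ∈ P.dom := by rw [hdom]; simp
  have hre : ∀ i, (P.pt i (1, 1)).re = q' i := hright 1 ⟨zero_le_one, le_rfl⟩
  have him : ∀ i, (P.pt i (1, 1)).im = ε * (q i - q' i) := fun i => by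
    rw [htop 1 ⟨zero_le_one, le_rfl⟩]
  have hline : ∀ i, (P.pt i (1, 1)).im ≠ ε * (g - (P.pt i (1, 1)).re) := fun i h => by
    rw [hre, him] at h
    have := mul_left_cancel₀ hε.ne' h
    exact hg' i (by linarith)
  have habove : ∀ i, ¬ g < q i → (P.pt i (1, 1)).im < ε * (g - (P.pt i (1, 1)).re) := fun i h => by
    rw [hre, him]
    have := lt_of_le_of_ne (not_lt.1 h) (hg' i)
    gcongr
  have hbelow : ∀ i, g < q i → ε * (g - (P.pt i (1, 1)).re) < (P.pt i (1, 1)).im := fun i h => by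
    rw [hre, him]
    gcongr
  -- The ends of the slanted segment are the places where the line reaches the heights `P.height`
  -- and `-P.height`.
  have ea : ε * (g - (g - P.height / ε)) = P.height := by field_simp; ring
  have eb : ε * (g - (g + P.height / ε)) = -P.height := by field_simp; ring
  have ha : ((1, 1), (⟨g - P.height / ε, ε * (g - (g - P.height / ε))⟩ : ℂ)) ∈ P.topSet :=
    ⟨h11, P.top_le.trans ea.ge⟩
  have hb : ((1, 1), (⟨g + P.height / ε, ε * (g - (g + P.height / ε))⟩ : ℂ)) ∈ P.botSet :=
    ⟨h11, eb.le⟩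
  have hne : ∀ c, (∀ i, q' i ≠ c) → ∀ i, (P.pt i (1, 1)).re ≠ c := fun c h i => by
    rw [hre]; exact h i
  have hm0 : ∀ k i, q' i ≠ q' k - r := fun k i => by
    rw [sub_eq_add_neg]; exact ne_add_of_small hr hrq (by rw [abs_neg, abs_of_pos hr]) i k
  have hp0 : ∀ k i, q' i ≠ q' k + r := fun k i => ne_add_of_small hr hrq (abs_of_pos hr) i k
  have hm1 : ∀ k i, (P.pt i (1, 1)).re ≠ q' k - r := fun k => hne _ (hm0 k)
  have hp1 : ∀ k i, (P.pt i (1, 1)).re ≠ q' k + r := fun k => hne _ (hp0 k)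
  -- vertical crossings agree on the right edge
  have hv : ∀ c (hc : ∀ i, q' i ≠ c) (hc0 : ∀ i, (P.pt i (0, 1)).re ≠ c)
      (hc1 : ∀ i, (P.pt i (1, 1)).re ≠ c), P.vert h01 hc0 = P.vert h11 hc1 := fun c hc hc0 hc1 => by
    refine P.vert_eq_vert h01 h11 ?_
    rintro _ ⟨a, b, ha, hb, hab, rfl⟩ i
    have e1 : a • ((0 : ℝ), (1 : ℝ)) + b • ((1 : ℝ), (1 : ℝ)) = (b, 1) := by simp [hab]
    rw [e1, hright b ⟨hb, by linarith⟩]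
    exact hc i
  have hstep : ∀ k, P.slantLoop h11 hline ha (hp1 k) = if g < q k then
      P.slantLoop h11 hline ha (hm1 k) ≫ P.vertLoop h01 (hm k) (hp k) else
      P.slantLoop h11 hline ha (hm1 k) := by
    intro k
    have honly : ∀ i, min (q' k - r) (q' k + r) ≤ (P.pt i (1, 1)).re →
        (P.pt i (1, 1)).re ≤ max (q' k - r) (q' k + r) → i = k := by
      intro i h1 h2
      rw [hre, min_eq_left (by linarith)] at h1
      rw [hre, max_eq_right (by linarith)] at h2
      by_contra hik
      exact (hrq i k hik).not_ge (abs_le.2 ⟨by linarith, by linarith⟩)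
    split_ifs with hk
    · simp only [vertLoop, hv _ (hm0 k) (hm k) (hm1 k), hv _ (hp0 k) (hp k) (hp1 k)]
      refine P.slantLoop_eq_of_below h11 hline ha (hm1 k) (hp1 k) (abs_le.1 (hK k).1).1
        (abs_le.1 (hK k).2).1 fun i h1 h2 => ?_
      rw [honly i h1 h2]
      exact hbelow k hk
    · refine P.slantLoop_eq_of_above h11 hline ha (hm1 k) (hp1 k) (abs_le.1 (hK k).1).2
        (abs_le.1 (hK k).2).2 fun i h1 h2 => ?_
      rw [honly i h1 h2]
      exact habove k hk
  refine ⟨fun j => P.slantLoop h11 hline ha (hp1 (e j)), ?_, fun j => ?_, ?_⟩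
  · beta_reduce
    rw [hstep, P.slantLoop_eq_id h11 hline ha (hm1 (e 0)), Category.id_comp]
    · have := (abs_le.1 (hK (e 0)).1).2
      rw [← ea] at this
      have := le_of_mul_le_mul_left this hε
      linarith
    · intro i
      rw [hre]
      have : q' (e 0) ≤ q' i := by
        simpa using he.monotone (Fin.zero_le (e.symm i))
      linarith
  · have hgap : P.slantLoop h11 hline ha (hm1 (e j.succ)) =
        P.slantLoop h11 hline ha (hp1 (e j.castSucc)) := by
      refine P.slantLoop_eq_of_above h11 hline ha (hp1 _) (hm1 _) (abs_le.1 (hK _).2).2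
        (abs_le.1 (hK _).1).2 fun i h1 h2 => ?_
      exfalso
      rw [hre] at h1 h2
      have h3 : q' (e j.castSucc) < q' (e j.succ) := he (Fin.castSucc_lt_succ)
      have h4 := hrq (e j.succ) (e j.castSucc) (by simp [Fin.ext_iff])
      rw [abs_of_pos (by linarith)] at h4
      have h5 : q' (e j.castSucc) < q' i := by
        refine lt_of_lt_of_le (lt_min ?_ ?_) h1 <;> linarith
      have h6 : q' i < q' (e j.succ) := by
        refine lt_of_le_of_lt h2 (max_lt ?_ ?_) <;> linarith
      obtain ⟨l, rfl⟩ := e.surjective i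
      have h7 : j.castSucc < l := he.lt_iff_lt.1 h5
      have h8 : l < j.succ := he.lt_iff_lt.1 h6
      simp only [Fin.lt_def, Fin.val_castSucc, Fin.val_succ] at h7 h8
      omega
    beta_reduce
    rw [hstep, hgap]
  · rw [P.vert_eq_cross hdom hε hleft htop h00 h11 hg hline ha hb,
      hv _ (hp0 _) (hp _) (hp1 (e (Fin.last n)))]
    refine P.cross_line_eq h11 hline ha hb (hp1 _) ?_ fun i => ?_
    · have := (abs_le.1 (hK (e (Fin.last n))).2).1
      rw [← eb] at this
      have := le_of_mul_le_mul_left this hε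
      linarith
    · rw [hre]
      have : q' i ≤ q' (e (Fin.last n)) := by
        simpa using he.monotone (Fin.le_last (e.symm i))
      linarith

end PointMotion
end

noncomputable section

/-! ### The linear algebra of the transport formula -/

section Algebra

variable {K V : Type*} [Field K] [AddCommGroup V] [Module K V]

/-- Summation by parts. `D j` is the class of a partial word and `τ j` its action. A letter acting
by `z` adds `τ (1 - z) a`, which is the drop of `τ` times `a`; an absent letter adds zero and leaves
`τ` unchanged. -/
theorem eq_sub_sum_of_word {n : ℕ} (a D : Fin (n + 1) → V) (τ : Fin (n + 1) → K)
    (h0 : D 0 = (1 - τ 0) • a 0)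
    (hs : ∀ j : Fin n, D j.succ = D j.castSucc + (τ j.castSucc - τ j.succ) • a j.succ) :
    D (Fin.last n) = a 0 - ∑ j : Fin n, τ j.castSucc • (a j.castSucc - a j.succ) -
      τ (Fin.last n) • a (Fin.last n) := by
  induction n with
  | zero => simp [h0, sub_smul]
  | succ n ih =>
    have h := ih (fun j => a j.castSucc) (fun j => D j.castSucc) (fun j => τ j.castSucc) h0
      (fun j => hs j.castSucc)
    have hl := hs (Fin.last n)
    rw [Fin.succ_last] at hl
    rw [hl, h, Fin.sum_univ_castSucc]
    simp only [Fin.succ_castSucc, Fin.succ_last, Fin.castSucc_zero]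
    module

theorem prod_filter_eq_mul {n : ℕ} (σ : Equiv.Perm (Fin (n + 1))) (s : Fin (n + 1) → K)
    {P Q : Fin (n + 1) → Prop} [DecidablePred P] [DecidablePred Q] (i j : Fin (n + 1))
    (hP : ∀ k, P k ↔ k = i ∨ Q k) (hQ : ¬ Q i) :
    ∏ k with P k ∧ σ k ≤ j, s k =
      (if σ i ≤ j then s i else 1) * ∏ k with Q k ∧ σ k ≤ j, s k := by
  classical
  split_ifs with h
  · rw [← Finset.prod_insert (s := {k | Q k ∧ σ k ≤ j}) (by simp [hQ])]
    congr 1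
    ext k
    simp only [Finset.mem_filter, Finset.mem_univ, true_and, Finset.mem_insert, hP]
    constructor
    · rintro ⟨rfl | h1, h2⟩
      · exact Or.inl rfl
      · exact Or.inr ⟨h1, h2⟩
    · rintro (rfl | ⟨h1, h2⟩)
      · exact ⟨Or.inl rfl, h⟩
      · exact ⟨Or.inr h1, h2⟩
  · rw [one_mul]
    congr 1
    ext k
    simp only [Finset.mem_filter, Finset.mem_univ, true_and, hP]
    constructor
    · rintro ⟨rfl | h1, h2⟩
      · exact absurd h2 h
      · exact ⟨h1, h2⟩
    · exact fun ⟨h1, h2⟩ => ⟨Or.inr h1, h2⟩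

/-- The class attached to the `i`-th point, in terms of the words on its two sides. -/
theorem inv_smul_word_sub {n : ℕ} (σ : Equiv.Perm (Fin (n + 1))) (s : Fin (n + 1) → K)
    (a : Fin (n + 1) → V) (i : Fin (n + 1)) (hs : s i ≠ 1) (D D' : V)
    (hD : D = a 0 - ∑ j : Fin n, (∏ k with i ≤ k ∧ σ k ≤ j.castSucc, s k) •
        (a j.castSucc - a j.succ) - (∏ k with i ≤ k ∧ σ k ≤ Fin.last n, s k) • a (Fin.last n))
    (hD' : D' = a 0 - ∑ j : Fin n, (∏ k with i < k ∧ σ k ≤ j.castSucc, s k) •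
        (a j.castSucc - a j.succ) - (∏ k with i < k ∧ σ k ≤ Fin.last n, s k) • a (Fin.last n)) :
    (1 - s i)⁻¹ • (D - s i • D') = a 0 - ∑ j : Fin n,
      (if j.castSucc < σ i then ∏ k with i < k ∧ σ k ≤ j.castSucc, s k else 0) •
        (a j.castSucc - a j.succ) := by
  have h1 : 1 - s i ≠ 0 := sub_ne_zero.2 hs.symm
  rw [inv_smul_eq_iff₀ h1, hD, hD']
  simp only [fun j => prod_filter_eq_mul σ s i j (P := fun k => i ≤ k) (Q := fun k => i < k)
    (fun k => by rw [le_iff_eq_or_lt, eq_comm]) (lt_irrefl i)]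
  rw [if_pos (Fin.le_last _)]
  -- For `j ≥ σ i` the extra letter contributes `s i`, which the subtraction of `s i • D'` cancels.
  -- For `j < σ i` the factor `1 - s i` remains, and the terms with `a (Fin.last n)` cancel.
  have h2 : ∀ j : Fin n, (if σ i ≤ j.castSucc then s i else 1) = s i + (1 - s i) *
      (if j.castSucc < σ i then 1 else 0) := fun j => by
    by_cases h : σ i ≤ j.castSucc
    · rw [if_pos h, if_neg h.not_gt]; ring
    · rw [if_neg h, if_pos (not_le.1 h)]; ring
  have h3 : ∑ j : Fin n, ((if σ i ≤ j.castSucc then s i else 1) *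
      ∏ k with i < k ∧ σ k ≤ j.castSucc, s k) • (a j.castSucc - a j.succ) =
      s i • ∑ j : Fin n, (∏ k with i < k ∧ σ k ≤ j.castSucc, s k) • (a j.castSucc - a j.succ) +
      (1 - s i) • ∑ j : Fin n,
      (if j.castSucc < σ i then ∏ k with i < k ∧ σ k ≤ j.castSucc, s k else 0) •
        (a j.castSucc - a j.succ) := by
    rw [Finset.smul_sum, Finset.smul_sum, ← Finset.sum_add_distrib]
    refine Finset.sum_congr rfl fun j _ => ?_
    rw [h2, smul_smul, smul_smul, ← add_smul]
    congr 1
    split_ifs <;> ring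
  rw [h3]
  module

/-- For `j < σ (i + 1)` the index `i + 1` does not enter the product over `k > i`, so there both
sums have equal weights. They cancel below the minimum of the two positions, and the longer sum
fixes the sign of the rest. -/
theorem sub_eq_sign_smul_sum {n : ℕ} (σ : Equiv.Perm (Fin (n + 1))) (s : Fin (n + 1) → K)
    (a : Fin (n + 1) → V) (i : Fin n) :
    (a 0 - ∑ j : Fin n, (if j.castSucc < σ i.castSucc then
        ∏ k with i.castSucc < k ∧ σ k ≤ j.castSucc, s k else 0) • (a j.castSucc - a j.succ)) -
      (a 0 - ∑ j : Fin n, (if j.castSucc < σ i.succ then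
        ∏ k with i.succ < k ∧ σ k ≤ j.castSucc, s k else 0) • (a j.castSucc - a j.succ)) =
    (if σ i.castSucc < σ i.succ then (1 : K) else -1) •
      ∑ j : Fin n with min (σ i.castSucc) (σ i.succ) ≤ j.castSucc ∧
          j.castSucc < max (σ i.castSucc) (σ i.succ),
        (∏ k with i.castSucc < k ∧ σ k ≤ j.castSucc, s k) • (a j.castSucc - a j.succ) := by
  rw [sub_sub_sub_cancel_left, ← Finset.sum_sub_distrib, Finset.smul_sum, Finset.sum_filter]
  refine Finset.sum_congr rfl fun j _ => ?_
  rw [prod_filter_eq_mul σ s i.succ j.castSucc (P := fun k => i.castSucc < k)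
    (Q := fun k => i.succ < k) (fun k => by
      simp only [Fin.lt_def, Fin.ext_iff, Fin.val_castSucc, Fin.val_succ]; omega) (lt_irrefl _)]
  have hne : σ i.castSucc ≠ σ i.succ := fun h => by
    simpa [Fin.ext_iff] using σ.injective h
  rw [← sub_smul, smul_smul, ← ite_zero_smul]
  congr 1
  -- Only the relative order of the two positions and of `j` matters from here on.
  generalize σ i.castSucc = A at *
  generalize σ i.succ = B at *
  generalize j.castSucc = J at *
  rcases hne.lt_or_gt with h | h
  · simp only [min_eq_left h.le, max_eq_right h.le, if_pos h]
    by_cases hA : J < A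
    · simp [hA, hA.trans h, (hA.trans h).not_ge, hA.not_ge]
    · by_cases hB : J < B
      · simp [hA, hB, hB.not_ge, not_lt.1 hA]
      · simp [hA, hB]
  · simp only [min_eq_right h.le, max_eq_left h.le, if_neg h.not_gt]
    by_cases hB : J < B
    · simp [hB, hB.trans h, hB.not_ge]
    · by_cases hA : J < A
      · simp [hA, hB, not_lt.1 hB]
      · simp [hA, hB]

end Algebra
end

/-! ### Transport of fibres and the total space over a family of parameters -/

noncomputable section

open CategoryTheory

namespace LineArrangement

variable {n m : ℕ} (A : LineArrangement n m)

theorem continuous_height (i : Fin n) : Continuous (A.height i) := by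
  unfold height; fun_prop

theorem im_height (i : Fin n) (z : ℂ) : (A.height i z).im = A.slope i * z.im := by
  simp [height]

theorem height_ne_of_mem_base {z : ℂ} (hz : z ∈ A.base) {i j : Fin n} (hij : i ≠ j) :
    A.height i z ≠ A.height j z := fun h =>
  hz ⟨(z, A.height i z), ⟨Sum.inl i, Sum.inl j, by simpa using hij, by simp [form],
    by simp [form, h]⟩, rfl⟩

/-- If two real lines meet over a nonreal abscissa, comparing imaginary parts gives equal slopes,
and then the intercepts agree. Vertical lines have real abscissae. -/
theorem mem_base_of_im_ne_zero {z : ℂ} (hz : z.im ≠ 0) : z ∈ A.base := by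
  have hv : ∀ j, z ≠ A.vert j := fun j h => hz (by rw [h, Complex.ofReal_im])
  rintro ⟨⟨z', y⟩, ⟨l, l', hll, h, h'⟩, rfl : z' = z⟩
  rcases l with i | j
  · rcases l' with i' | j
    · have e : A.height i z' = A.height i' z' :=
        (sub_eq_zero.1 h).symm.trans (sub_eq_zero.1 h')
      have hs : A.slope i = A.slope i' := by
        have := congrArg Complex.im e
        rw [im_height, im_height] at this
        exact mul_right_cancel₀ hz this
      have hi : A.intercept i = A.intercept i' := by
        simpa [height, hs] using e
      exact hll (congrArg Sum.inl (A.lines_injective (Prod.ext hs hi)))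
    · exact hv j (sub_eq_zero.1 h')
  · exact hv j (sub_eq_zero.1 h)

theorem ne_height_of_mem_compl {z y : ℂ} (h : (z, y) ∈ A.compl) (i : Fin n) : y ≠ A.height i z :=
  sub_ne_zero.1 (h (Sum.inl i))

/-- Fibres can be transported along every path in the base. -/
theorem nonempty_fibreTransport [NeZero n] {x x' : ℂ} (γ : Path x x') (hγ : ∀ u, γ u ∈ A.base) :
    Nonempty (A.FibreTransport γ) := by
  obtain ⟨Ψ, hΨ, hΨ0, hΨ1⟩ := exists_push (p := fun (i : Fin n) (u : ℝ) => A.height i (γ.extend u))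
    (fun i => (A.continuous_height i).comp γ.continuous_extend) (isCompact_Icc (a := 0) (b := 1))
    (convex_Icc 0 1) (fun d hd i j hij => by
      rw [Path.extend_apply γ hd]
      exact A.height_ne_of_mem_base (hγ _) hij)
  have key : ∀ (u : unitInterval) (y : A.fibre x), (γ u, Ψ (0, u, y)) ∈ A.compl := fun u y => by
    refine A.mem_compl_of_mem_base (hγ u) fun i => ?_
    have := hΨ1 0 ⟨le_rfl, zero_le_one⟩ u u.2 y (fun i => by
      rw [Path.extend_zero]; exact A.ne_height_of_mem_compl y.2 i) i
    rwa [Path.extend_apply γ u.2] at this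
  exact ⟨{
    endMap := ⟨fun y => ⟨Ψ (0, 1, y), by simpa using key 1 y⟩, by fun_prop⟩
    lift :=
      { toFun := fun z => ⟨(γ z.1, Ψ (0, z.1, z.2)), key z.1 z.2⟩
        continuous_toFun := by fun_prop
        map_zero_left := fun y => by
          apply Subtype.ext
          simp [incl, hΨ0]
        map_one_left := fun y => by
          apply Subtype.ext
          simp [incl] }
    fst_lift := fun t y => rfl }⟩

end LineArrangement

namespace PointMotion

variable {n m : ℕ} {A : LineArrangement n m}

section

variable {E : Type*} [NormedAddCommGroup E] [NormedSpace ℝ E] {P : PointMotion (Fin n) E}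
  {G : E → ℂ} (hP : ∀ d i, P.pt i d = A.height i (G d)) (hG : Continuous G)

/-- The inclusion of a fibre of an arrangement into the complement of moving points that are the
intersections with its lines. -/
def fibreIncl {d : E} (hd : d ∈ P.dom) {x : ℂ} (hx : G d = x) : C(A.fibre x, P.space) where
  toFun y := ⟨(d, y), hd, fun i => by
    rw [hP, hx]
    exact A.ne_height_of_mem_compl y.2 i⟩

variable [NeZero n] (hbase : ∀ d ∈ P.dom, G d ∈ A.base)

/-- The complement of moving points that are the intersections of a moving fibre with the lines of
an arrangement maps to the complement of the arrangement. -/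
def toCompl : C(P.space, A.compl) where
  toFun w := ⟨(G w.1.1, w.1.2), A.mem_compl_of_mem_base (hbase _ w.2.1) fun i => by
    rw [← hP]
    exact w.2.2 i⟩

variable (s : Fin n → ℂˣ) (t : Fin m → ℂˣ)

/-- The local system on the complement of the moving points. -/
def motionSystem : RankOneLocalSystem ℂ P.space :=
  (A.localSystem s t).pullback (toCompl hP hG hbase)

theorem along_map_fibreIncl {d : E} (hd : d ∈ P.dom) {x : ℂ} (hx : G d = x) {a b : A.fibre x}
    (p : Path a b) : (motionSystem hP hG hbase s t).along
      (p.map (fibreIncl hP hd hx).continuous) = (A.fibreSystem s t x).along p := by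
  rw [motionSystem, LineArrangement.fibreSystem, RankOneLocalSystem.along_pullback,
    RankOneLocalSystem.along_pullback]
  refine RankOneLocalSystem.along_eq_of_forall _ _ _ fun u => Subtype.ext ?_
  change ((G d, (p u : ℂ)) : ℂ × ℂ) = (x, (p u : ℂ))
  rw [hx]

/-- The map from chains modulo boundaries in a fibre to those in the complement of the moving
points. -/
def fibreMap {d : E} (hd : d ∈ P.dom) {x : ℂ} (hx : G d = x) :
    (RankOneLocalSystem.Chain ℂ (A.fibre x) 1 ⧸ (A.fibreSystem s t x).boundaries) →ₗ[ℂ]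
      RankOneLocalSystem.Chain ℂ P.space 1 ⧸ (motionSystem hP hG hbase s t).boundaries :=
  RankOneLocalSystem.mapChainQuotient _ _ (fibreIncl hP hd hx) (fun _ => 1) (by
    intro a b p
    rw [along_map_fibreIncl, mul_one, one_mul])

theorem fibreMap_pathClass {d : E} (hd : d ∈ P.dom) {x : ℂ} (hx : G d = x) {a b : A.fibre x}
    (p : Path a b) : fibreMap hP hG hbase s t hd hx ((A.fibreSystem s t x).pathClass p) =
      (motionSystem hP hG hbase s t).homClass (homOf (p.map (fibreIncl hP hd hx).continuous)) := by
  have h := RankOneLocalSystem.mapChainQuotient_pathClass (A.fibreSystem s t x)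
    (motionSystem hP hG hbase s t) (fibreIncl hP hd hx) (fun _ => 1) (by
      intro a b p
      rw [along_map_fibreIncl, mul_one, one_mul]) p
  rw [Units.val_one, one_smul] at h
  exact h

/-- Pushing every fibre straight to parameter `d` retracts the total space onto the fibre. The push,
seen in the complement of the arrangement, is a homotopy that identifies the stalks; the induced map
is a left inverse already on chains. -/
theorem fibreMap_injective (hcomp : IsCompact P.dom) {d : E} (hd : d ∈ P.dom) {x : ℂ}
    (hx : G d = x) : Function.Injective (fibreMap hP hG hbase s t hd hx) := by
  obtain ⟨Ψ, hΨ, hΨ0, hΨ1⟩ := exists_push (p := fun (i : Fin n) (u : E) => A.height i (G u))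
    (fun i => (A.continuous_height i).comp hG) hcomp P.convex_dom
    (fun d hd i j hij => A.height_ne_of_mem_base (hbase d hd) hij)
  have hw : ∀ w : P.space, ∀ i, w.1.2 ≠ A.height i (G w.1.1) := fun w i => by
    rw [← hP]; exact w.2.2 i
  have hmem : ∀ (v : unitInterval) (w : P.space), w.1.1 + (v : ℝ) • (d - w.1.1) ∈ P.dom :=
    fun v w => P.convex_dom.add_smul_sub_mem w.2.1 hd v.2
  have key : ∀ (v : unitInterval) (w : P.space),
      (G (w.1.1 + (v : ℝ) • (d - w.1.1)), Ψ (w.1.1, w.1.1 + (v : ℝ) • (d - w.1.1), w.1.2)) ∈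
        A.compl := fun v w =>
    A.mem_compl_of_mem_base (hbase _ (hmem v w)) (hΨ1 _ w.2.1 _ (hmem v w) _ (hw w))
  let ρ : C(P.space, A.fibre x) := ⟨fun w => ⟨Ψ (w.1.1, d, w.1.2), by
    simpa [hx] using key 1 w⟩, by fun_prop⟩
  let H : (toCompl hP hG hbase).Homotopy ((A.incl x).comp ρ) :=
    { toFun := fun z => ⟨_, key z.1 z.2⟩
      continuous_toFun := by fun_prop
      map_zero_left := fun w => by
        apply Subtype.ext
        simp [toCompl, hΨ0]
      map_one_left := fun w => by
        apply Subtype.ext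
        simp [LineArrangement.incl, ρ, hx] }
  let R := RankOneLocalSystem.mapChainQuotient (motionSystem hP hG hbase s t)
    (A.fibreSystem s t x) ρ (fun w => (A.localSystem s t).along (H.evalAt w))
    (fun p => (A.localSystem s t).along_mul_evalAt H p)
  refine Function.LeftInverse.injective (g := R) fun z => ?_
  obtain ⟨c, rfl⟩ := Submodule.mkQ_surjective _ z
  change Submodule.mkQ _ (RankOneLocalSystem.chainMap ρ _ 1
    (RankOneLocalSystem.chainMap (fibreIncl hP hd hx) _ 1 c)) = _
  congr 1
  induction c using Finsupp.induction_linear with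
  | zero => simp
  | add c c' h h' => simp only [map_add, h, h']
  | single σ c =>
    rw [RankOneLocalSystem.chainMap_single, RankOneLocalSystem.chainMap_single]
    have e1 : ρ.comp ((fibreIncl hP hd hx).comp σ) = σ := by
      ext z
      simp [ρ, fibreIncl, hΨ0]
    -- On the fibre over `d` itself the push is constant, so the identification of stalks is
    -- trivial.
    have e2 : (A.localSystem s t).along (H.evalAt (RankOneLocalSystem.lead
        ((fibreIncl hP hd hx).comp σ))) = 1 := by
      rw [← (A.localSystem s t).along_refl (A.incl x (RankOneLocalSystem.lead σ))]
      refine RankOneLocalSystem.along_eq_of_forall _ _ _ fun u => Subtype.ext ?_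
      change (G (d + (u : ℝ) • (d - d)), Ψ (d, d + (u : ℝ) • (d - d),
        (σ (stdSimplex.vertex 0) : ℂ))) = (x, (σ (stdSimplex.vertex 0) : ℂ))
      rw [sub_self, smul_zero, add_zero, hΨ0, hx]
    rw [e1, e2, Units.val_one, mul_one, mul_one]

end

end PointMotion
end

/-! ### Classes of words in elementary loops; transport in the total space -/

noncomputable section

open CategoryTheory

theorem prod_filter_and {κ M : Type*} [Fintype κ] [CommMonoid M] (s : κ → M) (R Q : κ → Prop)
    [DecidablePred R] [DecidablePred Q] :
    ∏ k with R k ∧ Q k, s k = ∏ k with Q k, if R k then s k else 1 := by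
  rw [← Finset.prod_filter, Finset.filter_filter]
  simp only [and_comm]

theorem RankOneLocalSystem.alongHom_word {K X : Type*} [Field K] [TopologicalSpace X]
    (L : RankOneLocalSystem K X) {b : FundamentalGroupoid X} {n : ℕ} (σ : Equiv.Perm (Fin (n + 1)))
    (R : Fin (n + 1) → Prop) [DecidablePred R] (β Z : Fin (n + 1) → (b ⟶ b))
    (s : Fin (n + 1) → K) (hs : ∀ k, (L.alongHom (β (σ k)) : K) = s k)
    (h0 : Z 0 = if R (σ.symm 0) then β 0 else 𝟙 b)
    (hsucc : ∀ j : Fin n, Z j.succ =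
      if R (σ.symm j.succ) then Z j.castSucc ≫ β j.succ else Z j.castSucc) (j : Fin (n + 1)) :
    (L.alongHom (Z j) : K) = ∏ k with R k ∧ σ k ≤ j, s k := by
  have hs' : ∀ j, (L.alongHom (β j) : K) = s (σ.symm j) := fun j => by
    rw [← hs, Equiv.apply_symm_apply]
  rw [prod_filter_and]
  induction j using Fin.induction with
  | zero =>
    have : ({k | σ k ≤ 0} : Finset (Fin (n + 1))) = {σ.symm 0} := by
      ext k
      simp [Equiv.eq_symm_apply]
    rw [this, Finset.prod_singleton, h0]
    split_ifs
    · exact hs' 0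
    · simp [alongHom_id]
  | succ j ih =>
    have : ({k | σ k ≤ j.succ} : Finset (Fin (n + 1))) =
        insert (σ.symm j.succ) ({k | σ k ≤ j.castSucc} : Finset (Fin (n + 1))) := by
      ext k
      simp only [Finset.mem_filter, Finset.mem_univ, true_and, Finset.mem_insert,
        Equiv.eq_symm_apply, Fin.le_def, Fin.ext_iff, Fin.val_succ, Fin.val_castSucc]
      omega
    rw [this, Finset.prod_insert (by simp), ← ih, hsucc]
    split_ifs
    · rw [alongHom_comp, Units.val_mul, hs', mul_comm]
    · rw [one_mul]

/-- The letter at position `j` is present when the line there satisfies `R` in the old order. The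
crossed homomorphism rule puts the partial words into the form of `eq_sub_sum_of_word`, with
`alongHom_word` supplying the weights. -/
theorem RankOneLocalSystem.homClass_word {K X : Type*} [Field K] [TopologicalSpace X]
    (L : RankOneLocalSystem K X) {b : FundamentalGroupoid X} {n : ℕ} (σ : Equiv.Perm (Fin (n + 1)))
    (R : Fin (n + 1) → Prop) [DecidablePred R] (β Z : Fin (n + 1) → (b ⟶ b))
    (s : Fin (n + 1) → K) (hs : ∀ k, (L.alongHom (β (σ k)) : K) = s k) (hs1 : ∀ k, s k ≠ 1)
    (h0 : Z 0 = if R (σ.symm 0) then β 0 else 𝟙 b)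
    (hsucc : ∀ j : Fin n, Z j.succ =
      if R (σ.symm j.succ) then Z j.castSucc ≫ β j.succ else Z j.castSucc)
    (a : Fin (n + 1) → Chain K X 1 ⧸ L.boundaries)
    (ha : ∀ j, a j = (1 - (L.alongHom (β j) : K))⁻¹ • L.homClass (β j)) :
    L.homClass (Z (Fin.last n)) =
      a 0 - ∑ j : Fin n, (∏ k with R k ∧ σ k ≤ j.castSucc, s k) • (a j.castSucc - a j.succ) -
        (∏ k with R k ∧ σ k ≤ Fin.last n, s k) • a (Fin.last n) := by
  have ha' : ∀ j, L.homClass (β j) = (1 - (L.alongHom (β j) : K)) • a j := fun j => by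
    rw [ha, smul_inv_smul₀]
    have := hs1 (σ.symm j)
    rw [← hs, Equiv.apply_symm_apply] at this
    exact sub_ne_zero.2 this.symm
  have hτ := L.alongHom_word σ R β Z s hs h0 hsucc
  simp only [← hτ]
  refine eq_sub_sum_of_word a (fun j => L.homClass (Z j)) (fun j => (L.alongHom (Z j) : K)) ?_
    fun j => ?_
  · rw [h0]
    split_ifs
    · exact ha' 0
    · simp [homClass_id, alongHom_id]
  · rw [hsucc]
    split_ifs
    · rw [homClass_comp, ha', alongHom_comp, Units.val_mul, smul_smul]
      congr 2
      ring
    · simp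

namespace LineArrangement

theorem toChainQuotient_alphaClass {n m : ℕ} (A : LineArrangement (n + 1) m)
    (s : Fin (n + 1) → ℂˣ) (t : Fin m → ℂˣ) (hs : ∀ i, s i ≠ 1) {x : ℝ} (hx : (x : ℂ) ∈ A.base)
    {y₀ : ℂ} (hy₀ : 0 < y₀.im) {r : ℝ} (hr : A.IsSmallRadius x r) (c : ℂ) (i : Fin n) :
    (A.fibreSystem s t x).toChainQuotient (A.alphaClass s t hx hy₀ hr c i) =
      c • ((1 - A.param s x i.castSucc)⁻¹ •
        (A.fibreSystem s t x).pathClass (A.alpha hx hy₀ hr i.castSucc) -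
      (1 - A.param s x i.succ)⁻¹ •
        (A.fibreSystem s t x).pathClass (A.alpha hx hy₀ hr i.succ)) := by
  have h : ∀ k, 1 - A.param s x k ≠ 0 := fun k =>
    sub_ne_zero.2 fun h => hs (A.lineAt x k) (Units.ext h.symm)
  have hc : ∀ {a : A.fibre x} (p : Path a a) (z : ℂ), (A.fibreSystem s t x).boundaries.mkQ
      (Finsupp.single (RankOneLocalSystem.pathSimplex p) z) =
      z • (A.fibreSystem s t x).pathClass p := fun p z => by
    rw [RankOneLocalSystem.pathClass, ← map_smul, Finsupp.smul_single, smul_eq_mul, mul_one]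
  rw [alphaClass, map_smul, tildeClass, RankOneLocalSystem.toChainQuotient_homologyClass]
  delta tildeChain
  rw [map_sub, hc, hc, smul_sub, smul_sub, smul_smul, smul_smul, smul_smul, smul_smul]
  have h1 := h i.castSucc
  have h2 := h i.succ
  congr 2 <;> field_simp

end LineArrangement

namespace PointMotion

variable {n m : ℕ} {A : LineArrangement n m} {E : Type*} [NormedAddCommGroup E] [NormedSpace ℝ E]
  {P : PointMotion (Fin n) E} {G : E → ℂ} (hP : ∀ d i, P.pt i d = A.height i (G d))
  (hG : Continuous G) [NeZero n] (hbase : ∀ d ∈ P.dom, G d ∈ A.base)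
  (s : Fin n → ℂˣ) (t : Fin m → ℂˣ)

/-- In the complement of the moving points, a loop of a fibre and its image under a transport
differ by the way along which the base point moves. -/
theorem exists_fibreMap_transport {x x' : ℂ} {γ : Path x x'} (T : A.FibreTransport γ)
    {δ : unitInterval → E} (hδ : Continuous δ) (hδP : ∀ u, δ u ∈ P.dom) (hδγ : ∀ u, G (δ u) = γ u)
    (b : A.fibre x)
    (hT : ∀ {a b : A.fibre x} (p : Path a b), (A.fibreSystem s t x).along p *
      (A.localSystem s t).along (T.lift.evalAt b) = (A.localSystem s t).along (T.lift.evalAt a) *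
        (A.fibreSystem s t x').along (p.map T.endMap.continuous))
    (h0 : G (δ 0) = x) (h1 : G (δ 1) = x') :
    ∃ v, ∀ p : Path b b, fibreMap hP hG hbase s t (hδP 1) h1
      (RankOneLocalSystem.mapChainQuotient (A.fibreSystem s t x) (A.fibreSystem s t x') T.endMap
        (fun y => (A.localSystem s t).along (T.lift.evalAt y)) hT
        ((A.fibreSystem s t x).pathClass p)) =
      (motionSystem hP hG hbase s t).homClass
        (homOf (p.map (fibreIncl hP (hδP 0) h0).continuous)) -
        (1 - ((A.fibreSystem s t x).along p : ℂ)) • v := by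
  have hmem : ∀ u y, (δ u, (T.lift (u, y)).1.2) ∈ P.space := fun u y => ⟨hδP u, fun i => by
    have h := (T.lift (u, y)).2
    have h' : (T.lift (u, y)).1 = (γ u, (T.lift (u, y)).1.2) := Prod.ext (T.fst_lift u y) rfl
    rw [h'] at h
    rw [hP, hδγ]
    exact A.ne_height_of_mem_compl h i⟩
  let H : (fibreIncl hP (hδP 0) h0).Homotopy ((fibreIncl hP (hδP 1) h1).comp T.endMap) :=
    { toFun := fun z => ⟨_, hmem z.1 z.2⟩
      continuous_toFun := by
        have := map_continuous T.lift
        fun_prop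
      map_zero_left := fun y => by
        refine Subtype.ext (Prod.ext rfl ?_)
        change (T.lift (0, y)).1.2 = y
        rw [T.lift.apply_zero]
        rfl
      map_one_left := fun y => by
        refine Subtype.ext (Prod.ext rfl ?_)
        change (T.lift (1, y)).1.2 = T.endMap y
        rw [T.lift.apply_one]
        rfl }
  have halong : (motionSystem hP hG hbase s t).along (H.evalAt b) =
      (A.localSystem s t).along (T.lift.evalAt b) := by
    rw [motionSystem, RankOneLocalSystem.along_pullback]
    refine RankOneLocalSystem.along_eq_of_forall _ _ _ fun u => Subtype.ext ?_
    exact Prod.ext ((hδγ u).trans (T.fst_lift u b).symm) rfl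
  -- The correction is the class of the track of `b` under the transport. Comparing the two ways
  -- around the square of the homotopy, each as a concatenation, gives the formula.
  refine ⟨(motionSystem hP hG hbase s t).pathClass (H.evalAt b), fun p => ?_⟩
  have e1 := RankOneLocalSystem.mapChainQuotient_pathClass (A.fibreSystem s t x)
    (A.fibreSystem s t x') T.endMap (fun y => (A.localSystem s t).along (T.lift.evalAt y)) hT p
  have e2 := RankOneLocalSystem.pathClass_congr (motionSystem hP hG hbase s t)
    (Path.Homotopic.map_trans_evalAt H p)
  rw [RankOneLocalSystem.pathClass_trans, RankOneLocalSystem.pathClass_trans, halong] at e2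
  have e3 := along_map_fibreIncl hP hG hbase s t (hδP 0) h0 p
  rw [e1, map_smul, fibreMap_pathClass]
  have e4 : (motionSystem hP hG hbase s t).homClass (homOf ((p.map T.endMap.continuous).map
      (fibreIncl hP (hδP 1) h1).continuous)) = (motionSystem hP hG hbase s t).pathClass
      (p.map (map_continuous ((fibreIncl hP (hδP 1) h1).comp T.endMap))) := rfl
  have e5 : (motionSystem hP hG hbase s t).homClass
      (homOf (p.map (fibreIncl hP (hδP 0) h0).continuous)) =
      (motionSystem hP hG hbase s t).pathClass
        (p.map (map_continuous (fibreIncl hP (hδP 0) h0))) := rfl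
  rw [e4, e5, ← e3]
  have e6 : (motionSystem hP hG hbase s t).along (p.map (fibreIncl hP (hδP 0) h0).continuous) =
      (motionSystem hP hG hbase s t).along (p.map (map_continuous (fibreIncl hP (hδP 0) h0))) := rfl
  rw [e6]
  rw [sub_smul, one_smul, ← sub_eq_zero]
  rw [← sub_eq_zero] at e2
  rw [← neg_eq_zero, ← e2]
  abel

end PointMotion
end

/-! ### Change of base point and elementary loops of a real fibre -/

noncomputable section

open CategoryTheory

theorem RankOneLocalSystem.alongHom_conj {K X : Type*} [Field K] [TopologicalSpace X]
    (L : RankOneLocalSystem K X) {a b : FundamentalGroupoid X} (f : b ⟶ a) (g : a ⟶ a) :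
    L.alongHom (f ≫ g ≫ inv f) = L.alongHom g := by
  rw [alongHom_comp, alongHom_comp, alongHom_inv]
  exact mul_inv_cancel_comm_assoc _ _

/-- Expand `[f⁻¹ β f]` by the crossed homomorphism rule. After division by `1 - χ(g)`, when this is
nonzero, the first summand no longer depends on `g`, so it cancels in differences of normalised
loops. -/
theorem RankOneLocalSystem.homClass_conj {K X : Type*} [Field K] [TopologicalSpace X]
    (L : RankOneLocalSystem K X) {a b : FundamentalGroupoid X} (f : b ⟶ a) (g : a ⟶ a)
    (β : b ⟶ b) (h : f ≫ g ≫ inv f = β) :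
    L.homClass g = (1 - (L.alongHom g : K)) • L.homClass (inv f) +
      (L.alongHom (inv f) : K) • L.homClass β := by
  have hg : g = inv f ≫ β ≫ f := by rw [← h]; simp
  have hβ : L.alongHom β = L.alongHom g := by
    rw [← h, alongHom_conj]
  have hf : L.homClass f = -((L.alongHom f : K) • L.homClass (inv f)) := by
    rw [homClass_inv, smul_neg, smul_inv_smul₀ (Units.ne_zero _), neg_neg]
  have hu : (L.alongHom (inv f) : K) * L.alongHom f = 1 := by
    rw [alongHom_inv, Units.inv_mul]
  nth_rw 1 [hg]
  rw [homClass_comp, homClass_comp, hβ, hf, smul_add, smul_neg, smul_neg, smul_smul, smul_smul,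
    mul_right_comm, hu, one_mul, sub_smul, one_smul]
  abel

theorem homOf_conj {X : Type*} [TopologicalSpace X] {a b : X} (p : Path a b) (q : Path b b) :
    homOf ((p.trans q).trans p.symm) = homOf p ≫ homOf q ≫ inv (homOf p) := by
  rw [homOf_trans, homOf_trans, homOf_symm, Category.assoc]

namespace PointMotion

theorem fromBase_self {ι E K : Type*} [Field K] [AddCommGroup E] [Module ℝ E] [TopologicalSpace E]
    [IsTopologicalAddGroup E] [ContinuousSMul ℝ E] (P : PointMotion ι E)
    (L : RankOneLocalSystem K P.space) {a : E × ℂ} (ha : a ∈ P.topSet) (h : a = P.base) :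
    L.alongHom (inv (P.fromBase ha)) = 1 ∧ L.homClass (inv (P.fromBase ha)) = 0 := by
  subst h
  rw [fromBase, seg_self]
  simp [RankOneLocalSystem.alongHom_id, RankOneLocalSystem.homClass_id]

end PointMotion

namespace LineArrangement

section Ordinates

variable {n m : ℕ} (A : LineArrangement n m)

/-- The ordinate of the `i`-th line over a real point. -/
def ordinate (x : ℝ) (i : Fin n) : ℝ := A.slope i * x + A.intercept i

variable {A}

theorem strictMono_ordinate_lineAt {x : ℝ} (hx : (x : ℂ) ∈ A.base) :
    StrictMono (A.ordinate x ∘ A.lineAt x) := by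
  refine (Tuple.monotone_sort (A.ordinate x)).strictMono_of_injective ?_
  refine Function.Injective.comp (fun i j h => ?_) (Equiv.injective _)
  by_contra hij
  refine A.height_ne_of_mem_base hx hij ?_
  rw [height_ofReal, height_ofReal]
  exact congrArg _ h

theorem ordinate_sub_lt_iff {x r : ℝ} (hx : (x : ℂ) ∈ A.base) (hr : A.IsSmallRadius x r)
    (k l : Fin n) :
    A.ordinate x (A.lineAt x k) - r < A.ordinate x (A.lineAt x l) ↔ k ≤ l := by
  have hmono := strictMono_ordinate_lineAt hx
  constructor
  · intro h
    by_contra! hlk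
    have h1 : A.ordinate x (A.lineAt x l) < A.ordinate x (A.lineAt x k) := hmono hlk
    have h2 : r < |A.ordinate x (A.lineAt x k) - A.ordinate x (A.lineAt x l)| :=
      hr.2 _ _ fun h => hlk.ne' ((A.lineAt x).injective h)
    rw [abs_of_pos (sub_pos.2 h1)] at h2
    linarith
  · intro h
    have h1 : A.ordinate x (A.lineAt x k) ≤ A.ordinate x (A.lineAt x l) := hmono.monotone h
    linarith [hr.1]

theorem ordinate_add_lt_iff {x r : ℝ} (hx : (x : ℂ) ∈ A.base) (hr : A.IsSmallRadius x r)
    (k l : Fin n) :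
    A.ordinate x (A.lineAt x k) + r < A.ordinate x (A.lineAt x l) ↔ k < l := by
  have hmono := strictMono_ordinate_lineAt hx
  constructor
  · intro h
    by_contra! hlk
    have h1 : A.ordinate x (A.lineAt x l) ≤ A.ordinate x (A.lineAt x k) := hmono.monotone hlk
    linarith [hr.1]
  · intro h
    have h1 : A.ordinate x (A.lineAt x k) < A.ordinate x (A.lineAt x l) := hmono h
    have h2 : r < |A.ordinate x (A.lineAt x l) - A.ordinate x (A.lineAt x k)| :=
      hr.2 _ _ fun h' => h.ne' ((A.lineAt x).injective h')
    rw [abs_of_pos (sub_pos.2 h1)] at h2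
    linarith

theorem ordinate_ne_sub {x r : ℝ} (hr : A.IsSmallRadius x r) (k i : Fin n) :
    A.ordinate x i ≠ A.ordinate x k - r := by
  rw [sub_eq_add_neg]
  exact PointMotion.ne_add_of_small hr.1 hr.2 (by rw [abs_neg, abs_of_pos hr.1]) i k

theorem ordinate_ne_add {x r : ℝ} (hr : A.IsSmallRadius x r) (k i : Fin n) :
    A.ordinate x i ≠ A.ordinate x k + r :=
  PointMotion.ne_add_of_small hr.1 hr.2 (abs_of_pos hr.1) i k

end Ordinates

section RealFibre

variable {n m : ℕ} {A : LineArrangement n m} {E : Type*} [NormedAddCommGroup E]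
  [NormedSpace ℝ E] {P : PointMotion (Fin n) E} {G : E → ℂ}

theorem pt_re_eq_ordinate (hP : ∀ d i, P.pt i d = A.height i (G d)) {d : E} {x : ℝ}
    (hdx : G d = x) (i : Fin n) : (P.pt i d).re = A.ordinate x i := by
  rw [hP, hdx, height_ofReal, Complex.ofReal_re, ordinate]

variable [NeZero n] (hP : ∀ d i, P.pt i d = A.height i (G d)) {d : E} (hd : d ∈ P.dom) {x : ℝ}
  (hdx : G d = x) (hx : (x : ℂ) ∈ A.base) {y₀ : ℂ} (hy₀ : 0 < y₀.im) {r : ℝ}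
  (hr : A.IsSmallRadius x r) (ho : (d, y₀) ∈ P.topSet) (k : Fin n)

/-- The class of an elementary loop of a real fibre in the complement of the moving points. -/
def alphaHom : (⟨⟨(d, y₀), P.topSet_subset ho⟩⟩ : FundamentalGroupoid P.space) ⟶
    ⟨⟨(d, y₀), P.topSet_subset ho⟩⟩ :=
  homOf ((A.alpha hx hy₀ hr k).map (PointMotion.fibreIncl hP hd hdx).continuous)

/-- In the complement of the moving points, an elementary loop of a real fibre crosses the real
axis on the left of a point and comes back on its right. -/
theorem fromBase_alphaHom (hl : ∀ i, (P.pt i d).re ≠ A.ordinate x (A.lineAt x k) - r)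
    (hr' : ∀ i, (P.pt i d).re ≠ A.ordinate x (A.lineAt x k) + r) :
    P.fromBase ho ≫ A.alphaHom hP hd hdx hx hy₀ hr ho k ≫ inv (P.fromBase ho) =
      P.vert hd hl ≫ inv (P.vert hd hr') := by
  have h := P.homOf_loop hd (q := A.ordinate x) (fun i => by
      rw [hP, hdx, height_ofReal, ordinate]) hy₀ ho (k := A.lineAt x k) hr.1
    (zT := A.height (A.lineAt x k) x + r * Complex.I) (by rw [height_ofReal, ordinate])
    (PointMotion.fibreIncl hP hd hdx (A.topPoint hx hr (A.lineAt x k))).2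
    ((A.descent hx hy₀ hr (A.lineAt x k)).map (PointMotion.fibreIncl hP hd hdx).continuous)
    ((A.circle hx hr (A.lineAt x k)).map (PointMotion.fibreIncl hP hd hdx).continuous)
    (fun t => rfl) (fun t => by
      rw [ordinate, ← height_ofReal]
      rfl) hl hr'
  rw [← h]
  congr 2
  refine Eq.trans (congrArg homOf ?_) (homOf_conj _ _)
  rw [alpha, loop, Path.map_trans, Path.map_trans]
  rfl

variable (hG : Continuous G) (hbase : ∀ d ∈ P.dom, G d ∈ A.base) (s : Fin n → ℂˣ)
  (t : Fin m → ℂˣ)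

theorem alongHom_alphaHom :
    (PointMotion.motionSystem hP hG hbase s t).alongHom (A.alphaHom hP hd hdx hx hy₀ hr ho k) =
      s (A.lineAt x k) :=
  (PointMotion.along_map_fibreIncl hP hG hbase s t hd hdx (A.alpha hx hy₀ hr k)).trans
    (A.along_loop hx hy₀ hr s t (A.lineAt x k))

end RealFibre

end LineArrangement
end

/-! ### The loops over one real point in terms of those over another -/

noncomputable section

open CategoryTheory

namespace LineArrangement

theorem param_ne_one {n m : ℕ} (A : LineArrangement (n + 1) m) {s : Fin (n + 1) → ℂˣ}
    (hs : ∀ i, s i ≠ 1) (x : ℝ) (k : Fin (n + 1)) : A.param s x k ≠ 1 := fun h =>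
  hs (A.lineAt x k) (Units.ext h)

/-- The classes of the elementary loops over a real point, expressed by those over another real
point. -/
theorem inv_smul_homClass_alphaHom {n m : ℕ} {A : LineArrangement (n + 1) m}
    {P : PointMotion (Fin (n + 1)) (ℝ × ℝ)} {G : ℝ × ℝ → ℂ}
    (hP : ∀ d i, P.pt i d = A.height i (G d)) (M : RankOneLocalSystem ℂ P.space)
    (s : Fin (n + 1) → ℂˣ) (hs : ∀ i, s i ≠ 1) {x x' : ℝ} (hx : (x : ℂ) ∈ A.base) (hx' : (x' : ℂ) ∈ A.base)
    {y₀ : ℂ} (hy₀ : 0 < y₀.im) {r r' : ℝ} (hr : A.IsSmallRadius x r) (hr' : A.IsSmallRadius x' r')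
    (hdom : P.dom = Set.Icc 0 1 ×ˢ Set.Icc 0 1) (h00 : (0, 0) ∈ P.dom) (h01 : (0, 1) ∈ P.dom)
    (hG0 : G (0, 0) = x) (hG1 : G (0, 1) = x') {ε : ℝ} (hε : 0 < ε)
    (hleft : ∀ v ∈ Set.Icc (0 : ℝ) 1, (G (v, 0)).re = x)
    (htop : ∀ u ∈ Set.Icc (0 : ℝ) 1, G (1, u) = ⟨x - u * (x - x'), ε * (x - x')⟩)
    (hright : ∀ v ∈ Set.Icc (0 : ℝ) 1, (G (v, 1)).re = x')
    (hK : ∀ k i, ε * (|A.ordinate x k - A.ordinate x' i| + r + r') ≤ P.height)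
    (ho : ((0, 0), y₀) ∈ P.topSet) (ho' : ((0, 1), y₀) ∈ P.topSet) (hb : ((0, 1), y₀) = P.base)
    (k : Fin (n + 1))
    (hM : M.alongHom (A.alphaHom hP h00 hG0 hx hy₀ hr ho k) = s (A.lineAt x k))
    (hM' : ∀ j, M.alongHom (A.alphaHom hP h01 hG1 hx' hy₀ hr' ho' j) = s (A.lineAt x' j))
    (a : Fin (n + 1) → RankOneLocalSystem.Chain ℂ P.space 1 ⧸ M.boundaries)
    (ha : ∀ j, a j = (1 - A.param s x' j)⁻¹ •
      M.homClass
        (A.alphaHom hP h01 hG1 hx' hy₀ hr' ho' j)) :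
    (1 - A.param s x k)⁻¹ • M.homClass
        (A.alphaHom hP h00 hG0 hx hy₀ hr ho k) =
      M.homClass (inv (P.fromBase ho)) +
        (M.alongHom (inv (P.fromBase ho)) : ℂ) •
          (a 0 - ∑ j : Fin n, (if j.castSucc < A.perm x x' k then
            ∏ l with k < l ∧ A.perm x x' l ≤ j.castSucc, A.param s x l else 0) •
              (a j.castSucc - a j.succ)) := by
  have hre : ∀ d, ∀ i, (P.pt i d).re = A.slope i * (G d).re + A.intercept i := fun d i => by
    rw [hP, height]; simp
  have hq0 : ∀ i, (P.pt i (0, 0)).re = A.ordinate x i := A.pt_re_eq_ordinate hP hG0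
  have hq1 : ∀ i, (P.pt i (0, 1)).re = A.ordinate x' i := A.pt_re_eq_ordinate hP hG1
  have hm : ∀ k i, (P.pt i (0, 1)).re ≠ A.ordinate x' k - r' := fun k i => by
    rw [hq1]; exact A.ordinate_ne_sub hr' k i
  have hp : ∀ k i, (P.pt i (0, 1)).re ≠ A.ordinate x' k + r' := fun k i => by
    rw [hq1]; exact A.ordinate_ne_add hr' k i
  have hm0 : ∀ i, (P.pt i (0, 0)).re ≠ A.ordinate x (A.lineAt x k) - r := fun i => by
    rw [hq0]; exact A.ordinate_ne_sub hr _ i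
  have hp0 : ∀ i, (P.pt i (0, 0)).re ≠ A.ordinate x (A.lineAt x k) + r := fun i => by
    rw [hq0]; exact A.ordinate_ne_add hr _ i
  let β : Fin (n + 1) → (P.baseObj ⟶ P.baseObj) := fun j =>
    P.vertLoop h01 (hm (A.lineAt x' j)) (hp (A.lineAt x' j))
  have hβ : ∀ j, P.fromBase ho' ≫ A.alphaHom hP h01 hG1 hx' hy₀ hr' ho' j ≫
      inv (P.fromBase ho') = β j := fun j => A.fromBase_alphaHom hP h01 hG1 hx' hy₀ hr' ho' j _ _
  have hβa : ∀ j, (M.alongHom (β j) : ℂ) = A.param s x' j := fun j => by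
    rw [← hβ, M.alongHom_conj, hM', param]
  have hβs : ∀ l, (M.alongHom (β (A.perm x x' l)) : ℂ) = A.param s x l := fun l => by
    rw [hβa, param, param, perm, Equiv.trans_apply, Equiv.apply_symm_apply]
  -- The base point above lies in the fibre over `x'`, so no correction for a change of base point
  -- occurs here.
  have hβD : ∀ j, a j = (1 - (M.alongHom (β j) : ℂ))⁻¹ • M.homClass (β j) := fun j => by
    obtain ⟨e1, e2⟩ := P.fromBase_self M ho' hb
    rw [ha, hβa, M.homClass_conj _ _ _ (hβ j), e1, e2, smul_zero, zero_add, Units.val_one, one_smul]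
  -- One statement serves both crossings: `g` will be the abscissa just left or just right of the
  -- `k`-th point, with `R` the condition `k ≤ l` or `k < l`.
  have word : ∀ (g : ℝ) (hg : ∀ i, (P.pt i (0, 0)).re ≠ g), |A.ordinate x (A.lineAt x k) - g| ≤ r →
      ∀ (R : Fin (n + 1) → Prop) [DecidablePred R],
      (∀ l, g < A.ordinate x (A.lineAt x l) ↔ R l) → ∃ Z : P.baseObj ⟶ P.baseObj,
        P.vert h00 hg = Z ≫ P.vert h01 (hp (A.lineAt x' (Fin.last n))) ∧
        (M.alongHom Z : ℂ) = ∏ l with R l ∧ A.perm x x' l ≤ Fin.last n, A.param s x l ∧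
        M.homClass Z = a 0 - ∑ j : Fin n, (∏ l with R l ∧ A.perm x x' l ≤ j.castSucc,
          A.param s x l) • (a j.castSucc - a j.succ) -
          (∏ l with R l ∧ A.perm x x' l ≤ Fin.last n, A.param s x l) • a (Fin.last n) := by
    intro g hg hgr R _ hR
    -- The height is chosen large enough that the slanted line stays between the levels `P.height`
    -- and `-P.height` at every abscissa used.
    have hb : ∀ i, ∀ c, |c| ≤ r' → |ε * (g - (A.ordinate x' i + c))| ≤ P.height := fun i c hc => by
      refine le_trans ?_ (hK (A.lineAt x k) i)
      rw [abs_mul, abs_of_pos hε]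
      gcongr
      calc |g - (A.ordinate x' i + c)| = |(A.ordinate x (A.lineAt x k) - A.ordinate x' i) -
            (A.ordinate x (A.lineAt x k) - g) - c| := by congr 1; ring
        _ ≤ _ := (abs_sub _ _).trans (add_le_add ((abs_sub _ _).trans (by gcongr)) hc)
    obtain ⟨Z, hZ0, hZs, hZ⟩ := P.exists_word hdom (q := A.ordinate x) (q' := A.ordinate x') hε
      (fun v hv i => by rw [hre, hleft v hv, ordinate])
      (fun u hu i => by
        rw [hP, htop u hu, height]
        apply Complex.ext <;> simp [ordinate] <;> ring)
      (fun v hv i => by rw [hre, hright v hv, ordinate]) h00 h01 hg hr'.1 hr'.2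
      (fun i => ⟨by
        rw [sub_eq_add_neg (A.ordinate x' i)]
        exact hb i _ (by rw [abs_neg, abs_of_pos hr'.1]), hb i _ (abs_of_pos hr'.1).le⟩)
      hm hp (A.lineAt x') (A.strictMono_ordinate_lineAt hx')
    have hR' : ∀ j, g < A.ordinate x (A.lineAt x' j) ↔ R ((A.perm x x').symm j) := fun j => by
      rw [← hR, perm, Equiv.symm_trans_apply, Equiv.apply_symm_apply, Equiv.symm_symm]
    have h0 : Z 0 = if R ((A.perm x x').symm 0) then β 0 else 𝟙 _ :=
      hZ0.trans (if_congr (hR' 0) rfl rfl)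
    have h1 : ∀ j : Fin n, Z j.succ = if R ((A.perm x x').symm j.succ) then
        Z j.castSucc ≫ β j.succ else Z j.castSucc := fun j =>
      (hZs j).trans (if_congr (hR' j.succ) rfl rfl)
    exact ⟨Z (Fin.last n), hZ, M.alongHom_word _ R β Z _ hβs h0 h1 _,
      M.homClass_word _ R β Z _ hβs (A.param_ne_one hs x) h0 h1 a hβD⟩
  obtain ⟨Z, hZ, hZa, hZD⟩ := word _ hm0 (by rw [sub_sub_cancel, abs_of_pos hr.1]) (fun l => k ≤ l)
    (A.ordinate_sub_lt_iff hx hr k)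
  obtain ⟨Z', hZ', hZa', hZD'⟩ := word _ hp0 (by
    rw [sub_add_cancel_left, abs_neg, abs_of_pos hr.1]) (fun l => k < l)
    (A.ordinate_add_lt_iff hx hr k)
  -- Both words end with the same crossing to the right of all points, which cancels.
  have hloop : P.fromBase ho ≫ A.alphaHom hP h00 hG0 hx hy₀ hr ho k ≫ inv (P.fromBase ho) =
      Z ≫ inv Z' := by
    rw [A.fromBase_alphaHom hP h00 hG0 hx hy₀ hr ho k hm0 hp0, hZ, hZ']
    simp
  have hprod : (M.alongHom Z : ℂ) = A.param s x k * M.alongHom Z' := by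
    rw [hZa, hZa', prod_filter_eq_mul (A.perm x x') (A.param s x) k (Fin.last n)
      (P := fun l => k ≤ l) (Q := fun l => k < l) (fun l => by rw [le_iff_eq_or_lt, eq_comm])
      (lt_irrefl k), if_pos (Fin.le_last _)]
  -- The actions of `Z` and `Z'` differ exactly by the parameter of the `k`-th line, the only letter
  -- in `Z` and not in `Z'`.
  have hD : M.homClass (Z ≫ inv Z') = M.homClass Z - A.param s x k • M.homClass Z' := by
    rw [M.homClass_comp, M.homClass_inv, hprod, smul_neg, smul_smul,
      mul_inv_cancel_right₀ (Units.ne_zero _), sub_eq_add_neg]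
  have hk : 1 - A.param s x k ≠ 0 := sub_ne_zero.2 (A.param_ne_one hs x k).symm
  rw [M.homClass_conj _ _ _ hloop, hM, hD, smul_add, ← param,
    inv_smul_smul₀ hk, smul_comm,
    inv_smul_word_sub (A.perm x x') (A.param s x) a k (A.param_ne_one hs x k) _ _ hZD hZD']

end LineArrangement
end

/-! ### Deformation of the path to the real axis -/

noncomputable section

open CategoryTheory Filter Topology

/-- The deformation of a path in the plane between real points `x` and `x'` to a segment near the
real axis. -/
def transit {x x' : ℝ} (γ : Path (x : ℂ) (x' : ℂ)) (ε : ℝ) (d : ℝ × ℝ) : ℂ :=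
  (1 - d.1 : ℝ) * γ.extend d.2 +
    (d.1 : ℝ) * ((x - d.2 * (x - x') : ℝ) + (ε * (x - x') : ℝ) * Complex.I)

section Transit

variable {x x' : ℝ} (γ : Path (x : ℂ) (x' : ℂ)) (ε : ℝ)

theorem continuous_transit : Continuous (transit γ ε) := by
  have := γ.continuous_extend
  unfold transit
  fun_prop

theorem transit_im (v u : ℝ) :
    (transit γ ε (v, u)).im = (1 - v) * (γ.extend u).im + v * (ε * (x - x')) := by
  simp only [transit, Complex.add_im, Complex.im_ofReal_mul, Complex.ofReal_im, Complex.I_im,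
    mul_one, zero_add]

theorem transit_re (v u : ℝ) :
    (transit γ ε (v, u)).re = (1 - v) * (γ.extend u).re + v * (x - u * (x - x')) := by
  simp only [transit, Complex.add_re, Complex.re_ofReal_mul, Complex.ofReal_re, Complex.I_re,
    mul_zero, add_zero]

theorem transit_one (u : ℝ) : transit γ ε (1, u) = ⟨x - u * (x - x'), ε * (x - x')⟩ := by
  apply Complex.ext
  · rw [transit_re]; ring
  · rw [transit_im]; ring

theorem transit_zero (u : unitInterval) : transit γ ε (0, u) = γ u := by
  apply Complex.ext
  · rw [transit_re, Path.extend_apply γ u.2]; ring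
  · rw [transit_im, Path.extend_apply γ u.2]; ring

theorem transit_re_left (v : ℝ) : (transit γ ε (v, 0)).re = x := by
  rw [transit_re, Path.extend_zero, Complex.ofReal_re]; ring

theorem transit_re_right (v : ℝ) : (transit γ ε (v, 1)).re = x' := by
  rw [transit_re, Path.extend_one, Complex.ofReal_re]; ring

end Transit

theorem PointMotion.alongHom_inv_fromBase {ι E K : Type*} [Field K] [AddCommGroup E] [Module ℝ E]
    [TopologicalSpace E] [IsTopologicalAddGroup E] [ContinuousSMul ℝ E] (P : PointMotion ι E)
    (L : RankOneLocalSystem K P.space) {a : E × ℂ} (ha : a ∈ P.topSet) :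
    L.alongHom (inv (P.fromBase ha)) = L.along (segPath (P.top_segment ha P.base_mem)) := by
  rw [fromBase, inv_seg _ (P.top_segment ha P.base_mem)]
  rfl

namespace LineArrangement

variable {n m : ℕ} {A : LineArrangement n m} {x x' : ℝ} {γ : Path (x : ℂ) (x' : ℂ)}

/-- Only real values need care. For `x ≠ x'` the imaginary part times `x - x'` is a sum of two
nonnegative terms, the second being `v ε (x - x')²`; it vanishes only for `v = 0`, on `γ` itself.
For `x = x'` a real value can only be `x`. -/
theorem transit_mem_base (hx : (x : ℂ) ∈ A.base) (hγ : ∀ u, γ u ∈ A.base)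
    (hreal : ∀ u, (γ u).im = 0 → γ u = x ∨ γ u = x') (hside : ∀ u, 0 ≤ (γ u).im * (x - x'))
    {ε : ℝ} (hε : 0 < ε) {d : ℝ × ℝ} (hd : d ∈ Set.Icc (0 : ℝ) 1 ×ˢ Set.Icc (0 : ℝ) 1) :
    transit γ ε d ∈ A.base := by
  obtain ⟨v, u⟩ := d
  obtain ⟨⟨hv0, hv1⟩, hu⟩ : v ∈ Set.Icc (0 : ℝ) 1 ∧ u ∈ Set.Icc (0 : ℝ) 1 := hd
  by_cases him : (transit γ ε (v, u)).im = 0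
  swap
  · exact A.mem_base_of_im_ne_zero him
  have hext : γ.extend u = γ ⟨u, hu⟩ := Path.extend_apply γ hu
  rcases eq_or_ne x x' with h | h
  · have hγu : (1 - v) * (γ ⟨u, hu⟩).im = 0 := by
      rw [transit_im, hext, sub_eq_zero.2 h] at him
      linarith
    suffices transit γ ε (v, u) = x by rwa [this]
    have hre : (1 - v) * (γ ⟨u, hu⟩).re = (1 - v) * x := by
      rcases mul_eq_zero.1 hγu with h1 | h1
      · rw [h1, zero_mul, zero_mul]
      · rcases hreal _ h1 with h2 | h2 <;> rw [h2, Complex.ofReal_re]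
        rw [h]
    apply Complex.ext
    · rw [transit_re, hext, hre, ← h, Complex.ofReal_re]
      ring
    · rw [him, Complex.ofReal_im]
  · have h1 : (1 - v) * ((γ ⟨u, hu⟩).im * (x - x')) + v * (ε * (x - x') ^ 2) = 0 := by
      rw [transit_im, hext] at him
      linear_combination (x - x') * him
    have h2 : 0 ≤ (1 - v) * ((γ ⟨u, hu⟩).im * (x - x')) :=
      mul_nonneg (sub_nonneg.2 hv1) (hside _)
    have h3 : 0 < ε * (x - x') ^ 2 := mul_pos hε (sq_pos_of_ne_zero (sub_ne_zero.2 h))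
    obtain rfl : v = 0 := by
      have h4 : v * (ε * (x - x') ^ 2) ≤ 0 := by linarith
      nlinarith
    rw [transit_zero γ ε ⟨u, hu⟩]
    exact hγ _

/-- The intersections of the lines with the fibres over the deformation of a path, as moving
points. -/
theorem exists_transitMotion (A : LineArrangement n m) {y₀ : ℂ} (hy₀ : 0 < y₀.im)
    (hy : ∀ u i, (A.height i (γ u)).im < y₀.im) (r r' : ℝ) :
    ∃ ε > 0, ∃ P : PointMotion (Fin n) (ℝ × ℝ), P.dom = Set.Icc 0 1 ×ˢ Set.Icc 0 1 ∧
      (∀ d i, P.pt i d = A.height i (transit γ ε d)) ∧ P.base = ((0, 1), y₀) ∧ P.top = y₀.im ∧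
      ∀ k i, ε * (|A.ordinate x k - A.ordinate x' i| + r + r') ≤ P.height := by
  -- Over the horizontal segment the `i`-th point has this constant imaginary part. Over the rest of
  -- the square it is a convex combination with the value over `γ`, so all points stay below `y₀`.
  obtain ⟨ε, hslope, hε⟩ : ∃ ε, (∀ i, A.slope i * (ε * (x - x')) < y₀.im) ∧ 0 < ε := by
    have h : ∀ᶠ ε in 𝓝[>] (0 : ℝ), ∀ i, A.slope i * (ε * (x - x')) < y₀.im := by
      refine eventually_all.2 fun i => Filter.Eventually.filter_mono nhdsWithin_le_nhds ?_
      refine ContinuousAt.eventually_lt (by fun_prop) continuousAt_const ?_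
      simpa using hy₀
    exact (h.and self_mem_nhdsWithin).exists
  have hcomp : IsCompact (Set.Icc (0 : ℝ) 1 ×ˢ Set.Icc (0 : ℝ) 1) := isCompact_Icc.prod isCompact_Icc
  -- `K` is chosen after `ε`: it has to exceed the depth of the points over the compact square and
  -- bound the slanted lines near all points.
  obtain ⟨K, hKy, hKlow, hK⟩ : ∃ K, y₀.im ≤ K ∧
      (∀ i, ∀ d ∈ Set.Icc (0 : ℝ) 1 ×ˢ Set.Icc (0 : ℝ) 1,
        -K < (A.height i (transit γ ε d)).im) ∧
      ∀ k i, ε * (|A.ordinate x k - A.ordinate x' i| + r + r') ≤ K := by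
    refine ((eventually_ge_atTop y₀.im).and ((eventually_all.2 fun i => ?_).and
      (eventually_all.2 fun k => eventually_all.2 fun i => eventually_ge_atTop _))).exists
    obtain ⟨b, hb⟩ := hcomp.bddBelow_image
      (f := fun d => (A.height i (transit γ ε d)).im)
      (Complex.continuous_im.comp ((A.continuous_height i).comp
        (continuous_transit γ ε))).continuousOn
    filter_upwards [eventually_gt_atTop (-b)] with K hK d hd
    have := hb (Set.mem_image_of_mem _ hd)
    linarith
  have hdom : ∀ v u : ℝ, v ∈ Set.Icc (0 : ℝ) 1 → u ∈ Set.Icc (0 : ℝ) 1 →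
      (v, u) ∈ Set.Icc (0 : ℝ) 1 ×ˢ Set.Icc (0 : ℝ) 1 := fun v u hv hu => ⟨hv, hu⟩
  exact ⟨ε, hε,
    { pt := fun i d => A.height i (transit γ ε d)
      dom := Set.Icc 0 1 ×ˢ Set.Icc 0 1
      convex_dom := (convex_Icc 0 1).prod (convex_Icc 0 1)
      top := y₀.im
      height := K
      top_le := hKy
      lt_top := by
        rintro ⟨v, u⟩ ⟨⟨hv0, hv1⟩, hu⟩ i
        have h1 := hy ⟨u, hu⟩ i
        rw [im_height] at h1 ⊢
        rw [transit_im, Path.extend_apply γ hu]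
        have h2 := hslope i
        dsimp only at hv0 hv1 ⊢
        rw [mul_add, mul_left_comm, mul_left_comm (A.slope i) v]
        rcases hv0.eq_or_lt with rfl | hv
        · linarith
        · nlinarith
      neg_height_lt := fun d hd i => hKlow i d hd
      base := ((0, 1), y₀)
      base_mem := ⟨⟨⟨le_rfl, zero_le_one⟩, ⟨zero_le_one, le_rfl⟩⟩, le_rfl (a := y₀.im)⟩
      nadir := ((0, 1), ⟨0, -K⟩)
      nadir_mem := ⟨⟨⟨le_rfl, zero_le_one⟩, ⟨zero_le_one, le_rfl⟩⟩, le_rfl (a := -K)⟩ },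
    rfl, fun _ _ => rfl, rfl, rfl, hK⟩

/-- The straight way between the base points over `(0,0)` and `(0,1)` maps in `A.compl` to the path
`u ↦ (γ u, y₀)`. This turns the change of base point into the prescribed identification of stalks.
-/
theorem alongHom_inv_fromBase [NeZero n] {P : PointMotion (Fin n) (ℝ × ℝ)} {G : ℝ × ℝ → ℂ}
    (hP : ∀ d i, P.pt i d = A.height i (G d)) (hG : Continuous G)
    (hbase : ∀ d ∈ P.dom, G d ∈ A.base) (s : Fin n → ℂˣ) (t : Fin m → ℂˣ) {y₀ : ℂ}
    (ho : ((0, 0), y₀) ∈ P.topSet) (hb : P.base = ((0, 1), y₀))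
    (hGγ : ∀ u : unitInterval, G (0, u) = γ u) {a b : A.compl} (q : Path a b)
    (hq : ∀ u, (q u : ℂ × ℂ) = (γ u, y₀)) :
    (PointMotion.motionSystem hP hG hbase s t).alongHom (inv (P.fromBase ho)) =
      (A.localSystem s t).along q := by
  rw [P.alongHom_inv_fromBase, PointMotion.motionSystem, RankOneLocalSystem.along_pullback]
  refine RankOneLocalSystem.along_eq_of_forall _ _ _ fun u => Subtype.ext ?_
  rw [hq, ← hGγ]
  change ((G ((1 - (u : ℝ)) • (((0 : ℝ), (0 : ℝ)), y₀) + (u : ℝ) • P.base).1,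
    ((1 - (u : ℝ)) • (((0 : ℝ), (0 : ℝ)), y₀) + (u : ℝ) • P.base).2) : ℂ × ℂ) = _
  rw [hb]
  simp [← add_mul]

end LineArrangement

/-! ### The transport formula -/

theorem mainTheorem7 {n m : ℕ} (A : LineArrangement (n + 1) m)
    (s : Fin (n + 1) → ℂˣ) (t : Fin m → ℂˣ) (hs : ∀ i, s i ≠ 1)
    (x x' : ℝ) (hx : (x : ℂ) ∈ A.base) (hx' : (x' : ℂ) ∈ A.base)
    (γ : Path (x : ℂ) (x' : ℂ)) (hγ : ∀ u, γ u ∈ A.base)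
    (hreal : ∀ u, (γ u).im = 0 → γ u = x ∨ γ u = x')
    (hside : ∀ u, 0 ≤ (γ u).im * (x - x'))
    (y₀ : ℂ) (hy₀ : 0 < y₀.im) (hy : ∀ u i, (A.height i (γ u)).im < y₀.im)
    (r r' : ℝ) (hr : A.IsSmallRadius x r) (hr' : A.IsSmallRadius x' r') :
    Nonempty (A.FibreTransport γ) ∧
      ∀ (T : A.FibreTransport γ) (c : ℂ) (i : Fin n),
        T.onH1 s t (A.alphaClass s t hx hy₀ hr c i) =
          LineArrangement.consecutiveSign (A.perm x x') i •
            ∑ j : Fin n with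
                min (A.perm x x' i.castSucc) (A.perm x x' i.succ) ≤ j.castSucc ∧
                  j.castSucc < max (A.perm x x' i.castSucc) (A.perm x x' i.succ),
              (∏ k : Fin (n + 1) with i.castSucc < k ∧ A.perm x x' k ≤ j.castSucc,
                A.param s x k) •
                A.alphaClass s t hx' hy₀ hr'
                  (c * (A.localSystem s t).along (A.baseTrack hx hx' γ hγ hy₀ hy)) j := by
  refine ⟨A.nonempty_fibreTransport γ hγ, fun T c i => ?_⟩
  obtain ⟨ε, hε, P, hdom, hP, hb, htop, hK⟩ :=
    A.exists_transitMotion hy₀ hy r r'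
  have hG := continuous_transit γ ε
  have hbase : ∀ d ∈ P.dom, transit γ ε d ∈ A.base := fun d hd =>
    A.transit_mem_base hx hγ hreal hside hε (hdom ▸ hd)
  have hδ : ∀ u : unitInterval, ((0 : ℝ), (u : ℝ)) ∈ P.dom := fun u => by
    rw [hdom]; exact ⟨⟨le_rfl, zero_le_one⟩, u.2⟩
  have ho : ∀ u : unitInterval, (((0 : ℝ), (u : ℝ)), y₀) ∈ P.topSet := fun u =>
    ⟨hδ u, htop.le⟩
  have h0 : transit γ ε (0, ((0 : unitInterval) : ℝ)) = x := by rw [transit_zero, γ.source]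
  have h1 : transit γ ε (0, ((1 : unitInterval) : ℝ)) = x' := by rw [transit_zero, γ.target]
  have htr := A.alongHom_inv_fromBase hP hG hbase s t (ho 0) hb (transit_zero γ ε)
    (A.baseTrack hx hx' γ hγ hy₀ hy) fun u => rfl
  -- An arbitrary transport enters only through the class `v` of the track of the base point, which
  -- is common to all loops.
  obtain ⟨v, hv⟩ := PointMotion.exists_fibreMap_transport hP hG hbase s t T
    (δ := fun u => (0, (u : ℝ))) (by fun_prop) hδ (transit_zero γ ε) (A.basePoint hx hy₀)
    (fun p => (A.localSystem s t).along_mul_evalAt T.lift p) h0 h1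
  let a : Fin (n + 1) →
      RankOneLocalSystem.Chain ℂ P.space 1 ⧸
        (PointMotion.motionSystem hP hG hbase s t).boundaries := fun j =>
    (1 - A.param s x' j)⁻¹ • (PointMotion.motionSystem hP hG hbase s t).homClass
        (A.alphaHom hP (hδ 1) h1 hx' hy₀ hr' (ho 1) j)
  have key := fun k => A.inv_smul_homClass_alphaHom hP
    (PointMotion.motionSystem hP hG hbase s t) s hs hx hx' hy₀ hr hr' hdom (hδ 0) (hδ 1) h0 h1 hε
    (fun v _ => transit_re_left γ ε v) (fun u _ => transit_one γ ε u)
    (fun v _ => transit_re_right γ ε v) hK (ho 0) (ho 1) hb.symm k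
    (A.alongHom_alphaHom hP (hδ 0) h0 hx hy₀ hr (ho 0) k hG hbase s t)
    (fun j => A.alongHom_alphaHom hP (hδ 1) h1 hx' hy₀ hr' (ho 1) j hG hbase s t) a fun _ => rfl
  -- The correction is `(1 - s_k) v`, so the normalised loops are all shifted by the same `v`.
  have hleft : ∀ k, (1 - A.param s x k)⁻¹ • PointMotion.fibreMap hP hG hbase s t (hδ 1) h1
      (RankOneLocalSystem.mapChainQuotient (A.fibreSystem s t x) (A.fibreSystem s t x') T.endMap
        (fun y => (A.localSystem s t).along (T.lift.evalAt y))
        (fun p => (A.localSystem s t).along_mul_evalAt T.lift p)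
        ((A.fibreSystem s t x).pathClass (A.alpha hx hy₀ hr k))) =
      (1 - A.param s x k)⁻¹ • (PointMotion.motionSystem hP hG hbase s t).homClass
        (A.alphaHom hP (hδ 0) h0 hx hy₀ hr (ho 0) k) - v := fun k => by
    rw [hv, LineArrangement.alpha, A.along_loop, smul_sub, ← LineArrangement.param,
      inv_smul_smul₀ (sub_ne_zero.2 (A.param_ne_one hs x k).symm)]
    rfl
  have hright : ∀ c j, PointMotion.fibreMap hP hG hbase s t (hδ 1) h1
      ((A.fibreSystem s t x').toChainQuotient (A.alphaClass s t hx' hy₀ hr' c j)) =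
      c • (a j.castSucc - a j.succ) := fun c j => by
    rw [A.toChainQuotient_alphaClass s t hs, map_smul, map_sub, map_smul, map_smul,
      PointMotion.fibreMap_pathClass, PointMotion.fibreMap_pathClass]
    rfl
  have hT : (A.fibreSystem s t x').toChainQuotient (T.onH1 s t (A.alphaClass s t hx hy₀ hr c i)) =
      RankOneLocalSystem.mapChainQuotient (A.fibreSystem s t x) (A.fibreSystem s t x') T.endMap
        (fun y => (A.localSystem s t).along (T.lift.evalAt y))
        (fun p => (A.localSystem s t).along_mul_evalAt T.lift p)
        ((A.fibreSystem s t x).toChainQuotient (A.alphaClass s t hx hy₀ hr c i)) :=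
    RankOneLocalSystem.toChainQuotient_mapH1 _ _ _ _ _ _
  -- Both sides are compared in the total space, through two injections.
  apply (A.fibreSystem s t x').toChainQuotient_injective
  apply PointMotion.fibreMap_injective hP hG hbase s t
    (hdom ▸ isCompact_Icc.prod isCompact_Icc) (hδ 1) h1
  -- In the difference of the `i`-th and the next loop both `v` and the class of the base track drop
  -- out; the action of the base track remains as a factor.
  rw [hT, A.toChainQuotient_alphaClass s t hs, map_smul, map_smul, map_sub, map_sub, map_smul, map_smul,
    map_smul, map_smul, hleft, hleft, key, key, htr, sub_sub_sub_cancel_right,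
    add_sub_add_left_eq_sub, ← smul_sub, sub_eq_sign_smul_sum, smul_smul, map_smul, map_smul,
    map_sum, map_sum, LineArrangement.consecutiveSign, smul_comm, Finset.smul_sum]
  congr 1
  refine Finset.sum_congr rfl fun j _ => ?_
  rw [map_smul, map_smul, hright, smul_comm]
end
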